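/- Let $G$ be an undirected weighted graph without self-loops, with vertex set $V$, $n=|V|$, and symmetric adjacency matrix $A\in\mathbb{R}^{V\times V}$ with zero diagonal (weights may be negative). Put $d_i=\sum_j |A_{ij}|$ and $D=\mathrm{diag}(d_i)_{i\in V}$. The gain of a cut $(L,R)$ of $V$, with $y\in\{-1,1\}^V$, $y_i=1$ if $i\in L$ and $y_i=-1$ if $i\in R$, is $$\mathrm{gain}_G(y)=-\frac{y^TAy}{y^TDy}$$ (taken to be $0$ if all weights are zero), and $\mathrm{maxcutgain}(G)=\max_{y\in\{-1,1\}^V}\mathrm{gain}_G(y)$. (For non-negative weights, a cut has gain $\varepsilon$ if and only if it cuts a $\frac12+\frac{\varepsilon}{2}$ fraction of the total edge weight.) Theorem 12 (Max CutGain). There are an absolute constant $C$ and a randomized algorithm which, given the adjacency matrix of any such graph $G$, runs in time $\tilde O(n^3)$ (that is, $O(n^3(\log n)^{k})$ for some absolute constant $k$, the bound holding for all inputs and all coin tosses), and which has the following property: for every $\varepsilon>0$ and every $G$ with $\mathrm{maxcutgain}(G)\ge\varepsilon$, the algorithm outputs, with probability at least $2/3$, a cut of the whole vertex set $V$ of gain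 at least $e^{-C/\varepsilon}$. Here an algorithm is a program for a random access machine that performs the arithmetic operations, square roots and comparisons on real numbers exactly and at unit cost, performs increments, decrements and comparisons of integer indices and indexed memory accesses at unit cost, and tosses fair coins. -/

import Mathlib

open Matrix

/-! ## Weighted graphs and Max Cut Gain -/

/-- A weighted graph on the vertex set `{0, …, n-1}`, without self-loops, given by its adjacency
matrix; edge weights are arbitrary reals, possibly negative. -/
structure WGraph (n : ℕ) where
  adj : Matrix (Fin n) (Fin n) ℝ
  symm : adj.IsSymm
  loopless : ∀ i, adj i i = 0

namespace WGraph

variable {n : ℕ}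

/-- The weighted degree `d_i = ∑_j |A_ij|`. -/
noncomputable def deg (G : WGraph n) (i : Fin n) : ℝ := ∑ j, |G.adj i j|

/-- The diagonal matrix `D` of the weighted degrees. -/
noncomputable def degMatrix (G : WGraph n) : Matrix (Fin n) (Fin n) ℝ := diagonal G.deg

/-- The `±1` vector of the cut `({i | c i = true}, {i | c i = false})` of the vertex set. -/
def cutVec (c : Fin n → Bool) : Fin n → ℝ := fun i => if c i then 1 else -1

/-- The gain `-(yᵀ A y) / (yᵀ D y)` of a cut with `±1` vector `y`: cut weight minus uncut weight,
divided by the total absolute weight of the edges (and `0` if that total is `0`). -/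
noncomputable def gain (G : WGraph n) (c : Fin n → Bool) : ℝ :=
  -(cutVec c ⬝ᵥ G.adj *ᵥ cutVec c) / (cutVec c ⬝ᵥ G.degMatrix *ᵥ cutVec c)

/-- The optimum of Max Cut Gain: the maximum of the gain over the (finitely many) cuts. -/
noncomputable def maxCutGain (G : WGraph n) : ℝ := ⨆ c : Fin n → Bool, G.gain c

end WGraph

/-! ## Randomized real random access machines

A program is a structured program over a memory with two sorts of data: natural numbers (used as
indices) and real numbers.  Each sort has registers and arrays with two subscripts.  An index can
only be copied, incremented and decremented, so that in `t` steps no index grows by more than `t`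
(machine words of logarithmic length); there is no conversion of reals to indices.  Every
instruction and every test costs one step. -/

namespace RealRAM

/-- Registers, arrays and the sequence of coin tosses that have not been read yet. -/
structure State where
  idx : ℕ → ℕ
  idxArr : ℕ → ℕ → ℕ → ℕ
  reg : ℕ → ℝ
  arr : ℕ → ℕ → ℕ → ℝ
  coins : ℕ → Bool

/-- The arithmetic operations on reals. -/
inductive Op
  | add | sub | mul | div

/-- The value of an arithmetic operation. -/
noncomputable def Op.eval : Op → ℝ → ℝ → ℝ
  | .add, a, b => a + b
  | .sub, a, b => a - b
  | .mul, a, b => a * b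
  | .div, a, b => a / b

/-- The elementary instructions; all arguments are names of registers or arrays, except for the
rational constant in `const`. -/
inductive Instr
  | zero (x : ℕ)                  -- index register `x := 0`
  | copy (x y : ℕ)                -- `x := y`
  | succ (x : ℕ)                  -- `x := x + 1`
  | pred (x : ℕ)                  -- `x := x - 1` (truncated)
  | iload (x a i j : ℕ)           -- `x := a[i][j]`, index array `a`, index registers `i`, `j`
  | istore (a i j x : ℕ)          -- `a[i][j] := x`
  | flip (x : ℕ)                  -- `x :=` the next coin toss, as `0` or `1`
  | const (r : ℕ) (q : ℚ)         -- real register `r := q`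
  | op (o : Op) (r s t : ℕ)       -- `r := s o t`
  | sqrt (r s : ℕ)                -- `r := √s`
  | load (r a i j : ℕ)            -- `r := a[i][j]`, real array `a`, index registers `i`, `j`
  | store (a i j r : ℕ)           -- `a[i][j] := r`

/-- Write `v` into the entry `[i][j]` of array `a`. -/
def write {α : Type} (m : ℕ → ℕ → ℕ → α) (a i j : ℕ) (v : α) : ℕ → ℕ → ℕ → α :=
  fun a' i' j' => if a' = a ∧ i' = i ∧ j' = j then v else m a' i' j'

/-- The effect of an elementary instruction. -/
noncomputable def Instr.exec (s : State) : Instr → State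
  | .zero x => { s with idx := Function.update s.idx x 0 }
  | .copy x y => { s with idx := Function.update s.idx x (s.idx y) }
  | .succ x => { s with idx := Function.update s.idx x (s.idx x + 1) }
  | .pred x => { s with idx := Function.update s.idx x (s.idx x - 1) }
  | .iload x a i j =>
      { s with idx := Function.update s.idx x (s.idxArr a (s.idx i) (s.idx j)) }
  | .istore a i j x => { s with idxArr := write s.idxArr a (s.idx i) (s.idx j) (s.idx x) }
  | .flip x =>
      { s with
        idx := Function.update s.idx x (if s.coins 0 then 1 else 0)
        coins := fun k => s.coins (k + 1) }
  | .const r q => { s with reg := Function.update s.reg r (q : ℝ) }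
  | .op o r u v => { s with reg := Function.update s.reg r (o.eval (s.reg u) (s.reg v)) }
  | .sqrt r u => { s with reg := Function.update s.reg r (Real.sqrt (s.reg u)) }
  | .load r a i j => { s with reg := Function.update s.reg r (s.arr a (s.idx i) (s.idx j)) }
  | .store a i j r => { s with arr := write s.arr a (s.idx i) (s.idx j) (s.reg r) }

/-- The elementary tests: comparison of two index registers or of two real registers. -/
inductive Test
  | ilt (x y : ℕ)
  | rlt (r s : ℕ)

/-- When a test succeeds. -/
def Test.holds (s : State) : Test → Prop
  | .ilt x y => s.idx x < s.idx y
  | .rlt r u => s.reg r < s.reg u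

/-- Programs. -/
inductive Prog
  | skip
  | instr (c : Instr)
  | seq (p q : Prog)
  | ite (b : Test) (p q : Prog)
  | while (b : Test) (p : Prog)

/-- `Exec p s t s'`: started in the state `s`, the program `p` halts after exactly `t` steps in the
state `s'`. -/
inductive Exec : Prog → State → ℕ → State → Prop
  | skip (s : State) : Exec .skip s 0 s
  | instr (c : Instr) (s : State) : Exec (.instr c) s 1 (c.exec s)
  | seq {p q : Prog} {s s' s'' : State} {t t' : ℕ} :
      Exec p s t s' → Exec q s' t' s'' → Exec (.seq p q) s (t + t') s''
  | ite_true {b : Test} {p q : Prog} {s s' : State} {t : ℕ} :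
      b.holds s → Exec p s t s' → Exec (.ite b p q) s (1 + t) s'
  | ite_false {b : Test} {p q : Prog} {s s' : State} {t : ℕ} :
      ¬ b.holds s → Exec q s t s' → Exec (.ite b p q) s (1 + t) s'
  | while_true {b : Test} {p : Prog} {s s' s'' : State} {t t' : ℕ} :
      b.holds s → Exec p s t s' → Exec (.while b p) s' t' s'' →
      Exec (.while b p) s (1 + t + t') s''
  | while_false {b : Test} {p : Prog} {s : State} :
      ¬ b.holds s → Exec (.while b p) s 1 s

/-- Execution is deterministic, once the coin tosses are fixed. -/
theorem Exec.unique {p : Prog} {s s₁ s₂ : State} {t₁ t₂ : ℕ}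
    (h₁ : Exec p s t₁ s₁) (h₂ : Exec p s t₂ s₂) : t₁ = t₂ ∧ s₁ = s₂ := by
  induction h₁ generalizing t₂ s₂ with
  | skip => cases h₂; exact ⟨rfl, rfl⟩
  | instr => cases h₂; exact ⟨rfl, rfl⟩
  | seq _ _ ih ih' =>
    cases h₂ with
    | seq h h' =>
      obtain ⟨rfl, rfl⟩ := ih h
      obtain ⟨rfl, rfl⟩ := ih' h'
      exact ⟨rfl, rfl⟩
  | ite_true hb _ ih =>
    cases h₂ with
    | ite_true _ h => obtain ⟨rfl, rfl⟩ := ih h; exact ⟨rfl, rfl⟩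
    | ite_false hb' _ => exact absurd hb hb'
  | ite_false hb _ ih =>
    cases h₂ with
    | ite_true hb' _ => exact absurd hb' hb
    | ite_false _ h => obtain ⟨rfl, rfl⟩ := ih h; exact ⟨rfl, rfl⟩
  | while_true hb _ _ ih ih' =>
    cases h₂ with
    | while_true _ h h' =>
      obtain ⟨rfl, rfl⟩ := ih h
      obtain ⟨rfl, rfl⟩ := ih' h'
      exact ⟨rfl, rfl⟩
    | while_false hb' => exact absurd hb hb'
  | while_false hb =>
    cases h₂ with
    | while_true hb' _ _ => exact absurd hb' hb
    | while_false _ => exact ⟨rfl, rfl⟩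

/-- The initial state on input `G` with coin tosses `ω`: index register `0` holds the number `n` of
vertices, the entries `[i][j]` with `i, j < n` of the real array `0` hold the adjacency matrix, and
all else is `0`. -/
noncomputable def init {n : ℕ} (G : WGraph n) (ω : ℕ → Bool) : State where
  idx := fun x => if x = 0 then n else 0
  idxArr := fun _ _ _ => 0
  reg := fun _ => 0
  arr := fun a i j => if h : a = 0 ∧ i < n ∧ j < n then G.adj ⟨i, h.2.1⟩ ⟨j, h.2.2⟩ else 0
  coins := ω

/-- The cut of the whole vertex set that is written in a (final) state: the side of vertex `i` is
given by whether the entry `[i][0]` of the index array `0` is nonzero. -/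
def outputCut (n : ℕ) (s : State) : Fin n → Bool := fun i => decide (s.idxArr 0 i 0 ≠ 0)

/-- The distribution of a sequence of independent fair coin tosses. -/
noncomputable def coinMeasure : MeasureTheory.Measure (ℕ → Bool) :=
  MeasureTheory.Measure.infinitePi fun _ : ℕ => (PMF.uniformOfFintype Bool).toMeasure

end RealRAM

/-! ## Trace inequalities -/

namespace Matrix

section TraceInequalities

variable {ι : Type*} [Fintype ι]

/-! Put `B = -A`. A cut `y` of gain ε gives the vector `D^{1/2} y` the Rayleigh quotient 1 + ε with
respect to `H = 1 + D^{-1/2} B D^{-1/2}`, whose spectrum lies in [0, 2]. For `P = H^m` with `m` of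
order (log n)/ε this forces `tr (H P) ≥ (1 + ε/4) tr P` up to adjusting ε (`mul_trace_pow_le`).
Hence the rows `u_i` of `D^{-1/2} H^{m/2}`, rescaled, satisfy `∑ d_i |u_i|² ≤ vol` and `∑ B_ij ⟨u_i,
u_j⟩ ≥ (ε/4) vol`: a solution of the semidefinite relaxation in which only the average length is
controlled.

Rounding also needs `|u_i|² ≤ K = 40/ε` at each vertex; vertices violating this are heavy. If they
carry at most ε²/256 of `tr P`, deleting them costs only (ε/8) vol (`isRelaxSol_relaxVec`).
Otherwise their coordinates in `H` are damped by `1 - 1/m` on both sides. By a Lieb-Thirring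
inequality this removes at least half of their share `Y` from the trace
(`trace_stepMat_damp_pow_le`), while heaviness bounds their total degree by `Y vol / K`, so the
optimal cut loses little. The trace starts below `n 2^m ≤ e^{2m}` and never falls below 1, so the
shares add up to at most `4m` before any phase; thus the Rayleigh quotient stays at least 1 + ε/2,
and after polylogarithmically many phases a relaxation solution must have appeared (`Progress.step`,
`not_progress`).

The solution is rounded by signs: for `g = ∑ s_l u^l` over the columns with random signs, `gᵀ B g`
has the objective as its mean and the fourth moments of `g_i` are at most `3 K |u_i|²`, so
truncation at `T = 64/ε` loses little and leaves a value of order ε³ vol. The signs come from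
conditional expectations of an explicit potential (`signPot_le`), and a greedy pass makes the vector
±1. No coin is ever tossed, and the success probability is 1.

The guesses ε = 1/a are tried for `a ≤ l = log₂ n + O(1)`. For smaller ε the target `e^{-C/ε}` is
below `n^{-4}`, which a cut built around a single vertex attains (`exists_le_quad_starVec`). The
remaining work is a small verified compiler from loop programs to the machine, with cubic cost per
phase. -/

theorem trace_transpose_mul_self_nonneg (X : Matrix ι ι ℝ) : 0 ≤ (Xᵀ * X).trace := by
  simp only [trace, diag_apply, mul_apply, transpose_apply]
  exact Finset.sum_nonneg fun i _ => Finset.sum_nonneg fun j _ => mul_self_nonneg _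

theorem trace_mul_self_le (X : Matrix ι ι ℝ) : (X * X).trace ≤ (Xᵀ * X).trace := by
  have h := trace_transpose_mul_self_nonneg (X - Xᵀ)
  have h1 : (Xᵀ * Xᵀ).trace = (X * X).trace := by
    rw [← transpose_mul, trace_transpose]
  have h2 : (X * Xᵀ).trace = (Xᵀ * X).trace := trace_mul_comm _ _
  simp only [transpose_sub, transpose_transpose, sub_mul, mul_sub, trace_sub] at h
  linarith

theorem two_mul_trace_mul_le {A B : Matrix ι ι ℝ} (hA : Aᵀ = A) (hB : Bᵀ = B) :
    2 * (A * B).trace ≤ (A * A).trace + (B * B).trace := by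
  have h := trace_transpose_mul_self_nonneg (A - B)
  have h2 : (B * A).trace = (A * B).trace := trace_mul_comm _ _
  simp only [transpose_sub, hA, hB, sub_mul, mul_sub, trace_sub] at h
  linarith

variable [DecidableEq ι]

theorem trace_mul_pow_comm (A B : Matrix ι ι ℝ) (k : ℕ) :
    ((A * B) ^ k).trace = ((B * A) ^ k).trace := by
  cases k with
  | zero => simp
  | succ k =>
    rw [pow_succ, ← mul_assoc, mul_pow_mul, mul_assoc, trace_mul_comm, mul_assoc, ← pow_succ]

/-- The two inequalities are proved together because each feeds the other: the first for `X²`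
reduces to the second for `XᵀX` and `XXᵀ`, and the second for `A, B` reduces to the first for `AB`
and the second for `A², B²`. Exponents are powers of two so that squaring carries the induction. -/
theorem trace_pow_le_and_trace_mul_pow_le (j : ℕ) :
    (∀ X : Matrix ι ι ℝ, (X ^ 2 ^ (j + 1)).trace ≤ ((Xᵀ * X) ^ 2 ^ j).trace) ∧
    ∀ A B : Matrix ι ι ℝ, Aᵀ = A → Bᵀ = B →
      ((A * B) ^ 2 ^ j).trace ≤ (A ^ 2 ^ j * B ^ 2 ^ j).trace := by
  induction j with
  | zero =>
    refine ⟨fun X => ?_, fun A B _ _ => by simp⟩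
    simpa [sq] using trace_mul_self_le X
  | succ j ih =>
    obtain ⟨ih₁, ih₂⟩ := ih
    constructor
    · intro X
      have e1 : X ^ 2 ^ (j + 1 + 1) = (X ^ 2) ^ 2 ^ (j + 1) := by
        rw [← pow_mul]; congr 1; ring
      have e2 : ((X ^ 2)ᵀ * X ^ 2) = Xᵀ * (Xᵀ * X * X) := by
        simp only [sq, transpose_mul, mul_assoc]
      have e3 : (Xᵀ * X * X) * Xᵀ = (Xᵀ * X) * (X * Xᵀ) := by simp only [mul_assoc]
      have e4 : ((X * Xᵀ) ^ 2 ^ (j + 1)).trace = ((Xᵀ * X) ^ 2 ^ (j + 1)).trace :=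
        trace_mul_pow_comm _ _ _
      have h1 := ih₁ (X ^ 2)
      rw [e2, trace_mul_pow_comm Xᵀ, e3] at h1
      have s1 : (Xᵀ * X)ᵀ = Xᵀ * X := by simp
      have s2 : (X * Xᵀ)ᵀ = X * Xᵀ := by simp
      have h2 := ih₂ _ _ s1 s2
      -- The traces of equal powers of `XᵀX` and `XXᵀ` agree, so both squares on the right have the
      -- same trace.
      have h3 := two_mul_trace_mul_le (A := (Xᵀ * X) ^ 2 ^ j) (B := (X * Xᵀ) ^ 2 ^ j)
        (by rw [transpose_pow, s1]) (by rw [transpose_pow, s2])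
      rw [← pow_add, ← pow_add, ← two_mul, ← pow_succ', e4] at h3
      rw [e1]
      linarith
    · intro A B hA hB
      have h1 := ih₁ (A * B)
      have e2 : (A * B)ᵀ * (A * B) = B * (A ^ 2 * B) := by
        simp only [transpose_mul, hA, hB, sq, mul_assoc]
      have e3 : (A ^ 2 * B) * B = A ^ 2 * B ^ 2 := by simp only [sq, mul_assoc]
      rw [e2, trace_mul_pow_comm B, e3] at h1
      have h2 := ih₂ (A ^ 2) (B ^ 2) (by rw [transpose_pow, hA]) (by rw [transpose_pow, hB])
      rw [← pow_mul, ← pow_mul, ← pow_succ'] at h2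
      exact h1.trans h2

/-- A case of the Lieb-Thirring inequality. -/
theorem trace_mul_pow_le {A B : Matrix ι ι ℝ} (hA : Aᵀ = A) (hB : Bᵀ = B) (j : ℕ) :
    ((A * B) ^ 2 ^ j).trace ≤ (A ^ 2 ^ j * B ^ 2 ^ j).trace :=
  (trace_pow_le_and_trace_mul_pow_le j).2 A B hA hB

/-- Conjugation by a diagonal matrix. -/
theorem trace_diagonal_conj_pow_le {H : Matrix ι ι ℝ} (hH : Hᵀ = H) (r : ι → ℝ) (j : ℕ) :
    ((diagonal r * H * diagonal r) ^ 2 ^ j).trace ≤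
      ∑ i, (H ^ 2 ^ j) i i * r i ^ (2 * 2 ^ j) := by
  -- Taking `B = diag(r)²` and moving one factor `diag(r)` around the trace turns `HB` into the
  -- symmetric conjugate.
  have h := trace_mul_pow_le hH (B := diagonal r ^ 2) (by simp) j
  have e : H * diagonal r ^ 2 = (H * diagonal r) * diagonal r := by rw [sq, mul_assoc]
  rw [e, trace_mul_pow_comm, ← mul_assoc, ← pow_mul, diagonal_pow] at h
  refine h.trans_eq ?_
  simp [trace, mul_diagonal]

/-! ## Traces of powers -/

theorem exists_diagonalization {H : Matrix ι ι ℝ} (hH : Hᵀ = H) :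
    ∃ (U : Matrix ι ι ℝ) (l : ι → ℝ), Uᵀ * U = 1 ∧ U * Uᵀ = 1 ∧ H = U * diagonal l * Uᵀ := by
  have h : H.IsHermitian := by
    rw [IsHermitian, conjTranspose_eq_transpose_of_trivial, hH]
  refine ⟨h.eigenvectorUnitary, h.eigenvalues, ?_, ?_, ?_⟩
  · have := Unitary.coe_star_mul_self h.eigenvectorUnitary
    rwa [star_eq_conjTranspose, conjTranspose_eq_transpose_of_trivial] at this
  · have := Unitary.coe_mul_star_self h.eigenvectorUnitary
    rwa [Unitary.coe_star, star_eq_conjTranspose, conjTranspose_eq_transpose_of_trivial] at this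
  · have := h.spectral_theorem
    rw [Unitary.conjStarAlgAut_apply, star_eq_conjTranspose,
      conjTranspose_eq_transpose_of_trivial] at this
    exact this

theorem pow_conj_diagonal {U : Matrix ι ι ℝ} (l : ι → ℝ) (h₁ : Uᵀ * U = 1) (h₂ : U * Uᵀ = 1)
    (k : ℕ) : (U * diagonal l * Uᵀ) ^ k = U * diagonal (l ^ k) * Uᵀ := by
  induction k with
  | zero => simp [h₂]
  | succ k ih =>
    rw [pow_succ, ih, pow_succ, show U * diagonal (l ^ k) * Uᵀ * (U * diagonal l * Uᵀ) =
      U * diagonal (l ^ k) * (Uᵀ * U) * diagonal l * Uᵀ by simp only [mul_assoc], h₁, mul_one,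
      mul_assoc U, diagonal_mul_diagonal]
    rfl

theorem trace_conj_diagonal_pow {U : Matrix ι ι ℝ} (l : ι → ℝ) (h₁ : Uᵀ * U = 1)
    (h₂ : U * Uᵀ = 1) (k : ℕ) : ((U * diagonal l * Uᵀ) ^ k).trace = ∑ i, l i ^ k := by
  rw [pow_conj_diagonal l h₁ h₂, trace_mul_comm, ← mul_assoc, h₁, one_mul]
  simp [trace]

theorem dotProduct_conj_diagonal_mulVec (U : Matrix ι ι ℝ) (l z : ι → ℝ) :
    z ⬝ᵥ (U * diagonal l * Uᵀ) *ᵥ z = ∑ i, l i * (Uᵀ *ᵥ z) i ^ 2 := by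
  rw [← mulVec_mulVec, ← mulVec_mulVec, dotProduct_mulVec, ← mulVec_transpose]
  simp only [dotProduct, mulVec_diagonal]
  exact Finset.sum_congr rfl fun i _ => by ring

/-- The properties of symmetric matrices with spectrum in `[0, 2]` that are expressible by traces
of powers. -/
theorem exists_eigenvalues {H : Matrix ι ι ℝ} (hH : Hᵀ = H) (h0 : ∀ z, 0 ≤ z ⬝ᵥ H *ᵥ z)
    (h2 : ∀ z, z ⬝ᵥ H *ᵥ z ≤ 2 * (z ⬝ᵥ z)) :
    ∃ l : ι → ℝ, (∀ i, 0 ≤ l i) ∧ (∀ i, l i ≤ 2) ∧ (∀ k, (H ^ k).trace = ∑ i, l i ^ k) ∧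
      ∀ (z : ι → ℝ) (μ : ℝ), 0 < z ⬝ᵥ z → μ * (z ⬝ᵥ z) ≤ z ⬝ᵥ H *ᵥ z → ∃ i, μ ≤ l i := by
  obtain ⟨U, l, h₁, h₂, rfl⟩ := exists_diagonalization hH
  -- The test vector is the `i`-th column of `U`, an eigenvector for `l i`.
  have key : ∀ i, ∃ z : ι → ℝ, z ⬝ᵥ z = 1 ∧ z ⬝ᵥ (U * diagonal l * Uᵀ) *ᵥ z = l i := by
    intro i
    have hz : Uᵀ *ᵥ (U *ᵥ Pi.single i 1) = Pi.single i 1 := by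
      rw [mulVec_mulVec, h₁, one_mulVec]
    refine ⟨U *ᵥ Pi.single i 1, ?_, ?_⟩
    · rw [dotProduct_mulVec, ← mulVec_transpose, hz]; simp
    · rw [dotProduct_conj_diagonal_mulVec, hz]
      simp [Pi.single_apply]
  refine ⟨l, fun i => ?_, fun i => ?_, trace_conj_diagonal_pow l h₁ h₂, fun z μ hz hμ => ?_⟩
  · obtain ⟨z, -, h⟩ := key i
    exact h ▸ h0 z
  · obtain ⟨z, h', h⟩ := key i
    have := h2 z
    rw [h, h'] at this
    linarith
  · by_contra! hc
    have hn : z ⬝ᵥ z = ∑ i, (Uᵀ *ᵥ z) i ^ 2 := by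
      have := dotProduct_conj_diagonal_mulVec U 1 z
      rw [show diagonal (1 : ι → ℝ) = 1 from diagonal_one, mul_one, h₂, one_mulVec] at this
      simpa using this
    rw [dotProduct_conj_diagonal_mulVec, hn, Finset.mul_sum] at hμ
    rw [hn] at hz
    obtain ⟨i, -, hi⟩ := Finset.exists_ne_zero_of_sum_ne_zero hz.ne'
    have hpos : 0 < (Uᵀ *ᵥ z) i ^ 2 := lt_of_le_of_ne (sq_nonneg _) (Ne.symm hi)
    refine absurd hμ (not_le.2 (Finset.sum_lt_sum (fun k _ => ?_) ⟨i, Finset.mem_univ i, ?_⟩))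
    · exact mul_le_mul_of_nonneg_right (hc k).le (sq_nonneg _)
    · exact mul_lt_mul_of_pos_right (hc i) hpos

/-- Weighted AM-GM for `k` copies of `x^(k+1)` and one of `v^(k+1)`. Summed over eigenvalues `x`, it
compares the traces of consecutive powers. -/
theorem succ_mul_mul_pow_le {x v : ℝ} (hx : 0 ≤ x) (hv : 0 ≤ v) (k : ℕ) :
    (k + 1) * v * x ^ k ≤ k * x ^ (k + 1) + v ^ (k + 1) := by
  induction k with
  | zero => simp
  | succ k ih =>
    push_cast
    have h1 := mul_le_mul_of_nonneg_left ih hv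
    have h2 : 0 ≤ ((k : ℝ) + 1) * x ^ k * (x - v) ^ 2 := by positivity
    have e : ((k : ℝ) + 1) * x ^ (k + 1 + 1) + v ^ (k + 1 + 1) -
        ((k : ℝ) + 1 + 1) * v * x ^ (k + 1) =
      v * (k * x ^ (k + 1) + v ^ (k + 1)) - v * ((k + 1) * v * x ^ k)
        + ((k : ℝ) + 1) * x ^ k * (x - v) ^ 2 := by ring
    linarith

/-- An eigenvalue at least `μ` alone contributes `μ^k ≥ N ν^k` to `tr H^k`, where `N` is the
dimension. In the summed AM-GM inequality the error `N ν^(k+1)` is therefore at most one of the `k +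
1` copies of `ν tr H^k`, and `k` copies remain. -/
theorem mul_trace_pow_le {H : Matrix ι ι ℝ} (hH : Hᵀ = H) (h0 : ∀ z, 0 ≤ z ⬝ᵥ H *ᵥ z)
    (h2 : ∀ z, z ⬝ᵥ H *ᵥ z ≤ 2 * (z ⬝ᵥ z)) {z : ι → ℝ} {μ ν : ℝ} (hz : 0 < z ⬝ᵥ z)
    (hμ : μ * (z ⬝ᵥ z) ≤ z ⬝ᵥ H *ᵥ z) (hμ0 : 0 ≤ μ) (hν : 0 ≤ ν) {k : ℕ} (hk : 0 < k)
    (hnu : Fintype.card ι * ν ^ k ≤ μ ^ k) :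
    ν * (H ^ k).trace ≤ (H ^ (k + 1)).trace := by
  obtain ⟨l, hl0, -, htr, hl⟩ := exists_eigenvalues hH h0 h2
  obtain ⟨i₀, hi₀⟩ := hl z μ hz hμ
  have h1 : μ ^ k ≤ ∑ i, l i ^ k := (pow_le_pow_left₀ hμ0 hi₀ k).trans
    (Finset.single_le_sum (f := fun i => l i ^ k) (fun i _ => pow_nonneg (hl0 i) k)
      (Finset.mem_univ i₀))
  have h3 : ∑ i, ((k : ℝ) + 1) * ν * l i ^ k ≤ ∑ i, (k * l i ^ (k + 1) + ν ^ (k + 1)) :=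
    Finset.sum_le_sum fun i _ => succ_mul_mul_pow_le (hl0 i) hν k
  rw [← Finset.mul_sum, Finset.sum_add_distrib, ← Finset.mul_sum, Finset.sum_const,
    Finset.card_univ, nsmul_eq_mul, ← htr, ← htr] at h3
  rw [← htr] at h1
  have h4 := mul_le_mul_of_nonneg_left (hnu.trans h1) hν
  have hk' : (0 : ℝ) < k := by exact_mod_cast hk
  have h5 : (k : ℝ) * (ν * (H ^ k).trace) ≤ k * (H ^ (k + 1)).trace := by
    rw [pow_succ ν] at h3
    linarith
  exact le_of_mul_le_mul_left h5 hk'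

/-- The initial size of the potential `tr H^k`. -/
theorem trace_pow_le {H : Matrix ι ι ℝ} (hH : Hᵀ = H) (h0 : ∀ z, 0 ≤ z ⬝ᵥ H *ᵥ z)
    (h2 : ∀ z, z ⬝ᵥ H *ᵥ z ≤ 2 * (z ⬝ᵥ z)) (k : ℕ) :
    (H ^ k).trace ≤ Fintype.card ι * 2 ^ k := by
  obtain ⟨l, hl0, hl2, htr, -⟩ := exists_eigenvalues hH h0 h2
  rw [htr, ← nsmul_eq_mul, ← Finset.card_univ, ← Finset.sum_const]
  exact Finset.sum_le_sum fun i _ => pow_le_pow_left₀ (hl0 i) (hl2 i) k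

/-- The floor under the potential: a vector of Rayleigh quotient at least 1 prevents the trace from
decaying, which limits the number of dampings. -/
theorem one_le_trace_pow {H : Matrix ι ι ℝ} (hH : Hᵀ = H) (h0 : ∀ z, 0 ≤ z ⬝ᵥ H *ᵥ z)
    (h2 : ∀ z, z ⬝ᵥ H *ᵥ z ≤ 2 * (z ⬝ᵥ z)) {z : ι → ℝ} (hz : 0 < z ⬝ᵥ z)
    (h1 : z ⬝ᵥ z ≤ z ⬝ᵥ H *ᵥ z) (k : ℕ) : 1 ≤ (H ^ k).trace := by
  obtain ⟨l, hl0, -, htr, hl⟩ := exists_eigenvalues hH h0 h2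
  obtain ⟨i₀, hi₀⟩ := hl z 1 hz (by rwa [one_mul])
  rw [htr]
  exact (one_le_pow₀ hi₀).trans
    (Finset.single_le_sum (f := fun i => l i ^ k) (fun i _ => pow_nonneg (hl0 i) k)
      (Finset.mem_univ i₀))

end TraceInequalities

end Matrix

/-! ## The damped normalized matrix and its potential -/

namespace CutGain

section Potential

variable {ι : Type*} [Fintype ι]

/-- The weighted degree. -/
def wdeg (B : Matrix ι ι ℝ) (i : ι) : ℝ := ∑ j, |B i j|

/-- The sum of the weighted degrees. -/
def vol (B : Matrix ι ι ℝ) : ℝ := ∑ i, wdeg B i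

/-- The inverse square root of the weighted degree (`0` at isolated vertices). -/
noncomputable def isqDeg (B : Matrix ι ι ℝ) (i : ι) : ℝ := 1 / √(wdeg B i)

/-- The quadratic form of `B`. -/
def quad (B : Matrix ι ι ℝ) (x : ι → ℝ) : ℝ := ∑ i, ∑ j, B i j * (x i * x j)

theorem wdeg_nonneg (B : Matrix ι ι ℝ) (i : ι) : 0 ≤ wdeg B i :=
  Finset.sum_nonneg fun _ _ => abs_nonneg _

theorem vol_nonneg (B : Matrix ι ι ℝ) : 0 ≤ vol B :=
  Finset.sum_nonneg fun i _ => wdeg_nonneg B i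

theorem isqDeg_sq_mul_wdeg_le (B : Matrix ι ι ℝ) (i : ι) : isqDeg B i ^ 2 * wdeg B i ≤ 1 := by
  unfold isqDeg
  rw [div_pow, Real.sq_sqrt (wdeg_nonneg B i), one_pow, one_div]
  exact inv_mul_le_one

/-- At an isolated vertex the normalizing product is 0 rather than 1, but then the whole row of `B`
vanishes. -/
theorem mul_isqDeg_mul_sqrt (B : Matrix ι ι ℝ) (i j : ι) :
    B i j * (isqDeg B i * √(wdeg B i)) = B i j := by
  rcases (wdeg_nonneg B i).eq_or_lt with h | h
  · have h0 : |B i j| = 0 :=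
      (Finset.sum_eq_zero_iff_of_nonneg (fun j _ => abs_nonneg (B i j))).1 h.symm j
        (Finset.mem_univ j)
    rw [abs_eq_zero.1 h0, zero_mul]
  · rw [isqDeg, one_div, inv_mul_cancel₀ (Real.sqrt_pos.2 h).ne', mul_one]

/-- Weights on the two ends of an edge are collected at the vertices. -/
theorem sum_abs_mul_add {B : Matrix ι ι ℝ} (hB : Bᵀ = B) (f g : ι → ℝ) :
    ∑ i, ∑ j, |B i j| * (f i + g j) = ∑ i, wdeg B i * (f i + g i) := by
  have hs : ∀ i j, B j i = B i j := fun i j => congr_fun (congr_fun hB i) j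
  have h1 : ∑ i, ∑ j, |B i j| * g j = ∑ i, wdeg B i * g i := by
    rw [Finset.sum_comm]
    refine Finset.sum_congr rfl fun j _ => ?_
    rw [wdeg, Finset.sum_mul]
    exact Finset.sum_congr rfl fun i _ => by rw [hs]
  have h2 : ∑ i, ∑ j, |B i j| * f i = ∑ i, wdeg B i * f i :=
    Finset.sum_congr rfl fun j _ => by rw [wdeg, Finset.sum_mul]
  simp only [mul_add, Finset.sum_add_distrib, h1, h2]

/-- The normalized matrix has norm at most 1: AM-GM on each edge, then the weights at each vertex
add up to its degree. -/
theorem abs_sum_mul_isqDeg_le {B : Matrix ι ι ℝ} (hB : Bᵀ = B) (w : ι → ℝ) :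
    |∑ i, ∑ j, B i j * (isqDeg B i * isqDeg B j) * (w i * w j)| ≤ ∑ i, w i ^ 2 := by
  have h1 : |∑ i, ∑ j, B i j * (isqDeg B i * isqDeg B j) * (w i * w j)| ≤
      ∑ i, ∑ j, |B i j| * ((isqDeg B i * w i) ^ 2 / 2 + (isqDeg B j * w j) ^ 2 / 2) := by
    refine (Finset.abs_sum_le_sum_abs _ _).trans (Finset.sum_le_sum fun i _ =>
      (Finset.abs_sum_le_sum_abs _ _).trans (Finset.sum_le_sum fun j _ => ?_))
    rw [show B i j * (isqDeg B i * isqDeg B j) * (w i * w j) =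
      B i j * ((isqDeg B i * w i) * (isqDeg B j * w j)) by ring, abs_mul]
    refine mul_le_mul_of_nonneg_left ?_ (abs_nonneg _)
    rw [abs_le]
    constructor <;> nlinarith [sq_nonneg (isqDeg B i * w i + isqDeg B j * w j),
      sq_nonneg (isqDeg B i * w i - isqDeg B j * w j)]
  refine h1.trans ?_
  rw [sum_abs_mul_add hB (fun i => (isqDeg B i * w i) ^ 2 / 2)
    (fun i => (isqDeg B i * w i) ^ 2 / 2)]
  refine Finset.sum_le_sum fun i _ => ?_
  have := mul_le_mul_of_nonneg_right (isqDeg_sq_mul_wdeg_le B i) (sq_nonneg (w i))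
  nlinarith

theorem dotProduct_sqrt_wdeg (B : Matrix ι ι ℝ) {y : ι → ℝ} (hy : ∀ i, y i * y i = 1) :
    (fun i => √(wdeg B i) * y i) ⬝ᵥ (fun i => √(wdeg B i) * y i) = vol B := by
  refine Finset.sum_congr rfl fun i _ => ?_
  rw [mul_mul_mul_comm, hy, Real.mul_self_sqrt (wdeg_nonneg B i), mul_one]

variable [DecidableEq ι]

/-- The matrix `Q (1 + D^{-1/2} B D^{-1/2}) Q` with `Q = diag(q)`. -/
noncomputable def stepMat (B : Matrix ι ι ℝ) (q : ι → ℝ) : Matrix ι ι ℝ :=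
  of fun i j => q i * q j * ((if i = j then 1 else 0) + B i j * (isqDeg B i * isqDeg B j))

theorem stepMat_transpose {B : Matrix ι ι ℝ} (hB : Bᵀ = B) (q : ι → ℝ) :
    (stepMat B q)ᵀ = stepMat B q := by
  have hs : ∀ i j, B j i = B i j := fun i j => congr_fun (congr_fun hB i) j
  ext i j
  simp only [transpose_apply, stepMat, of_apply, hs i j, eq_comm (a := j)]
  ring

/-- Splits off the identity part. `P` is arbitrary because this is needed both for rank one
(quadratic forms) and for a power of the matrix (traces). -/
theorem sum_stepMat_mul (B : Matrix ι ι ℝ) (q : ι → ℝ) (P : ι → ι → ℝ) :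
    ∑ i, ∑ j, stepMat B q i j * P i j =
      ∑ i, q i ^ 2 * P i i + ∑ i, ∑ j, B i j * (isqDeg B i * isqDeg B j) * (q i * q j * P i j) := by
  rw [← Finset.sum_add_distrib]
  refine Finset.sum_congr rfl fun i _ => ?_
  have : q i ^ 2 * P i i = ∑ j, if i = j then q i * q j * P i j else 0 := by simp [sq]
  rw [this, ← Finset.sum_add_distrib]
  refine Finset.sum_congr rfl fun j _ => ?_
  simp only [stepMat, of_apply]
  split_ifs <;> ring

theorem dotProduct_stepMat_mulVec (B : Matrix ι ι ℝ) (q z : ι → ℝ) :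
    z ⬝ᵥ stepMat B q *ᵥ z =
      ∑ i, q i ^ 2 * (z i * z i) +
        ∑ i, ∑ j, B i j * (isqDeg B i * isqDeg B j) * (q i * q j * (z i * z j)) := by
  rw [← sum_stepMat_mul B q fun i j => z i * z j]
  simp only [dotProduct, mulVec, Finset.mul_sum]
  exact Finset.sum_congr rfl fun i _ => Finset.sum_congr rfl fun j _ => by ring

/-- The spectrum lies in [0, 2]: the identity part and the normalized adjacency part are each
bounded by the squared norm of `Qz`. -/
theorem stepMat_bounds {B : Matrix ι ι ℝ} (hB : Bᵀ = B) {q : ι → ℝ} (h0 : ∀ i, 0 ≤ q i)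
    (h1 : ∀ i, q i ≤ 1) (z : ι → ℝ) :
    0 ≤ z ⬝ᵥ stepMat B q *ᵥ z ∧ z ⬝ᵥ stepMat B q *ᵥ z ≤ 2 * (z ⬝ᵥ z) := by
  have h := abs_le.1 (abs_sum_mul_isqDeg_le hB fun i => q i * z i)
  have e1 : ∑ i, q i ^ 2 * (z i * z i) = ∑ i, (q i * z i) ^ 2 :=
    Finset.sum_congr rfl fun i _ => by ring
  have e2 : ∑ i, ∑ j, B i j * (isqDeg B i * isqDeg B j) * (q i * q j * (z i * z j)) =
      ∑ i, ∑ j, B i j * (isqDeg B i * isqDeg B j) * (q i * z i * (q j * z j)) :=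
    Finset.sum_congr rfl fun i _ => Finset.sum_congr rfl fun j _ => by ring
  have h3 : ∑ i, (q i * z i) ^ 2 ≤ z ⬝ᵥ z := by
    refine Finset.sum_le_sum fun i _ => ?_
    have : q i ^ 2 ≤ 1 := pow_le_one₀ (h0 i) (h1 i)
    nlinarith [mul_self_nonneg (z i)]
  rw [dotProduct_stepMat_mulVec, e1, e2]
  constructor <;> linarith [h.1, h.2]

/-- The Rayleigh quotient of the vector of an optimal cut. -/
theorem le_dotProduct_stepMat {B : Matrix ι ι ℝ} (hB : Bᵀ = B) {q : ι → ℝ} (h0 : ∀ i, 0 ≤ q i)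
    (h1 : ∀ i, q i ≤ 1) {y : ι → ℝ} (hy : ∀ i, y i * y i = 1) :
    vol B + quad B y - 4 * ∑ i, wdeg B i * (1 - q i) ≤
      (fun i => √(wdeg B i) * y i) ⬝ᵥ stepMat B q *ᵥ (fun i => √(wdeg B i) * y i) := by
  have hs : ∀ i j, B j i = B i j := fun i j => congr_fun (congr_fun hB i) j
  have hab : ∀ i, |y i| = 1 := fun i => by
    have := abs_mul_abs_self (y i)
    rw [hy] at this
    nlinarith [abs_nonneg (y i)]
  rw [dotProduct_stepMat_mulVec]
  -- The identity part loses `1 - q² ≤ 2(1 - q)` per unit of degree.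
  have e1 : vol B - 2 * ∑ i, wdeg B i * (1 - q i) ≤
      ∑ i, q i ^ 2 * (√(wdeg B i) * y i * (√(wdeg B i) * y i)) := by
    rw [vol, Finset.mul_sum, ← Finset.sum_sub_distrib]
    refine Finset.sum_le_sum fun i _ => ?_
    rw [mul_mul_mul_comm, hy, Real.mul_self_sqrt (wdeg_nonneg B i)]
    nlinarith [mul_nonneg (wdeg_nonneg B i) (sq_nonneg (1 - q i))]
  have e2 : quad B y - ∑ i, ∑ j, |B i j| * ((1 - q i) + (1 - q j)) ≤
      ∑ i, ∑ j, B i j * (isqDeg B i * isqDeg B j) *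
        (q i * q j * (√(wdeg B i) * y i * (√(wdeg B j) * y j))) := by
    rw [quad, ← Finset.sum_sub_distrib]
    refine Finset.sum_le_sum fun i _ => ?_
    rw [← Finset.sum_sub_distrib]
    refine Finset.sum_le_sum fun j _ => ?_
    have e : B i j * (isqDeg B i * isqDeg B j) *
        (q i * q j * (√(wdeg B i) * y i * (√(wdeg B j) * y j))) =
        B i j * (q i * q j * (y i * y j)) := by
      calc _ = B i j * (isqDeg B i * √(wdeg B i)) * (isqDeg B j * √(wdeg B j)) *
            (q i * q j * (y i * y j)) := by ring
        _ = _ := by rw [mul_isqDeg_mul_sqrt, ← hs i j, mul_isqDeg_mul_sqrt]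
    rw [e]
    -- The edge part loses `1 - q_i q_j ≤ (1 - q_i) + (1 - q_j)`, charged to the two ends; summed
    -- over ordered pairs this is the other half of the constant 4.
    have h3 : B i j * (y i * y j) * (1 - q i * q j) ≤ |B i j| * (1 - q i + (1 - q j)) := by
      have hq : q i * q j ≤ 1 := mul_le_one₀ (h1 i) (h0 j) (h1 j)
      have h4 : B i j * (y i * y j) ≤ |B i j| := by
        refine (le_abs_self _).trans_eq ?_
        rw [abs_mul, abs_mul, hab, hab, mul_one, mul_one]
      refine (mul_le_mul_of_nonneg_right h4 (by linarith)).trans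
        (mul_le_mul_of_nonneg_left ?_ (abs_nonneg _))
      nlinarith [mul_nonneg (sub_nonneg.2 (h1 i)) (sub_nonneg.2 (h1 j))]
    linarith
  rw [sum_abs_mul_add hB (fun i => 1 - q i) (fun i => 1 - q i)] at e2
  have e3 : ∑ i, wdeg B i * (1 - q i + (1 - q i)) = 2 * ∑ i, wdeg B i * (1 - q i) := by
    rw [Finset.mul_sum]
    exact Finset.sum_congr rfl fun i _ => by ring
  linarith

/-- The vertices that carry too large a part of the trace of `P`. -/
noncomputable def heavy (B P : Matrix ι ι ℝ) (K : ℝ) : Finset ι :=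
  Finset.univ.filter fun i => K * wdeg B i * P.trace < vol B * P i i

/-- Damping of the coordinates in `S`. -/
noncomputable def damp (q : ι → ℝ) (S : Finset ι) (m : ℕ) : ι → ℝ :=
  fun i => if i ∈ S then q i * (1 - 1 / m) else q i

/-- Damping is conjugation by a diagonal matrix, the form to which the trace inequality applies. -/
theorem stepMat_damp (B : Matrix ι ι ℝ) (q : ι → ℝ) (S : Finset ι) (m : ℕ) :
    stepMat B (damp q S m) = diagonal (fun i => if i ∈ S then 1 - 1 / (m : ℝ) else 1) *
      stepMat B q * diagonal (fun i => if i ∈ S then 1 - 1 / (m : ℝ) else 1) := by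
  ext i j
  rw [mul_diagonal, diagonal_mul]
  simp only [stepMat, damp, of_apply]
  by_cases hi : i ∈ S <;> by_cases hj : j ∈ S <;> simp only [hi, hj, if_true, if_false] <;> ring

theorem pow_two_pow_apply_self {H : Matrix ι ι ℝ} (hH : Hᵀ = H) (k : ℕ) (i : ι) :
    (H ^ (2 * k)) i i = ∑ l, (H ^ k) i l ^ 2 := by
  rw [two_mul, pow_add, mul_apply]
  refine Finset.sum_congr rfl fun l _ => ?_
  have : (H ^ k)ᵀ = H ^ k := by rw [transpose_pow, hH]
  rw [sq, ← congr_fun (congr_fun this l) i, transpose_apply]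

/-- Damping the coordinates in `S` removes half of their part of the trace. -/
theorem trace_stepMat_damp_pow_le {B : Matrix ι ι ℝ} (hB : Bᵀ = B) (q : ι → ℝ) (S : Finset ι)
    (j : ℕ) :
    (stepMat B (damp q S (2 ^ (j + 1))) ^ 2 ^ (j + 1)).trace ≤
      (stepMat B q ^ 2 ^ (j + 1)).trace - (∑ i ∈ S, (stepMat B q ^ 2 ^ (j + 1)) i i) / 2 := by
  have hH := stepMat_transpose hB q
  have hP : ∀ i, 0 ≤ (stepMat B q ^ 2 ^ (j + 1)) i i := fun i => by
    rw [pow_succ', pow_two_pow_apply_self hH]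
    exact Finset.sum_nonneg fun l _ => sq_nonneg _
  rw [stepMat_damp]
  -- Each diagonal entry of the power in `S` is now multiplied by `(1 - 1/m)^(2m)`, which tends to
  -- `e^{-2}`; only the bound 1/2 is needed.
  refine (trace_diagonal_conj_pow_le hH _ (j + 1)).trans ?_
  have hsum : ∑ i ∈ S, (stepMat B q ^ 2 ^ (j + 1)) i i =
      ∑ i, if i ∈ S then (stepMat B q ^ 2 ^ (j + 1)) i i else 0 := by
    rw [Finset.sum_ite_mem, Finset.univ_inter]
  rw [hsum, trace, Finset.sum_div, ← Finset.sum_sub_distrib]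
  refine Finset.sum_le_sum fun i _ => ?_
  rw [diag_apply]
  by_cases hi : i ∈ S
  · simp only [hi, if_true]
    have hm : (2 : ℝ) ≤ (2 ^ (j + 1) : ℕ) := by
      have := Nat.one_le_two_pow (n := j)
      have h2 : 2 ≤ 2 ^ (j + 1) := by rw [pow_succ]; omega
      exact_mod_cast h2
    have h1 : (1 - 1 / ((2 ^ (j + 1) : ℕ) : ℝ)) ^ (2 ^ (j + 1)) ≤ Real.exp (-1) :=
      Real.one_sub_div_pow_le_exp_neg (by linarith)
    have h0 : (0 : ℝ) ≤ 1 - 1 / ((2 ^ (j + 1) : ℕ) : ℝ) := by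
      rw [sub_nonneg, div_le_one (by linarith)]; linarith
    have h3 : Real.exp (-1) ≤ 1 / 2 := by
      rw [Real.exp_neg, inv_eq_one_div]
      refine one_div_le_one_div_of_le two_pos ?_
      have := Real.add_one_le_exp 1
      linarith
    have h4 : (1 - 1 / ((2 ^ (j + 1) : ℕ) : ℝ)) ^ (2 * 2 ^ (j + 1)) ≤ 1 / 2 := by
      rw [mul_comm, pow_mul]
      have h5 := h1.trans h3
      have h6 := pow_nonneg h0 (2 ^ (j + 1))
      nlinarith
    have := mul_le_mul_of_nonneg_left h4 (hP i)
    linarith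
  · simp [hi]

theorem sum_wdeg_damp_le (B : Matrix ι ι ℝ) {q : ι → ℝ} (h1 : ∀ i, q i ≤ 1)
    (S : Finset ι) {m : ℕ} (hm : 0 < m) :
    ∑ i, wdeg B i * (1 - damp q S m i) ≤
      ∑ i, wdeg B i * (1 - q i) + (∑ i ∈ S, wdeg B i) / m := by
  have hsum : ∑ i ∈ S, wdeg B i = ∑ i, if i ∈ S then wdeg B i else 0 := by
    rw [Finset.sum_ite_mem, Finset.univ_inter]
  rw [hsum, Finset.sum_div, ← Finset.sum_add_distrib]
  refine Finset.sum_le_sum fun i _ => ?_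
  have hm' : (0 : ℝ) < m := by exact_mod_cast hm
  unfold damp
  split_ifs with hi
  · have h2 : wdeg B i * q i * (1 / m) ≤ wdeg B i * (1 / m) :=
      mul_le_mul_of_nonneg_right (mul_le_of_le_one_right (wdeg_nonneg B i) (h1 i)) (by positivity)
    have h3 : wdeg B i / m = wdeg B i * (1 / m) := by ring
    rw [h3]
    linarith
  · simp

/-- The vectors of a solution of the relaxation: `R` is a square root of a power of the damped
matrix, and the heavy vertices are left out. -/
noncomputable def relaxVec (B : Matrix ι ι ℝ) (q : ι → ℝ) (R P : Matrix ι ι ℝ) (K : ℝ) :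
    Matrix ι ι ℝ :=
  of fun i l => if K * wdeg B i * P.trace < vol B * P i i then 0 else
    q i * isqDeg B i * R i l * (√(vol B) / √P.trace)

/-- A nearly feasible solution of the relaxation. -/
structure IsRelaxSol (B U : Matrix ι ι ℝ) (K v : ℝ) : Prop where
  obj : v ≤ ∑ i, ∑ j, B i j * ∑ l, U i l * U j l
  row : ∀ i, ∑ l, U i l ^ 2 ≤ K
  avg : ∑ i, wdeg B i * ∑ l, U i l ^ 2 ≤ vol B

theorem isRelaxSol_relaxVec {B : Matrix ι ι ℝ} (hB : Bᵀ = B) {q : ι → ℝ} (h0 : ∀ i, 0 ≤ q i)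
    (h1 : ∀ i, q i ≤ 1) {R P : Matrix ι ι ℝ} (hRP : ∀ i j, P i j = ∑ l, R i l * R j l)
    (htr : 0 < P.trace) {ε K : ℝ} (hε : 0 < ε) (hK : 0 ≤ K)
    (hobj : (1 + ε / 4) * P.trace ≤ (stepMat B q * P).trace)
    (hheavy : ∑ i ∈ heavy B P K, P i i ≤ ε ^ 2 / 256 * P.trace) :
    IsRelaxSol B (relaxVec B q R P K) K (ε / 8 * vol B) := by
  set S := heavy B P K with hS
  set V : ι → ι → ℝ := fun i l => q i * isqDeg B i * R i l with hV
  set s : ℝ := √(vol B) / √P.trace with hs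
  have hU : ∀ i l, relaxVec B q R P K i l = (if i ∈ S then 0 else V i l) * s := by
    intro i l
    simp only [relaxVec, of_apply, hS, heavy, Finset.mem_filter, Finset.mem_univ, true_and]
    split_ifs <;> simp [hV, hs]
  have hs2 : s ^ 2 * P.trace = vol B := by
    rw [hs, div_pow, Real.sq_sqrt (vol_nonneg B), Real.sq_sqrt htr.le, div_mul_cancel₀ _ htr.ne']
  have hs0 : 0 ≤ s ^ 2 := sq_nonneg _
  have hPsym : ∀ i j, P i j = P j i := fun i j => by
    rw [hRP, hRP]; exact Finset.sum_congr rfl fun l _ => mul_comm _ _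
  have hPP : ∀ i, ∑ l, R i l ^ 2 = P i i := fun i => by
    rw [hRP]; exact Finset.sum_congr rfl fun l _ => sq _
  have hP0 : ∀ i, 0 ≤ P i i := fun i => by
    rw [← hPP]; exact Finset.sum_nonneg fun l _ => sq_nonneg _
  have hVV : ∀ i, ∑ l, V i l ^ 2 = q i ^ 2 * isqDeg B i ^ 2 * P i i := fun i => by
    rw [← hPP, Finset.mul_sum]
    exact Finset.sum_congr rfl fun l _ => by simp only [hV]; ring
  have hq2 : ∀ i, q i ^ 2 ≤ 1 := fun i => pow_le_one₀ (h0 i) (h1 i)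
  have hdV : ∀ i, wdeg B i * ∑ l, V i l ^ 2 ≤ P i i := fun i => by
    rw [hVV]
    have h3 : q i ^ 2 * (isqDeg B i ^ 2 * wdeg B i) ≤ 1 :=
      mul_le_one₀ (hq2 i) (mul_nonneg (sq_nonneg _) (wdeg_nonneg B i)) (isqDeg_sq_mul_wdeg_le B i)
    have := mul_le_mul_of_nonneg_right h3 (hP0 i)
    linarith
  refine ⟨?_, fun i => ?_, ?_⟩
  · -- the objective
    -- The identity part accounts for at most `tr P`, so the excess of `tr (H P)` over `tr P` comes
    -- from the edges.
    have hbig : ε / 4 * P.trace ≤ ∑ i, ∑ j, B i j * ∑ l, V i l * V j l := by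
      have e1 : (stepMat B q * P).trace = ∑ i, ∑ j, stepMat B q i j * P i j := by
        simp only [trace, diag_apply, mul_apply]
        exact Finset.sum_congr rfl fun i _ => Finset.sum_congr rfl fun j _ => by rw [hPsym i j]
      rw [e1, sum_stepMat_mul B q fun i j => P i j] at hobj
      have e2 : ∑ i, q i ^ 2 * P i i ≤ P.trace :=
        Finset.sum_le_sum fun i _ => mul_le_of_le_one_left (hP0 i) (hq2 i)
      have e3 : ∑ i, ∑ j, B i j * (isqDeg B i * isqDeg B j) * (q i * q j * P i j) =
          ∑ i, ∑ j, B i j * ∑ l, V i l * V j l := by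
        refine Finset.sum_congr rfl fun i _ => Finset.sum_congr rfl fun j _ => ?_
        rw [hRP, Finset.mul_sum, Finset.mul_sum, Finset.mul_sum]
        exact Finset.sum_congr rfl fun l _ => by simp only [hV]; ring
      linarith
    -- The weight in the AM-GM bound `|⟨v_i, v_j⟩| ≤ (|v_i|²/β + β |v_j|²)/2` for edges with a heavy
    -- end `i`. It balances the two errors: `(ε²/256)/β` and `β` are both ε/16.
    set β : ℝ := ε / 16 with hβ
    have hβ0 : 0 < β := by positivity
    have hterm : ∀ i j, B i j * ∑ l, V i l * V j l -
        |B i j| * (((if i ∈ S then (∑ l, V i l ^ 2) else 0) / β + β * ∑ l, V i l ^ 2) / 2 +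
          ((if j ∈ S then (∑ l, V j l ^ 2) else 0) / β + β * ∑ l, V j l ^ 2) / 2) ≤
        B i j * ∑ l, (if i ∈ S then 0 else V i l) * (if j ∈ S then 0 else V j l) := by
      intro i j
      have hn : ∀ i, 0 ≤ ∑ l, V i l ^ 2 := fun i => Finset.sum_nonneg fun l _ => sq_nonneg _
      have hcs : ∀ i j, |∑ l, V i l * V j l| ≤ ((∑ l, V i l ^ 2) / β + β * ∑ l, V j l ^ 2) / 2 := by
        intro i j
        rw [Finset.sum_div, Finset.mul_sum, ← Finset.sum_add_distrib, Finset.sum_div]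
        refine (Finset.abs_sum_le_sum_abs _ _).trans (Finset.sum_le_sum fun l _ => ?_)
        have e1 : ∀ x : ℝ, (V i l ^ 2 / β + β * V j l ^ 2) / 2 - x * (V i l * V j l) =
            (V i l - x * β * V j l) ^ 2 / (2 * β) + (1 - x ^ 2) * (β * V j l ^ 2 / 2) := by
          intro x; field_simp; ring
        have e2 := e1 1
        have e3 := e1 (-1)
        have p1 : 0 ≤ (V i l - 1 * β * V j l) ^ 2 / (2 * β) := by positivity
        have p2 : 0 ≤ (V i l - (-1) * β * V j l) ^ 2 / (2 * β) := by positivity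
        rw [abs_le]
        constructor <;> linarith
      by_cases hij : i ∈ S ∨ j ∈ S
      · have hz : ∑ l, (if i ∈ S then 0 else V i l) * (if j ∈ S then 0 else V j l) = 0 := by
          refine Finset.sum_eq_zero fun l _ => ?_
          rcases hij with h | h <;> simp [h]
        rw [hz, mul_zero, sub_nonpos]
        refine (le_abs_self _).trans ?_
        rw [abs_mul]
        refine mul_le_mul_of_nonneg_left ?_ (abs_nonneg _)
        have a1 : 0 ≤ β * ∑ l, V i l ^ 2 := mul_nonneg hβ0.le (hn i)
        have a2 : 0 ≤ β * ∑ l, V j l ^ 2 := mul_nonneg hβ0.le (hn j)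
        have a3 : 0 ≤ (∑ l, V i l ^ 2) / β := div_nonneg (hn i) hβ0.le
        have a4 : 0 ≤ (∑ l, V j l ^ 2) / β := div_nonneg (hn j) hβ0.le
        by_cases hi : i ∈ S
        · have := hcs i j
          by_cases hj : j ∈ S <;> simp only [hi, hj, if_true, if_false, zero_div] <;> linarith
        · have hj : j ∈ S := hij.resolve_left hi
          have := hcs j i
          have hc : ∑ l, V i l * V j l = ∑ l, V j l * V i l :=
            Finset.sum_congr rfl fun l _ => mul_comm _ _
          rw [hc]
          simp only [hi, hj, if_true, if_false, zero_div]
          linarith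
      · push Not at hij
        simp only [hij.1, hij.2, if_false, zero_div, zero_add]
        have := mul_nonneg (abs_nonneg (B i j)) (add_nonneg
          (div_nonneg (mul_nonneg hβ0.le (hn i)) zero_le_two)
          (div_nonneg (mul_nonneg hβ0.le (hn j)) zero_le_two))
        linarith
    have hsum := Finset.sum_le_sum fun i (_ : i ∈ Finset.univ) =>
      Finset.sum_le_sum fun j (_ : j ∈ Finset.univ) => hterm i j
    simp only [Finset.sum_sub_distrib] at hsum
    rw [sum_abs_mul_add hB
      (fun i => ((if i ∈ S then (∑ l, V i l ^ 2) else 0) / β + β * ∑ l, V i l ^ 2) / 2)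
      (fun i => ((if i ∈ S then (∑ l, V i l ^ 2) else 0) / β + β * ∑ l, V i l ^ 2) / 2)] at hsum
    have herr : ∑ i, wdeg B i *
        (((if i ∈ S then (∑ l, V i l ^ 2) else 0) / β + β * ∑ l, V i l ^ 2) / 2 +
          ((if i ∈ S then (∑ l, V i l ^ 2) else 0) / β + β * ∑ l, V i l ^ 2) / 2) ≤
        ε / 8 * P.trace := by
      have h3 : ∑ i, wdeg B i *
        (((if i ∈ S then (∑ l, V i l ^ 2) else 0) / β + β * ∑ l, V i l ^ 2) / 2 +
          ((if i ∈ S then (∑ l, V i l ^ 2) else 0) / β + β * ∑ l, V i l ^ 2) / 2) ≤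
          ∑ i, ((if i ∈ S then P i i else 0) / β + β * P i i) := by
        refine Finset.sum_le_sum fun i _ => ?_
        have a1 := hdV i
        have a2 := mul_le_mul_of_nonneg_left a1 hβ0.le
        have a3 := div_le_div_of_nonneg_right a1 hβ0.le
        split_ifs
        · rw [mul_div_assoc] at a3; linarith
        · simp only [zero_div]; linarith
      refine h3.trans ?_
      rw [Finset.sum_add_distrib, ← Finset.sum_div, ← Finset.mul_sum, Finset.sum_ite_mem,
        Finset.univ_inter]
      have h4 : (∑ i ∈ S, P i i) / β ≤ ε / 16 * P.trace := by
        rw [div_le_iff₀ hβ0]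
        refine hheavy.trans_eq ?_
        rw [hβ]; ring
      have h5 : β * ∑ i, P i i = ε / 16 * P.trace := rfl
      linarith
    have hfin : ε / 8 * P.trace ≤ ∑ i, ∑ j, B i j *
        ∑ l, (if i ∈ S then 0 else V i l) * (if j ∈ S then 0 else V j l) := by linarith
    have hfin' := mul_le_mul_of_nonneg_left hfin hs0
    calc ε / 8 * vol B = s ^ 2 * (ε / 8 * P.trace) := by rw [← hs2]; ring
      _ ≤ _ := hfin'
      _ = _ := by
        simp only [hU, Finset.mul_sum]
        exact Finset.sum_congr rfl fun i _ => Finset.sum_congr rfl fun j _ =>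
          Finset.sum_congr rfl fun l _ => by ring
  · simp only [hU]
    by_cases hi : i ∈ S
    · simpa [hi] using hK
    · simp only [hi, if_false, mul_pow, ← Finset.sum_mul]
      rw [hVV]
      -- After the rescaling by `s² = vol / tr P`, not being heavy is precisely the bound `K` on the
      -- squared length.
      have h3 : vol B * P i i ≤ K * wdeg B i * P.trace := by
        simpa [hS, heavy] using hi
      rw [← hs2] at h3
      have h4 : s ^ 2 * P i i ≤ K * wdeg B i := by
        refine le_of_mul_le_mul_right ?_ htr
        linarith
      have h5 := mul_le_mul_of_nonneg_left (isqDeg_sq_mul_wdeg_le B i) hK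
      have h6 := mul_le_mul_of_nonneg_left h4 (sq_nonneg (isqDeg B i))
      have h7 := mul_le_mul_of_nonneg_right (hq2 i)
        (mul_nonneg (mul_nonneg (sq_nonneg (isqDeg B i)) (hP0 i)) hs0)
      linarith
  · rw [← hs2, mul_comm (s ^ 2), trace, Finset.sum_mul]
    refine Finset.sum_le_sum fun i _ => ?_
    simp only [hU, mul_pow, ← Finset.sum_mul]
    rw [← mul_assoc]
    refine mul_le_mul_of_nonneg_right ?_ hs0
    by_cases hi : i ∈ S
    · simpa [hi] using hP0 i
    · simpa [hi] using hdV i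

end Potential

section Damp

variable {ι : Type*} [DecidableEq ι]

theorem damp_nonneg {q : ι → ℝ} (h0 : ∀ i, 0 ≤ q i) (S : Finset ι) {m : ℕ} (hm : 0 < m) (i : ι) :
    0 ≤ damp q S m i := by
  have hm' : (1 : ℝ) ≤ m := by exact_mod_cast hm
  unfold damp
  split_ifs
  · exact mul_nonneg (h0 i) (sub_nonneg.2 ((div_le_one (by linarith)).2 hm'))
  · exact h0 i

theorem damp_le_one {q : ι → ℝ} (h0 : ∀ i, 0 ≤ q i) (h1 : ∀ i, q i ≤ 1) (S : Finset ι) (m : ℕ)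
    (i : ι) : damp q S m i ≤ 1 := by
  unfold damp
  split_ifs
  · have : (0 : ℝ) ≤ 1 / m := by positivity
    nlinarith [h0 i, h1 i]
  · exact h1 i

end Damp

/-! ### The potential argument that bounds the number of phases. -/

section Phases

variable {ι : Type*} [Fintype ι] [DecidableEq ι]

/-- The state of the damping vector `q` after `t` phases that did not produce a solution of the
relaxation; `c` is the total relative trace that was found at heavy vertices. -/
structure Progress (B : Matrix ι ι ℝ) (ε K : ℝ) (m t : ℕ) (q : ι → ℝ) (c : ℝ) : Prop where
  nonneg : ∀ i, 0 ≤ q i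
  le_one : ∀ i, q i ≤ 1
  le_total : ε ^ 2 / 256 * t ≤ c
  total_le : c ≤ 5 * m
  trace_le : (stepMat B q ^ m).trace ≤ Fintype.card ι * 2 ^ m * Real.exp (-(c / 2))
  loss_le : (∑ i, wdeg B i * (1 - q i)) * (m * K) ≤ vol B * c

theorem progress_zero {B : Matrix ι ι ℝ} (hB : Bᵀ = B) (ε K : ℝ) (m : ℕ) :
    Progress B ε K m 0 (fun _ => 1) 0 := by
  refine ⟨fun _ => zero_le_one, fun _ => le_rfl, by simp, by positivity, ?_, by simp⟩
  simpa using trace_pow_le (stepMat_transpose hB _)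
    (fun z => (stepMat_bounds hB (fun _ => zero_le_one) (fun _ => le_rfl) z).1)
    (fun z => (stepMat_bounds hB (fun _ => zero_le_one) (fun _ => le_rfl) z).2) m

/-- A phase either produces a solution of the relaxation or makes progress. -/
theorem Progress.step {B : Matrix ι ι ℝ} (hB : Bᵀ = B) {ε K : ℝ} {j t : ℕ} {q : ι → ℝ} {c : ℝ}
    (h : Progress B ε K (2 ^ (j + 1)) t q c) (hε : 0 < ε) (hK : K * ε = 40)
    (hcard : Fintype.card ι ≤ 2 ^ 2 ^ (j + 1))
    (hm : Fintype.card ι * (1 + ε / 4) ^ 2 ^ (j + 1) ≤ (1 + ε / 2) ^ 2 ^ (j + 1))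
    (hvol : 0 < vol B) {y : ι → ℝ} (hy : ∀ i, y i * y i = 1) (hopt : ε * vol B ≤ quad B y) :
    IsRelaxSol B (relaxVec B q (stepMat B q ^ 2 ^ j) (stepMat B q ^ 2 ^ (j + 1)) K) K
        (ε / 8 * vol B) ∨
      ∃ c', Progress B ε K (2 ^ (j + 1)) (t + 1)
        (damp q (heavy B (stepMat B q ^ 2 ^ (j + 1)) K) (2 ^ (j + 1))) c' := by
  have hK0 : 0 < K := by
    by_contra hc
    nlinarith
  obtain ⟨h0, h1, hle, hc5, htr, hloss⟩ := h
  set m : ℕ := 2 ^ (j + 1) with hmdef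
  have hmpos : 0 < m := by positivity
  have hm1 : (1 : ℝ) ≤ m := by exact_mod_cast hmpos
  have hH := stepMat_transpose hB q
  have hb := stepMat_bounds hB h0 h1
  set P := stepMat B q ^ m with hP
  -- the Rayleigh quotient of the optimal cut
  have hloss' : ∑ i, wdeg B i * (1 - q i) ≤ ε / 8 * vol B := by
    have h3 : (∑ i, wdeg B i * (1 - q i)) * (m * K) ≤ ε / 8 * vol B * (m * K) := by
      refine hloss.trans ((mul_le_mul_of_nonneg_left hc5 hvol.le).trans_eq ?_)
      calc vol B * (5 * m) = vol B * m * 40 / 8 := by ring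
        _ = _ := by rw [← hK]; ring
    exact le_of_mul_le_mul_right h3 (by positivity)
  have hz := dotProduct_sqrt_wdeg B hy
  have hray := le_dotProduct_stepMat hB h0 h1 hy
  set z : ι → ℝ := fun i => √(wdeg B i) * y i with hzdef
  have hray' : (1 + ε / 2) * (z ⬝ᵥ z) ≤ z ⬝ᵥ stepMat B q *ᵥ z := by
    rw [hz]; linarith
  have hzpos : 0 < z ⬝ᵥ z := by rw [hz]; exact hvol
  have htr1 : 1 ≤ P.trace :=
    one_le_trace_pow hH (fun z => (hb z).1) (fun z => (hb z).2) hzpos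
      (le_trans (by nlinarith) hray') m
  have hnext := mul_trace_pow_le hH (fun z => (hb z).1) (fun z => (hb z).2) hzpos hray'
    (by linarith) (ν := 1 + ε / 4) (by linarith) hmpos hm
  -- the total is bounded
  have hc4 : c ≤ 4 * m := by
    have h3 : (Fintype.card ι : ℝ) ≤ 2 ^ m := by exact_mod_cast hcard
    have h4 : (4 : ℝ) ^ m ≤ Real.exp (2 * m) := by
      have := Real.add_one_le_exp 1
      have h5 : (4 : ℝ) ≤ Real.exp 2 := by
        rw [show (2 : ℝ) = 1 + 1 by norm_num, Real.exp_add]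
        nlinarith
      rw [mul_comm, Real.exp_nat_mul]
      exact pow_le_pow_left₀ (by norm_num) h5 m
    -- The trace is at least 1 and at most `n 2^m e^{-c/2} ≤ 4^m e^{-c/2} ≤ e^{2m - c/2}`.
    have h5 : 1 ≤ Real.exp (2 * m) * Real.exp (-(c / 2)) := by
      refine (htr1.trans htr).trans (mul_le_mul_of_nonneg_right ?_ (Real.exp_pos _).le)
      refine le_trans ?_ h4
      rw [show (4 : ℝ) = 2 * 2 by norm_num, mul_pow]
      exact mul_le_mul_of_nonneg_right h3 (by positivity)
    rw [← Real.exp_add] at h5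
    have := Real.one_le_exp_iff.1 h5
    linarith
  have hRP : ∀ i k, P i k = ∑ l, (stepMat B q ^ 2 ^ j) i l * (stepMat B q ^ 2 ^ j) k l := by
    intro i k
    rw [hP, hmdef, pow_succ, mul_two, pow_add, mul_apply]
    refine Finset.sum_congr rfl fun l _ => ?_
    have : (stepMat B q ^ 2 ^ j)ᵀ = stepMat B q ^ 2 ^ j := by rw [transpose_pow, hH]
    rw [← congr_fun (congr_fun this l) k, transpose_apply]
  have hP0 : ∀ i, 0 ≤ P i i := fun i => by
    rw [hRP]; exact Finset.sum_nonneg fun l _ => mul_self_nonneg _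
  by_cases hheavy : ∑ i ∈ heavy B P K, P i i ≤ ε ^ 2 / 256 * P.trace
  · left
    refine isRelaxSol_relaxVec hB h0 h1 hRP (by linarith) hε hK0.le ?_ hheavy
    rw [← pow_succ']
    exact hnext
  · right
    push Not at hheavy
    set S := heavy B P K with hS
    set Y := (∑ i ∈ S, P i i) / P.trace with hY
    have htr0 : 0 < P.trace := by linarith
    have hYtr : ∑ i ∈ S, P i i = Y * P.trace := by rw [hY, div_mul_cancel₀ _ htr0.ne']
    have hYlow : ε ^ 2 / 256 ≤ Y := by
      rw [hYtr] at hheavy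
      exact (lt_of_mul_lt_mul_right hheavy htr0.le).le
    have hY1 : Y ≤ 1 := by
      rw [hY, div_le_one htr0]
      exact Finset.sum_le_univ_sum_of_nonneg hP0
    refine ⟨c + Y, fun i => damp_nonneg h0 S hmpos i, fun i => damp_le_one h0 h1 S m i, ?_, ?_,
      ?_, ?_⟩
    · push_cast
      linarith
    -- The share satisfies `Y ≤ 1 ≤ m`, so the sharper bound `4m` before the phase leaves room for
    -- it in `5m`.
    · linarith
    · have h3 := trace_stepMat_damp_pow_le hB q S j
      rw [← hmdef, ← hP, hYtr] at h3
      have h4 : 1 - Y / 2 ≤ Real.exp (-(Y / 2)) := by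
        have := Real.add_one_le_exp (-(Y / 2)); linarith
      calc _ ≤ P.trace * (1 - Y / 2) := by linarith
        _ ≤ P.trace * Real.exp (-(Y / 2)) := mul_le_mul_of_nonneg_left h4 htr0.le
        _ ≤ _ * Real.exp (-(Y / 2)) := mul_le_mul_of_nonneg_right htr (Real.exp_pos _).le
        _ = _ := by
          rw [mul_assoc, ← Real.exp_add]
          congr 2; ring
    · have h3 := sum_wdeg_damp_le B h1 S hmpos
      -- Summing the heaviness condition over `S`: the loss of degree is paid for by the removed
      -- trace.
      have h4 : (∑ i ∈ S, wdeg B i) * K ≤ vol B * Y := by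
        refine le_of_mul_le_mul_right ?_ htr0
        rw [mul_assoc (vol B), ← hYtr, Finset.sum_mul, Finset.sum_mul, Finset.mul_sum]
        refine Finset.sum_le_sum fun i hi => ?_
        have : K * wdeg B i * P.trace < vol B * P i i := (Finset.mem_filter.1 hi).2
        linarith
      have h5 := mul_le_mul_of_nonneg_right h3 (by positivity : 0 ≤ (m : ℝ) * K)
      have h6 : (∑ i ∈ S, wdeg B i) / m * (m * K) = (∑ i ∈ S, wdeg B i) * K := by
        field_simp
      rw [add_mul, h6] at h5
      linarith

/-- The size of the exponent that makes the phases work. -/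
theorem card_mul_pow_le {N a l m : ℕ} (ha : 0 < a) (hN : N ≤ 2 ^ l) (hm : 5 * a * l ≤ m) :
    (N : ℝ) * (1 + 1 / (a : ℝ) / 4) ^ m ≤ (1 + 1 / (a : ℝ) / 2) ^ m := by
  have ha' : (1 : ℝ) ≤ a := by exact_mod_cast ha
  -- Bernoulli's inequality; hence `N ≤ 2^l` is absorbed by `(1 + 1/(5a))^m`.
  have h1 : (2 : ℝ) ≤ (1 + 1 / (5 * a : ℝ)) ^ (5 * a) := by
    have := one_add_mul_le_pow (a := 1 / (5 * a : ℝ))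
      (by have : (0 : ℝ) ≤ 1 / (5 * a : ℝ) := by positivity
          linarith) (5 * a)
    refine le_trans (le_of_eq ?_) this
    push_cast
    field_simp
    norm_num
  have h2 : (N : ℝ) ≤ (1 + 1 / (5 * a : ℝ)) ^ m := by
    have h3 : (1 : ℝ) ≤ 1 + 1 / (5 * a : ℝ) := by
      have : (0 : ℝ) ≤ 1 / (5 * a : ℝ) := by positivity
      linarith
    calc (N : ℝ) ≤ 2 ^ l := by exact_mod_cast hN
      _ ≤ ((1 + 1 / (5 * a : ℝ)) ^ (5 * a)) ^ l := pow_le_pow_left₀ zero_le_two h1 l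
      _ = (1 + 1 / (5 * a : ℝ)) ^ (5 * a * l) := by rw [← pow_mul]
      _ ≤ _ := pow_le_pow_right₀ h3 hm
  calc (N : ℝ) * (1 + 1 / (a : ℝ) / 4) ^ m
      ≤ (1 + 1 / (5 * a : ℝ)) ^ m * (1 + 1 / (a : ℝ) / 4) ^ m :=
        mul_le_mul_of_nonneg_right h2 (by positivity)
    _ = ((1 + 1 / (5 * a : ℝ)) * (1 + 1 / (a : ℝ) / 4)) ^ m := by rw [mul_pow]
    _ ≤ _ := by
      -- With `x = 1/a ≤ 1`, the product `(1 + x/5)(1 + x/4)` is at most `1 + x/2`, since 1/5 + 1/4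
      -- + 1/20 = 1/2.
      refine pow_le_pow_left₀ (by positivity) ?_ m
      have h4 : 1 / (5 * a : ℝ) = 1 / (a : ℝ) / 5 := by field_simp
      have h5 : 1 / (a : ℝ) ≤ 1 := (div_le_one (by linarith)).2 ha'
      have h6 : 0 < 1 / (a : ℝ) := by positivity
      rw [h4]
      nlinarith

end Phases

end CutGain

/-! ## Rounding -/

namespace CutGain

section Rounding

variable {ι : Type*} [Fintype ι]

/-- The bilinear form of `B`. -/
def bilin (B : Matrix ι ι ℝ) (x y : ι → ℝ) : ℝ := ∑ i, ∑ j, B i j * (x i * y j)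

theorem bilin_comm {B : Matrix ι ι ℝ} (hB : Bᵀ = B) (x y : ι → ℝ) :
    bilin B x y = bilin B y x := by
  have hs : ∀ i j, B j i = B i j := fun i j => congr_fun (congr_fun hB i) j
  unfold bilin
  rw [Finset.sum_comm]
  exact Finset.sum_congr rfl fun i _ => Finset.sum_congr rfl fun j _ => by rw [hs]; ring

theorem quad_add_smul {B : Matrix ι ι ℝ} (hB : Bᵀ = B) (x y : ι → ℝ) (s : ℝ) :
    quad B (fun i => x i + s * y i) = quad B x + 2 * s * bilin B x y + s ^ 2 * quad B y := by
  have h : quad B (fun i => x i + s * y i) =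
      quad B x + s * bilin B x y + s * bilin B y x + s ^ 2 * quad B y := by
    simp only [quad, bilin, Finset.mul_sum, ← Finset.sum_add_distrib]
    exact Finset.sum_congr rfl fun i _ => Finset.sum_congr rfl fun j _ => by ring
  rw [h, bilin_comm hB y x]
  ring

/-- A lower bound for the conditional expectation of `gᵀ B g - c ∑ dᵢ gᵢ⁴` when random signs are
given to the columns of `U` in `rem`. -/
def signPot (B U : Matrix ι ι ℝ) (c : ℝ) (g : ι → ℝ) (rem : Finset ι) : ℝ :=
  quad B g + ∑ l ∈ rem, quad B (fun i => U i l) -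
    c * ∑ i, wdeg B i * (g i ^ 4 + 6 * g i ^ 2 * ∑ l ∈ rem, U i l ^ 2 +
      3 * (∑ l ∈ rem, U i l ^ 2) ^ 2)

/-- The dependence of the potential on the next sign. -/
def signDiff (B U : Matrix ι ι ℝ) (c : ℝ) (g : ι → ℝ) (rem : Finset ι) (l : ι) : ℝ :=
  bilin B g (fun i => U i l) - c * ∑ i, wdeg B i *
    (2 * g i ^ 3 * U i l + 2 * g i * U i l ^ 3 + 6 * g i * U i l * ∑ l ∈ rem, U i l ^ 2)

/-- The new potential is the old one plus `2 s` times `signDiff` plus a nonnegative term: replacing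
`3(U² + σ²)²` by the exact fourth moment leaves a surplus `2 c d_i U⁴` at each vertex. The sign `s`
is chosen to make the linear term nonnegative. -/
theorem signPot_le [DecidableEq ι] {B : Matrix ι ι ℝ} (hB : Bᵀ = B) (U : Matrix ι ι ℝ) {c : ℝ}
    (hc : 0 ≤ c) (g : ι → ℝ) {rem : Finset ι} {l : ι} (hl : l ∉ rem) :
    signPot B U c g (insert l rem) ≤ signPot B U c
      (fun i => g i + (if signDiff B U c g rem l < 0 then -1 else 1) * U i l) rem := by
  set s : ℝ := if signDiff B U c g rem l < 0 then -1 else 1 with hs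
  have hs2 : s ^ 2 = 1 := by rw [hs]; split_ifs <;> norm_num
  have hsd : 0 ≤ s * signDiff B U c g rem l := by
    rw [hs]; split_ifs <;> linarith
  unfold signPot
  simp only [Finset.sum_insert hl]
  rw [quad_add_smul hB, hs2]
  have key : ∑ i, wdeg B i * ((g i + s * U i l) ^ 4 +
      6 * (g i + s * U i l) ^ 2 * ∑ l ∈ rem, U i l ^ 2 + 3 * (∑ l ∈ rem, U i l ^ 2) ^ 2) ≤
      ∑ i, wdeg B i * (g i ^ 4 + 6 * g i ^ 2 * (U i l ^ 2 + ∑ l ∈ rem, U i l ^ 2) +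
        3 * (U i l ^ 2 + ∑ l ∈ rem, U i l ^ 2) ^ 2) + 2 * s * ∑ i, wdeg B i *
        (2 * g i ^ 3 * U i l + 2 * g i * U i l ^ 3 + 6 * g i * U i l * ∑ l ∈ rem, U i l ^ 2) := by
    rw [Finset.mul_sum, ← Finset.sum_add_distrib]
    refine Finset.sum_le_sum fun i _ => ?_
    have h0 := mul_nonneg (wdeg_nonneg B i) (by positivity : 0 ≤ 2 * U i l ^ 4)
    have h3 : s ^ 3 = s := by rw [pow_succ, hs2, one_mul]
    have h4 : s ^ 4 = 1 := by rw [show s ^ 4 = (s ^ 2) ^ 2 by ring, hs2, one_pow]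
    have e : (g i + s * U i l) ^ 4 + 6 * (g i + s * U i l) ^ 2 * ∑ l ∈ rem, U i l ^ 2 +
        3 * (∑ l ∈ rem, U i l ^ 2) ^ 2 =
        g i ^ 4 + 6 * g i ^ 2 * (U i l ^ 2 + ∑ l ∈ rem, U i l ^ 2) +
        3 * (U i l ^ 2 + ∑ l ∈ rem, U i l ^ 2) ^ 2 - 2 * U i l ^ 4 + 2 * s *
        (2 * g i ^ 3 * U i l + 2 * g i * U i l ^ 3 + 6 * g i * U i l * ∑ l ∈ rem, U i l ^ 2) := by
      linear_combination (6 * g i ^ 2 * U i l ^ 2 + 6 * U i l ^ 2 * ∑ l ∈ rem, U i l ^ 2) * hs2 +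
        4 * g i * U i l ^ 3 * h3 + U i l ^ 4 * h4
    rw [e]
    linarith
  have key' := mul_le_mul_of_nonneg_left key hc
  unfold signDiff at hsd
  linarith

theorem signPot_empty (B U : Matrix ι ι ℝ) (c : ℝ) (g : ι → ℝ) :
    signPot B U c g ∅ = quad B g - c * ∑ i, wdeg B i * g i ^ 4 := by
  simp [signPot]

/-- Before any sign is fixed the quadratic terms give the objective of the relaxation, and the
fourth-moment terms are at most `3 |u_i|⁴ ≤ 3 K |u_i|²`, controlled by the average length. -/
theorem IsRelaxSol.le_signPot {B U : Matrix ι ι ℝ} {K v : ℝ} (h : IsRelaxSol B U K v) {c : ℝ}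
    (hc : 0 ≤ c) (hK : 0 ≤ K) :
    v - 3 * c * K * vol B ≤ signPot B U c (fun _ => 0) Finset.univ := by
  have h1 : ∑ l, quad B (fun i => U i l) = ∑ i, ∑ j, B i j * ∑ l, U i l * U j l := by
    simp only [quad, Finset.mul_sum]
    rw [Finset.sum_comm]
    exact Finset.sum_congr rfl fun i _ => Finset.sum_comm
  have h2 : ∑ i, wdeg B i * (∑ l, U i l ^ 2) ^ 2 ≤ K * vol B := by
    refine le_trans ?_ (mul_le_mul_of_nonneg_left h.avg hK)
    rw [Finset.mul_sum]
    refine Finset.sum_le_sum fun i _ => ?_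
    have := mul_le_mul_of_nonneg_right (h.row i)
      (mul_nonneg (wdeg_nonneg B i) (Finset.sum_nonneg fun l (_ : l ∈ Finset.univ) =>
        sq_nonneg (U i l)))
    linarith
  have h3 : signPot B U c (fun _ => 0) Finset.univ = ∑ l, quad B (fun i => U i l) -
      3 * c * ∑ i, wdeg B i * (∑ l, U i l ^ 2) ^ 2 := by
    simp only [signPot, quad, mul_zero, Finset.sum_const_zero, zero_add, ne_eq, OfNat.ofNat_ne_zero,
      not_false_eq_true, zero_pow, zero_mul, Finset.mul_sum]
    congr 1
    exact Finset.sum_congr rfl fun i _ => by ring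
  rw [h3, h1]
  have h4 := mul_le_mul_of_nonneg_left h2 (by positivity : 0 ≤ 3 * c)
  have := h.obj
  linarith

/-- Truncation to `[-1, 1]` after division by `T`. -/
noncomputable def clip (T g : ℝ) : ℝ := if T < g then 1 else if g < -T then -1 else g / T

theorem abs_clip_le {T : ℝ} (hT : 0 < T) (g : ℝ) : |clip T g| ≤ 1 := by
  unfold clip
  split_ifs with h1 h2
  · simp
  · simp
  · rw [abs_div, abs_of_pos hT, div_le_one hT, abs_le]
    constructor <;> linarith

theorem abs_mul_clip_le {T : ℝ} (hT : 0 < T) (g : ℝ) : |T * clip T g| ≤ |g| := by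
  unfold clip
  split_ifs with h1 h2
  · rw [mul_one, abs_of_pos hT]; exact h1.le.trans (le_abs_self g)
  · rw [mul_neg_one, abs_neg, abs_of_pos hT]
    have := neg_le_abs g
    linarith
  · rw [mul_div_cancel₀ _ hT.ne']

theorem mul_clip_of_abs_le {T : ℝ} (hT : 0 < T) {g : ℝ} (h : |g| ≤ T) : T * clip T g = g := by
  have h' := abs_le.1 h
  rw [clip, if_neg (by linarith), if_neg (by linarith), mul_div_cancel₀ _ hT.ne']

/-- Let `|g| ≥ |h|`. Nothing changes if `|g| ≤ T`; otherwise the error is at most `|gh| ≤ g² ≤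
g⁴/T²`, which is `c g⁴/2`. -/
theorem abs_mul_sub_mul_clip_le {T c : ℝ} (hT : 0 < T) (hc : c * T ^ 2 = 2) (g h : ℝ) :
    |g * h - T * clip T g * (T * clip T h)| ≤ c * (g ^ 4 / 2 + h ^ 4 / 2) := by
  have hc0 : 0 < c := by
    by_contra hc'
    nlinarith [mul_nonneg (neg_nonneg.2 (not_lt.1 hc')) (sq_nonneg T)]
  wlog hgh : |h| ≤ |g| generalizing g h
  · have := this h g (le_of_not_ge hgh)
    rw [mul_comm h g, mul_comm (T * clip T h)] at this
    linarith
  by_cases hg : |g| ≤ T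
  · rw [mul_clip_of_abs_le hT hg, mul_clip_of_abs_le hT (hgh.trans hg), sub_self, abs_zero]
    positivity
  · push Not at hg
    have a1 : |g * h| ≤ g ^ 2 := by
      rw [abs_mul, ← sq_abs g, sq]
      exact mul_le_mul_of_nonneg_left hgh (abs_nonneg g)
    have a2 : |T * clip T g * (T * clip T h)| ≤ |g * h| := by
      rw [abs_mul, abs_mul g]
      exact mul_le_mul (abs_mul_clip_le hT g) (abs_mul_clip_le hT h) (abs_nonneg _) (abs_nonneg _)
    have a5 : 0 ≤ (g * h) * (T * clip T g * (T * clip T h)) := by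
      have b : ∀ x : ℝ, 0 ≤ x * (T * clip T x) := by
        intro x
        unfold clip
        split_ifs with h1 h2
        · nlinarith
        · nlinarith
        · rw [mul_div_cancel₀ _ hT.ne']; exact mul_self_nonneg x
      have := mul_nonneg (b g) (b h)
      linarith
    -- The truncated product has the sign of `gh` and no larger modulus, so subtracting it cannot
    -- increase the modulus.
    have a3 : |g * h - T * clip T g * (T * clip T h)| ≤ |g * h| := by
      rw [← sq_le_sq]
      have := sq_le_sq.2 a2
      nlinarith
    have a4 : g ^ 2 ≤ c * (g ^ 4 / 2) := by
      have : T ^ 2 ≤ g ^ 2 := by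
        rw [← sq_abs g]; exact pow_le_pow_left₀ hT.le hg.le 2
      have b2 := mul_le_mul_of_nonneg_left this (mul_nonneg hc0.le (sq_nonneg g))
      have e : c * g ^ 2 * T ^ 2 = 2 * g ^ 2 := by rw [← hc]; ring
      rw [e] at b2
      linarith
    have : 0 ≤ c * (h ^ 4 / 2) := by positivity
    linarith

theorem le_quad_clip {B : Matrix ι ι ℝ} (hB : Bᵀ = B) {T c : ℝ} (hT : 0 < T) (hc : c * T ^ 2 = 2)
    (g : ι → ℝ) :
    quad B g - c * ∑ i, wdeg B i * g i ^ 4 ≤ T ^ 2 * quad B (fun i => clip T (g i)) := by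
  have h1 : quad B g - T ^ 2 * quad B (fun i => clip T (g i)) ≤
      ∑ i, ∑ j, |B i j| * (c * (g i ^ 4 / 2) + c * (g j ^ 4 / 2)) := by
    simp only [quad, Finset.mul_sum, ← Finset.sum_sub_distrib]
    refine Finset.sum_le_sum fun i _ => Finset.sum_le_sum fun j _ => ?_
    have e : B i j * (g i * g j) - T ^ 2 * (B i j * (clip T (g i) * clip T (g j))) =
        B i j * (g i * g j - T * clip T (g i) * (T * clip T (g j))) := by ring
    rw [e]
    refine (le_abs_self _).trans ?_
    rw [abs_mul, ← mul_add]
    exact mul_le_mul_of_nonneg_left (abs_mul_sub_mul_clip_le hT hc _ _) (abs_nonneg _)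
  rw [sum_abs_mul_add hB (fun i => c * (g i ^ 4 / 2)) (fun i => c * (g i ^ 4 / 2))] at h1
  have h2 : ∑ i, wdeg B i * (c * (g i ^ 4 / 2) + c * (g i ^ 4 / 2)) =
      c * ∑ i, wdeg B i * g i ^ 4 := by
    rw [Finset.mul_sum]
    exact Finset.sum_congr rfl fun i _ => by ring
  linarith

/-- With zero diagonal the form is affine in each coordinate, so over [-1, 1] it is maximized at the
endpoint in the direction of the slope. -/
theorem quad_le_quad_update [DecidableEq ι] {B : Matrix ι ι ℝ} (hB : Bᵀ = B) (h0 : ∀ i, B i i = 0)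
    (x : ι → ℝ) (i : ι) (hx : |x i| ≤ 1) :
    quad B x ≤ quad B (Function.update x i (if ∑ j, B i j * x j < 0 then -1 else 1)) := by
  set s : ℝ := if ∑ j, B i j * x j < 0 then -1 else 1 with hs
  have e1 : Function.update x i s = fun k => x k + (s - x i) * (if k = i then 1 else 0) := by
    ext k
    by_cases hk : k = i
    · subst hk; simp
    · simp [hk]
  have e2 : bilin B x (fun k => if k = i then 1 else 0) = ∑ j, B i j * x j := by
    rw [bilin_comm hB]
    simp [bilin]
  have e3 : quad B (fun k => if k = i then 1 else 0) = 0 := by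
    simp [quad, h0]
  rw [e1, quad_add_smul hB, e2, e3]
  have h1 := abs_le.1 hx
  have : 0 ≤ (s - x i) * ∑ j, B i j * x j := by
    rw [hs]
    split_ifs with h
    · exact mul_nonneg_of_nonpos_of_nonpos (by linarith) h.le
    · exact mul_nonneg (by linarith) (not_lt.1 h)
  linarith

/-- The vector that is rounded for very small optima. -/
noncomputable def starVec [DecidableEq ι] (B : Matrix ι ι ℝ) (i : ι) (j : ι) : ℝ :=
  (if i = j then 1 else 0) + B i j / (wdeg B i * Fintype.card ι * Fintype.card ι)

/-- Small enough that the quadratic contribution of these entries is at most `vol / N⁴`. -/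
theorem abs_div_wdeg_le (B : Matrix ι ι ℝ) (i j : ι) (N : ℕ) (hN : 0 < N) :
    |B i j / (wdeg B i * N * N)| ≤ 1 / (N : ℝ) ^ 2 := by
  have h1 : |B i j| ≤ wdeg B i :=
    Finset.single_le_sum (f := fun j => |B i j|) (fun j _ => abs_nonneg _) (Finset.mem_univ j)
  have hN' : (0 : ℝ) < N := by exact_mod_cast hN
  rcases (wdeg_nonneg B i).eq_or_lt with h | h
  · rw [← h]; simp
  · rw [abs_div, abs_of_pos (by positivity : 0 < wdeg B i * N * N),
      div_le_div_iff₀ (by positivity) (by positivity)]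
    have := mul_le_mul_of_nonneg_right h1 (by positivity : 0 ≤ (N : ℝ) ^ 2)
    linarith

theorem abs_starVec_le [DecidableEq ι] {B : Matrix ι ι ℝ} (h0 : ∀ i, B i i = 0) (i j : ι) :
    |starVec B i j| ≤ 1 := by
  unfold starVec
  by_cases h : i = j
  · subst h; simp [h0]
  · rw [if_neg h, zero_add]
    have hN : 0 < Fintype.card ι := Fintype.card_pos_iff.2 ⟨i⟩
    refine (abs_div_wdeg_le B i j _ hN).trans ?_
    have : (1 : ℝ) ≤ Fintype.card ι := by exact_mod_cast hN
    rw [div_le_one (by positivity)]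
    exact one_le_pow₀ this

/-- Write the vector as `e_i + w`. The cross term is `2 ∑_j B_ij w_j`, where by Cauchy-Schwarz the
sum is at least `d_i / n³ ≥ vol / n⁴` for a vertex of at least average degree; the form at `w` can
cancel only one of the two copies. -/
theorem exists_le_quad_starVec [DecidableEq ι] {B : Matrix ι ι ℝ} (hB : Bᵀ = B)
    (h0 : ∀ i, B i i = 0) (hvol : 0 < vol B) :
    ∃ i, vol B / (Fintype.card ι : ℝ) ^ 4 ≤ quad B (starVec B i) := by
  have hne : Nonempty ι := by
    by_contra h
    rw [not_nonempty_iff] at h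
    simp [vol] at hvol
  have hN : 0 < Fintype.card ι := Fintype.card_pos
  have hN' : (0 : ℝ) < Fintype.card ι := by exact_mod_cast hN
  obtain ⟨i, hi⟩ : ∃ i, vol B ≤ Fintype.card ι * wdeg B i := by
    by_contra! h
    have : Fintype.card ι * vol B < vol B * Fintype.card ι := by
      calc Fintype.card ι * vol B = ∑ i : ι, Fintype.card ι * wdeg B i := by
            rw [← Finset.mul_sum]; rfl
        _ < ∑ i : ι, vol B :=
          Finset.sum_lt_sum_of_nonempty Finset.univ_nonempty fun i _ => h i
        _ = _ := by simp [mul_comm]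
    linarith
  refine ⟨i, ?_⟩
  set N : ℝ := (Fintype.card ι : ℝ) with hNdef
  have hd : 0 < wdeg B i := by
    by_contra h
    nlinarith [mul_nonneg hN'.le (neg_nonneg.2 (not_lt.1 h))]
  set w : ι → ℝ := fun j => B i j / (wdeg B i * N * N) with hw
  have e : starVec B i = fun j => (if i = j then 1 else 0) + 1 * w j := by
    ext j; simp [starVec, hw, hNdef]
  have e1 : quad B (fun j => if i = j then (1 : ℝ) else 0) = 0 := by simp [quad, h0]
  have e2 : bilin B (fun j => if i = j then 1 else 0) w = ∑ j, B i j * w j := by simp [bilin]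
  rw [e, quad_add_smul hB, e1, e2]
  have h1 : wdeg B i ≤ N ^ 3 * ∑ j, B i j * w j := by
    have h2 : wdeg B i ^ 2 ≤ N * ∑ j, B i j ^ 2 := by
      have := sq_sum_le_card_mul_sum_sq (s := Finset.univ) (f := fun j => |B i j|)
      simpa [wdeg, hNdef] using this
    have h3 : N ^ 3 * ∑ j, B i j * w j = N * (∑ j, B i j ^ 2) / wdeg B i := by
      rw [Finset.mul_sum, Finset.mul_sum, Finset.sum_div]
      refine Finset.sum_congr rfl fun j _ => ?_
      simp only [hw]
      field_simp
    rw [h3, le_div_iff₀ hd]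
    linarith
  have h4 : -(vol B / N ^ 4) ≤ quad B w := by
    have h5 : |quad B w| ≤ ∑ i, ∑ j, |B i j| * (1 / N ^ 4) := by
      refine (Finset.abs_sum_le_sum_abs _ _).trans (Finset.sum_le_sum fun k _ =>
        (Finset.abs_sum_le_sum_abs _ _).trans (Finset.sum_le_sum fun j _ => ?_))
      rw [abs_mul, abs_mul]
      refine mul_le_mul_of_nonneg_left ?_ (abs_nonneg _)
      calc |w k| * |w j| ≤ (1 / N ^ 2) * (1 / N ^ 2) :=
            mul_le_mul (abs_div_wdeg_le B i k _ hN) (abs_div_wdeg_le B i j _ hN) (abs_nonneg _)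
              (by positivity)
        _ = _ := by field_simp
    have h6 : ∑ i, ∑ j, |B i j| * (1 / N ^ 4) = vol B / N ^ 4 := by
      simp only [← Finset.sum_mul]
      rw [mul_one_div]; rfl
    rw [h6] at h5
    exact (abs_le.1 h5).1
  have h7 : vol B / N ^ 4 ≤ ∑ j, B i j * w j := by
    rw [div_le_iff₀ (by positivity)]
    have := mul_le_mul_of_nonneg_left h1 hN'.le
    linarith
  linarith

end Rounding

end CutGain

/-! ## A language of loop programs

Expressions with bounded sums and commands with bounded loops, their translation into programs of
the random access machine, and a bound for the running time.  Index register `0` holds the number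
of vertices, `1` and `2` hold the constants `0` and `1`, and `3` holds the length of the second kind
of loops.  The loop variable that is bound at nesting depth `d` is held in index register `d`.  Real
registers from `100` on are used for intermediate results. -/

namespace RealRAM

/-- Real expressions. -/
inductive RExp
  | const (q : ℚ)
  | reg (r : ℕ)
  | arr (a x y : ℕ)
  | op (o : Op) (e f : RExp)
  | sqrt (e : RExp)
  | lt (x y : ℕ)
  | ite (e f g h : RExp)
  | sum (e : RExp)

/-- The part of the state that commands change. -/
structure Mem where
  reg : ℕ → ℝ
  arr : ℕ → ℕ → ℕ → ℝ
  out : ℕ → ℕ → ℕ → ℕ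

namespace RExp

/-- The value of an expression; `ite e f g h` is `g` if `e < f` and `h` otherwise. -/
noncomputable def eval (M : Mem) : RExp → ℕ → (ℕ → ℕ) → ℝ
  | const q, _, _ => q
  | reg r, _, _ => M.reg r
  | arr a x y, _, ρ => M.arr a (ρ x) (ρ y)
  | op o e f, d, ρ => o.eval (e.eval M d ρ) (f.eval M d ρ)
  | sqrt e, d, ρ => √(e.eval M d ρ)
  | lt x y, _, ρ => if ρ x < ρ y then 1 else 0
  | ite e f g h, d, ρ =>
    open Classical in if e.eval M d ρ < f.eval M d ρ then g.eval M d ρ else h.eval M d ρ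
  | sum e, d, ρ => ∑ k ∈ Finset.range (ρ 0), e.eval M (d + 1) (Function.update ρ d k)

/-- Well-formedness at nesting depth `d`. -/
def wf : RExp → ℕ → Bool
  | const _, _ => true
  | reg r, _ => decide (r < 100)
  | arr _ x y, d => decide (x < d) && decide (y < d)
  | op _ e f, d => e.wf d && f.wf d
  | sqrt e, d => e.wf d
  | lt x y, d => decide (x < d) && decide (y < d)
  | ite e f g h, d => e.wf d && f.wf d && g.wf d && h.wf d
  | sum e, d => e.wf (d + 1)

/-- Whether an expression does not read the array `a`. -/
def avoids (a : ℕ) : RExp → Bool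
  | const _ => true
  | reg _ => true
  | arr b _ _ => decide (b ≠ a)
  | op _ e f => e.avoids a && f.avoids a
  | sqrt e => e.avoids a
  | lt _ _ => true
  | ite e f g h => e.avoids a && f.avoids a && g.avoids a && h.avoids a
  | sum e => e.avoids a

/-- Lets an array be filled entry by entry: the partial writes do not influence the later values of
the expression. -/
theorem eval_congr {a : ℕ} {M M' : Mem} (hreg : M'.reg = M.reg)
    (harr : ∀ b, b ≠ a → M'.arr b = M.arr b) (e : RExp) (he : e.avoids a = true) (d : ℕ)
    (ρ : ℕ → ℕ) : e.eval M' d ρ = e.eval M d ρ := by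
  induction e generalizing d ρ with
  | const q => rfl
  | reg r => simp [eval, hreg]
  | arr b x y => simp only [avoids, decide_eq_true_eq] at he; simp [eval, harr b he]
  | op o e f ihe ihf =>
    simp only [avoids, Bool.and_eq_true] at he
    simp [eval, ihe he.1, ihf he.2]
  | sqrt e ih => simp only [avoids] at he; simp [eval, ih he]
  | lt x y => rfl
  | ite e f g h ihe ihf ihg ihh =>
    simp only [avoids, Bool.and_eq_true] at he
    simp [eval, ihe he.1.1.1, ihf he.1.1.2, ihg he.1.2, ihh he.2]
  | sum e ih =>
    simp only [avoids] at he
    simp only [eval]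
    exact Finset.sum_congr rfl fun k _ => ih he _ _

/-- Translation; the value is left in the real register `k`. -/
def comp : RExp → ℕ → ℕ → Prog
  | const q, k, _ => .instr (.const k q)
  -- There is no move between real registers, so the register is added to 0.
  | reg r, k, _ => .seq (.instr (.const k 0)) (.instr (.op .add k r k))
  | arr a x y, k, _ => .instr (.load k a x y)
  | op o e f, k, d =>
    .seq (e.comp k d) (.seq (f.comp (k + 1) d) (.instr (.op o k k (k + 1))))
  | sqrt e, k, d => .seq (e.comp k d) (.instr (.sqrt k k))
  | lt x y, k, _ => .ite (.ilt x y) (.instr (.const k 1)) (.instr (.const k 0))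
  | ite e f g h, k, d =>
    .seq (e.comp k d) (.seq (f.comp (k + 1) d) (.ite (.rlt k (k + 1)) (g.comp k d) (h.comp k d)))
  | sum e, k, d =>
    .seq (.instr (.const k 0)) (.seq (.instr (.zero d)) (.while (.ilt d 0)
      (.seq (e.comp (k + 1) (d + 1)) (.seq (.instr (.op .add k k (k + 1))) (.instr (.succ d))))))

/-- The coefficient of the time bound. -/
def size : RExp → ℕ
  | const _ => 1
  | reg _ => 2
  | arr _ _ _ => 1
  | op _ e f => e.size + f.size + 1
  | sqrt e => e.size + 1
  | lt _ _ => 2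
  | ite e f g h => e.size + f.size + g.size + h.size + 1
  | sum e => e.size + 6

/-- The exponent of the time bound. -/
def depth : RExp → ℕ
  | const _ => 0
  | reg _ => 0
  | arr _ _ _ => 0
  | op _ e f => max e.depth f.depth
  | sqrt e => e.depth
  | lt _ _ => 0
  | ite e f g h => max (max e.depth f.depth) (max g.depth h.depth)
  | sum e => e.depth + 1

end RExp

/-- The state `s` holds the indices `ρ` below `d` and the memory `M`. -/
structure Holds (d : ℕ) (ρ : ℕ → ℕ) (M : Mem) (s : State) : Prop where
  idx : ∀ x < d, s.idx x = ρ x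
  reg : ∀ r < 100, s.reg r = M.reg r
  arr : s.arr = M.arr
  out : s.idxArr = M.out

theorem Holds.setReg {d : ℕ} {ρ : ℕ → ℕ} {M : Mem} {s : State} (h : Holds d ρ M s) {k : ℕ}
    (hk : 100 ≤ k) (v : ℝ) : Holds d ρ M { s with reg := Function.update s.reg k v } :=
  ⟨h.idx, fun r hr => by
    have : r ≠ k := by omega
    simp [Function.update_of_ne this, h.reg r hr], h.arr, h.out⟩

theorem Holds.setIdx {d : ℕ} {ρ : ℕ → ℕ} {M : Mem} {s : State} (h : Holds d ρ M s) (v : ℕ) :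
    Holds (d + 1) (Function.update ρ d v) M { s with idx := Function.update s.idx d v } :=
  ⟨fun x hx => by
    rcases eq_or_ne x d with rfl | hne
    · simp
    · simp [Function.update_of_ne hne, h.idx x (by omega)], h.reg, h.arr, h.out⟩

theorem Holds.weaken {d : ℕ} {ρ : ℕ → ℕ} {v : ℕ} {M : Mem} {s : State}
    (h : Holds (d + 1) (Function.update ρ d v) M s) : Holds d ρ M s :=
  ⟨fun x hx => by
    rw [h.idx x (by omega), Function.update_of_ne (by omega)], h.reg, h.arr, h.out⟩

/-- Iteration of a body with a counter. -/
theorem exec_while {x b : ℕ} {p : Prog} {N T : ℕ} {I : ℕ → State → Prop}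
    (hx : ∀ k s, I k s → s.idx x = k) (hb : ∀ k s, I k s → s.idx b = N)
    (hp : ∀ k < N, ∀ s, I k s → ∃ t s', Exec p s t s' ∧ t ≤ T ∧ I (k + 1) s') :
    ∀ s, I 0 s → ∃ t s', Exec (.while (.ilt x b) p) s t s' ∧ t ≤ N * (T + 1) + 1 ∧ I N s' := by
  have key : ∀ j k, k + j = N → ∀ s, I k s →
      ∃ t s', Exec (.while (.ilt x b) p) s t s' ∧ t ≤ j * (T + 1) + 1 ∧ I N s' := by
    intro j
    induction j with
    | zero =>
      intro k hk s hs
      obtain rfl : k = N := by omega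
      refine ⟨1, s, .while_false ?_, by omega, hs⟩
      simp [Test.holds, hx k s hs, hb k s hs]
    | succ j ih =>
      intro k hk s hs
      obtain ⟨t, s', he, ht, hs'⟩ := hp k (by omega) s hs
      obtain ⟨t', s'', he', ht', hs''⟩ := ih (k + 1) (by omega) s' hs'
      refine ⟨1 + t + t', s'', .while_true ?_ he he', ?_, hs''⟩
      · simp only [Test.holds, hx k s hs, hb k s hs]; omega
      · rw [Nat.add_mul]; omega
  exact fun s hs => key N 0 (by omega) s hs

theorem mul_pow_le_mul_pow {s A a a' : ℕ} (h : a ≤ a') : s * (A + 1) ^ a ≤ s * (A + 1) ^ a' :=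
  Nat.mul_le_mul_left _ (Nat.pow_le_pow_right (Nat.succ_pos A) h)

/-- Registers below `k` must survive, since a left operand waits in `k` while the right one is
computed in `k + 1`; an accumulator waits in the same way during a sum. -/
theorem RExp.exec_comp (M : Mem) (e : RExp) : ∀ (d : ℕ) (ρ : ℕ → ℕ) (k : ℕ) (s : State),
    e.wf d = true → 0 < d → 100 ≤ k → Holds d ρ M s →
    ∃ t s', Exec (e.comp k d) s t s' ∧ t ≤ e.size * (ρ 0 + 1) ^ e.depth ∧
      s'.reg k = e.eval M d ρ ∧ Holds d ρ M s' ∧ ∀ r < k, s'.reg r = s.reg r := by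
  induction e with
  | const q =>
    intro d ρ k s hwf hd hk h
    refine ⟨1, _, .instr _ _, by simp [size, depth], by simp [Instr.exec, eval], h.setReg hk _,
      fun r hr => ?_⟩
    simp [Instr.exec, Function.update_of_ne hr.ne]
  | reg r =>
    intro d ρ k s hwf hd hk h
    have hr : r < 100 := by simpa [wf] using hwf
    refine ⟨1 + 1, _, .seq (.instr _ _) (.instr _ _), by simp [size, depth], ?_,
      (h.setReg hk _).setReg hk _, fun r hr => ?_⟩
    · have : r ≠ k := by omega
      simp [Instr.exec, eval, Op.eval, Function.update_of_ne this, h.reg r hr]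
    · simp [Instr.exec, Function.update_of_ne hr.ne]
  | arr a x y =>
    intro d ρ k s hwf hd hk h
    simp only [wf, Bool.and_eq_true, decide_eq_true_eq] at hwf
    refine ⟨1, _, .instr _ _, by simp [size, depth], ?_, h.setReg hk _, fun r hr => ?_⟩
    · simp [Instr.exec, eval, h.idx x hwf.1, h.idx y hwf.2, h.arr]
    · simp [Instr.exec, Function.update_of_ne hr.ne]
  | op o e f ihe ihf =>
    intro d ρ k s hwf hd hk h
    simp only [wf, Bool.and_eq_true] at hwf
    obtain ⟨t₁, s₁, he₁, ht₁, hv₁, h₁, hr₁⟩ := ihe d ρ k s hwf.1 hd hk h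
    obtain ⟨t₂, s₂, he₂, ht₂, hv₂, h₂, hr₂⟩ := ihf d ρ (k + 1) s₁ hwf.2 hd (by omega) h₁
    refine ⟨_, _, .seq he₁ (.seq he₂ (.instr _ _)), ?_, ?_, h₂.setReg hk _, fun r hr => ?_⟩
    · have b₁ := ht₁.trans (mul_pow_le_mul_pow (le_max_left e.depth f.depth))
      have b₂ := ht₂.trans (mul_pow_le_mul_pow (le_max_right e.depth f.depth))
      have b₃ : 1 ≤ (ρ 0 + 1) ^ max e.depth f.depth := Nat.one_le_pow _ _ (Nat.succ_pos _)
      simp only [size, depth, add_mul]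
      omega
    · simp [Instr.exec, eval, hv₂, hr₂ k (by omega), hv₁]
    · simp [Instr.exec, Function.update_of_ne hr.ne, hr₂ r (by omega), hr₁ r hr]
  | sqrt e ih =>
    intro d ρ k s hwf hd hk h
    obtain ⟨t₁, s₁, he₁, ht₁, hv₁, h₁, hr₁⟩ := ih d ρ k s hwf hd hk h
    refine ⟨_, _, .seq he₁ (.instr _ _), ?_, ?_, h₁.setReg hk _, fun r hr => ?_⟩
    · have b₃ : 1 ≤ (ρ 0 + 1) ^ e.depth := Nat.one_le_pow _ _ (Nat.succ_pos _)
      simp only [size, depth, add_mul]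
      omega
    · simp [Instr.exec, eval, hv₁]
    · simp [Instr.exec, Function.update_of_ne hr.ne, hr₁ r hr]
  | lt x y =>
    intro d ρ k s hwf hd hk h
    simp only [wf, Bool.and_eq_true, decide_eq_true_eq] at hwf
    by_cases hxy : ρ x < ρ y
    · refine ⟨_, _, .ite_true ?_ (.instr _ _), by simp [size, depth], ?_, h.setReg hk _,
        fun r hr => ?_⟩
      · simpa [Test.holds, h.idx x hwf.1, h.idx y hwf.2] using hxy
      · simp [Instr.exec, eval, hxy]
      · simp [Instr.exec, Function.update_of_ne hr.ne]
    · refine ⟨_, _, .ite_false ?_ (.instr _ _), by simp [size, depth], ?_, h.setReg hk _,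
        fun r hr => ?_⟩
      · simpa [Test.holds, h.idx x hwf.1, h.idx y hwf.2] using hxy
      · simp [Instr.exec, eval, hxy]
      · simp [Instr.exec, Function.update_of_ne hr.ne]
  | ite e f g g' ihe ihf ihg ihg' =>
    intro d ρ k s hwf hd hk h
    simp only [wf, Bool.and_eq_true] at hwf
    obtain ⟨⟨⟨hwe, hwf'⟩, hwg⟩, hwg'⟩ := hwf
    obtain ⟨t₁, s₁, he₁, ht₁, hv₁, h₁, hr₁⟩ := ihe d ρ k s hwe hd hk h
    obtain ⟨t₂, s₂, he₂, ht₂, hv₂, h₂, hr₂⟩ := ihf d ρ (k + 1) s₁ hwf' hd (by omega) h₁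
    have htest : (Test.rlt k (k + 1)).holds s₂ ↔ e.eval M d ρ < f.eval M d ρ := by
      rw [Test.holds, hv₂, hr₂ k (by omega), hv₁]
    set D := max (max e.depth f.depth) (max g.depth g'.depth) with hD
    have b₁ := ht₁.trans (mul_pow_le_mul_pow (show e.depth ≤ D by omega))
    have b₂ := ht₂.trans (mul_pow_le_mul_pow (show f.depth ≤ D by omega))
    have b₃ : 1 ≤ (ρ 0 + 1) ^ D := Nat.one_le_pow _ _ (Nat.succ_pos _)
    by_cases hc : e.eval M d ρ < f.eval M d ρ
    · obtain ⟨t₃, s₃, he₃, ht₃, hv₃, h₃, hr₃⟩ := ihg d ρ k s₂ hwg hd hk h₂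
      refine ⟨_, _, .seq he₁ (.seq he₂ (.ite_true (htest.2 hc) he₃)), ?_, ?_, h₃,
        fun r hr => ?_⟩
      · have b₄ := ht₃.trans (mul_pow_le_mul_pow (show g.depth ≤ D by omega))
        simp only [size, depth, add_mul, ← hD]
        omega
      · simp [eval, hc, hv₃]
      · rw [hr₃ r hr, hr₂ r (by omega), hr₁ r hr]
    · obtain ⟨t₃, s₃, he₃, ht₃, hv₃, h₃, hr₃⟩ := ihg' d ρ k s₂ hwg' hd hk h₂
      refine ⟨_, _, .seq he₁ (.seq he₂ (.ite_false (fun h => hc (htest.1 h)) he₃)), ?_, ?_, h₃,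
        fun r hr => ?_⟩
      · have b₄ := ht₃.trans (mul_pow_le_mul_pow (show g'.depth ≤ D by omega))
        simp only [size, depth, add_mul, ← hD]
        omega
      · simp [eval, hc, hv₃]
      · rw [hr₃ r hr, hr₂ r (by omega), hr₁ r hr]
  | sum e ih =>
    intro d ρ k s hwf hd hk h
    have h0 := (h.setReg hk (0 : ℝ)).setIdx 0
    obtain ⟨t, s', he, ht, ⟨hI, hv, hr⟩⟩ := exec_while (x := d) (b := 0)
      (p := .seq (e.comp (k + 1) (d + 1)) (.seq (.instr (.op .add k k (k + 1))) (.instr (.succ d))))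
      (N := ρ 0) (T := e.size * (ρ 0 + 1) ^ e.depth + 2)
      (I := fun j s' => Holds (d + 1) (Function.update ρ d j) M s' ∧
        s'.reg k = ∑ i ∈ Finset.range j, e.eval M (d + 1) (Function.update ρ d i) ∧
        ∀ r < k, s'.reg r = s.reg r)
      (fun j s' h => by rw [h.1.idx d (by omega)]; simp)
      (fun j s' h => by rw [h.1.idx 0 (by omega), Function.update_of_ne hd.ne])
      (fun j hj s' ⟨h1, h2, h3⟩ => by
        obtain ⟨t₁, s₁, he₁, ht₁, hv₁, h₁, hr₁⟩ :=
          ih (d + 1) _ (k + 1) s' hwf (by omega) (by omega) h1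
        rw [Function.update_of_ne hd.ne] at ht₁
        refine ⟨_, _, .seq he₁ (.seq (.instr _ _) (.instr _ _)), by omega, ?_, ?_, ?_⟩
        · have h5 : s₁.idx d = j := by rw [h₁.idx d (by omega)]; simp
          have := (h₁.weaken.setReg hk (s₁.reg k + s₁.reg (k + 1))).setIdx (j + 1)
          simpa [Instr.exec, Op.eval, h5] using this
        · simp [Instr.exec, Op.eval, Finset.sum_range_succ, hr₁ k (by omega), h2, hv₁]
        · intro r hr
          simp [Instr.exec, Function.update_of_ne hr.ne, hr₁ r (by omega), h3 r hr])
      { s with reg := Function.update s.reg k 0, idx := Function.update s.idx d 0 }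
      ⟨h0, by simp, fun r hr => by simp [Function.update_of_ne hr.ne]⟩
    refine ⟨1 + (1 + t), s', .seq (.instr _ _) (.seq (.instr _ _) ?_), ?_, hv, hI.weaken, hr⟩
    · simpa [Instr.exec] using he
    · simp only [size, depth]
      have b₃ : 1 ≤ (ρ 0 + 1) ^ e.depth := Nat.one_le_pow _ _ (Nat.succ_pos _)
      rw [pow_succ]
      set X := (ρ 0 + 1) ^ e.depth
      have : (e.size + 6) * (X * (ρ 0 + 1)) =
          e.size * X * ρ 0 + e.size * X + 6 * X * ρ 0 + 6 * X := by
        ring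
      rw [this]
      have h7 : ρ 0 ≤ X * ρ 0 := Nat.le_mul_of_pos_left _ b₃
      have h8 : ρ 0 * (e.size * X + 2 + 1) = e.size * X * ρ 0 + 3 * ρ 0 := by ring
      rw [h8] at ht
      have h9 : 6 * X * ρ 0 = 6 * (X * ρ 0) := by ring
      rw [h9]
      omega

/-- Commands; `loop false` runs over the vertices, and `loop true` runs over the numbers below the
content of index register `3`. -/
inductive Cmd
  | asg (r : ℕ) (e : RExp)
  | sto (a x y : ℕ) (e : RExp)
  | out (x : ℕ) (e : RExp)
  | seq (p q : Cmd)
  | ite (e f : RExp) (p q : Cmd)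
  | skip
  | loop (b : Bool) (p : Cmd)

/-- Iteration of a function that depends on the number of the iteration. -/
def iter {α : Type} (f : ℕ → α → α) : ℕ → α → α
  | 0, m => m
  | k + 1, m => f k (iter f k m)

/-- The index register with the length of a loop. -/
def loopBound (b : Bool) : ℕ := cond b 3 0

namespace Cmd

/-- The effect of a command. -/
noncomputable def run : Cmd → ℕ → (ℕ → ℕ) → Mem → Mem
  | asg r e, d, ρ, M => { M with reg := Function.update M.reg r (e.eval M d ρ) }
  | sto a x y e, d, ρ, M => { M with arr := write M.arr a (ρ x) (ρ y) (e.eval M d ρ) }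
  | out x e, d, ρ, M =>
    { M with out := write M.out 0 (ρ x) 0 (open Classical in if 0 < e.eval M d ρ then 1 else 0) }
  | seq p q, d, ρ, M => q.run d ρ (p.run d ρ M)
  | ite e f p q, d, ρ, M =>
    open Classical in if e.eval M d ρ < f.eval M d ρ then p.run d ρ M else q.run d ρ M
  | skip, _, _, M => M
  | loop b p, d, ρ, M => iter (fun k => p.run (d + 1) (Function.update ρ d k)) (ρ (loopBound b)) M

/-- Well-formedness at nesting depth `d`. -/
def wf : Cmd → ℕ → Bool
  | asg r e, d => decide (r < 100) && e.wf d
  | sto _ x y e, d => decide (x < d) && decide (y < d) && e.wf d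
  | out x e, d => decide (x < d) && e.wf d
  | seq p q, d => p.wf d && q.wf d
  | ite e f p q, d => e.wf d && f.wf d && p.wf d && q.wf d
  | skip, _ => true
  | loop _ p, d => p.wf (d + 1)

/-- Translation. -/
def comp : Cmd → ℕ → Prog
  | asg r e, d =>
    .seq (e.comp 100 d) (.seq (.instr (.const 101 0)) (.instr (.op .add r 100 101)))
  | sto a x y e, d => .seq (e.comp 100 d) (.instr (.store a x y 100))
  | out x e, d =>
    .seq (e.comp 100 d) (.seq (.instr (.const 101 0))
      (.ite (.rlt 101 100) (.instr (.istore 0 x 1 2)) (.instr (.istore 0 x 1 1))))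
  | seq p q, d => .seq (p.comp d) (q.comp d)
  | ite e f p q, d =>
    .seq (e.comp 100 d) (.seq (f.comp 101 d) (.ite (.rlt 100 101) (p.comp d) (q.comp d)))
  | skip, _ => .skip
  | loop b p, d =>
    .seq (.instr (.zero d)) (.while (.ilt d (loopBound b))
      (.seq (p.comp (d + 1)) (.instr (.succ d))))

/-- The coefficient of the time bound. -/
def size : Cmd → ℕ
  | asg _ e => e.size + 2
  | sto _ _ _ e => e.size + 1
  | out _ e => e.size + 3
  | seq p q => p.size + q.size
  | ite e f p q => e.size + f.size + p.size + q.size + 1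
  | skip => 0
  | loop _ p => p.size + 4

/-- The exponent of the number of vertices in the time bound. -/
def depth : Cmd → ℕ
  | asg _ e => e.depth
  | sto _ _ _ e => e.depth
  | out _ e => e.depth
  | seq p q => max p.depth q.depth
  | ite e f p q => max (max e.depth f.depth) (max p.depth q.depth)
  | skip => 0
  | loop b p => cond b p.depth (p.depth + 1)

/-- The exponent of the other loop length in the time bound. -/
def depth' : Cmd → ℕ
  | asg _ _ => 0
  | sto _ _ _ _ => 0
  | out _ _ => 0
  | seq p q => max p.depth' q.depth'
  | ite _ _ p q => max p.depth' q.depth'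
  | skip => 0
  | loop b p => cond b (p.depth' + 1) p.depth'

end Cmd

theorem mul_pow_mul_pow_le {s A B a a' b b' : ℕ} (h : a ≤ a') (h' : b ≤ b') :
    s * (A + 1) ^ a * (B + 1) ^ b ≤ s * (A + 1) ^ a' * (B + 1) ^ b' :=
  Nat.mul_le_mul (mul_pow_le_mul_pow h) (Nat.pow_le_pow_right (Nat.succ_pos B) h')

theorem mul_pow_le_mul_pow_mul_pow {s A B a a' b : ℕ} (h : a ≤ a') :
    s * (A + 1) ^ a ≤ s * (A + 1) ^ a' * (B + 1) ^ b :=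
  (mul_pow_le_mul_pow h).trans (Nat.le_mul_of_pos_right _ (Nat.pow_pos (Nat.succ_pos B)))

/-- Each loop raises one of the two exponents by one. The additive constant in `size` pays for the
counter and the tests, also of empty loops. The values of `ρ 1` and `ρ 2` matter only for writing
the output bits. -/
theorem Cmd.exec_comp (p : Cmd) : ∀ (d : ℕ) (ρ : ℕ → ℕ) (M : Mem) (s : State),
    p.wf d = true → 4 ≤ d → ρ 1 = 0 → ρ 2 = 1 → Holds d ρ M s →
    ∃ t s', Exec (p.comp d) s t s' ∧
      t ≤ p.size * (ρ 0 + 1) ^ p.depth * (ρ 3 + 1) ^ p.depth' ∧ Holds d ρ (p.run d ρ M) s' := by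
  induction p with
  | asg r e =>
    intro d ρ M s hwf hd hρ1 hρ2 h
    simp only [wf, Bool.and_eq_true, decide_eq_true_eq] at hwf
    obtain ⟨t₁, s₁, he₁, ht₁, hv₁, h₁, hr₁⟩ :=
      e.exec_comp M d ρ 100 s hwf.2 (by omega) le_rfl h
    refine ⟨_, _, .seq he₁ (.seq (.instr _ _) (.instr _ _)), ?_, h₁.idx, fun r' hr' => ?_, h₁.arr,
      h₁.out⟩
    · have b₃ : 1 ≤ (ρ 0 + 1) ^ e.depth := Nat.one_le_pow _ _ (Nat.succ_pos _)
      simp only [size, depth, depth', pow_zero, mul_one, add_mul]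
      omega
    · rcases eq_or_ne r' r with rfl | hne
      · simp [Instr.exec, run, Op.eval, hv₁]
      · have : r' ≠ 101 := by omega
        simp [Instr.exec, run, Function.update_of_ne hne, Function.update_of_ne this,
          h₁.reg r' hr']
  | sto a x y e =>
    intro d ρ M s hwf hd hρ1 hρ2 h
    simp only [wf, Bool.and_eq_true, decide_eq_true_eq] at hwf
    obtain ⟨t₁, s₁, he₁, ht₁, hv₁, h₁, hr₁⟩ :=
      e.exec_comp M d ρ 100 s hwf.2 (by omega) le_rfl h
    refine ⟨_, _, .seq he₁ (.instr _ _), ?_, h₁.idx, h₁.reg, ?_, h₁.out⟩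
    · have b₃ : 1 ≤ (ρ 0 + 1) ^ e.depth := Nat.one_le_pow _ _ (Nat.succ_pos _)
      simp only [size, depth, depth', pow_zero, mul_one, add_mul]
      omega
    · simp [Instr.exec, run, hv₁, h₁.idx x hwf.1.1, h₁.idx y hwf.1.2, h₁.arr]
  | out x e =>
    intro d ρ M s hwf hd hρ1 hρ2 h
    simp only [wf, Bool.and_eq_true, decide_eq_true_eq] at hwf
    obtain ⟨t₁, s₁, he₁, ht₁, hv₁, h₁, hr₁⟩ :=
      e.exec_comp M d ρ 100 s hwf.2 (by omega) le_rfl h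
    have h₂ := h₁.setReg (k := 101) (by omega) 0
    have b₃ : 1 ≤ (ρ 0 + 1) ^ e.depth := Nat.one_le_pow _ _ (Nat.succ_pos _)
    have hi : ∀ x < d, s₁.idx x = ρ x := h₁.idx
    by_cases hc : 0 < e.eval M d ρ
    · refine ⟨_, _, .seq he₁ (.seq (.instr _ _) (.ite_true ?_ (.instr _ _))), ?_, h₂.idx,
        fun r hr => by simpa [Instr.exec, run] using h₂.reg r hr, h₂.arr, ?_⟩
      · simpa [Test.holds, Instr.exec, hv₁] using hc
      · simp only [size, depth, depth', pow_zero, mul_one, add_mul]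
        omega
      · simp [Instr.exec, run, hc, hi x hwf.1, hi 1 (by omega), hi 2 (by omega), hρ1, hρ2, h₁.out]
    · refine ⟨_, _, .seq he₁ (.seq (.instr _ _) (.ite_false ?_ (.instr _ _))), ?_, h₂.idx,
        fun r hr => by simpa [Instr.exec, run] using h₂.reg r hr, h₂.arr, ?_⟩
      · simpa [Test.holds, Instr.exec, hv₁] using hc
      · simp only [size, depth, depth', pow_zero, mul_one, add_mul]
        omega
      · simp [Instr.exec, run, hc, hi x hwf.1, hi 1 (by omega), hρ1, h₁.out]
  | seq p q ihp ihq =>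
    intro d ρ M s hwf hd hρ1 hρ2 h
    simp only [wf, Bool.and_eq_true] at hwf
    obtain ⟨t₁, s₁, he₁, ht₁, h₁⟩ := ihp d ρ M s hwf.1 hd hρ1 hρ2 h
    obtain ⟨t₂, s₂, he₂, ht₂, h₂⟩ := ihq d ρ _ s₁ hwf.2 hd hρ1 hρ2 h₁
    refine ⟨_, _, .seq he₁ he₂, ?_, h₂⟩
    simp only [size, depth, depth', add_mul]
    exact Nat.add_le_add (ht₁.trans (mul_pow_mul_pow_le (le_max_left _ _) (le_max_left _ _)))
      (ht₂.trans (mul_pow_mul_pow_le (le_max_right _ _) (le_max_right _ _)))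
  | ite e f p q ihp ihq =>
    intro d ρ M s hwf hd hρ1 hρ2 h
    simp only [wf, Bool.and_eq_true] at hwf
    obtain ⟨⟨⟨hwe, hwf'⟩, hwp⟩, hwq⟩ := hwf
    obtain ⟨t₁, s₁, he₁, ht₁, hv₁, h₁, hr₁⟩ := e.exec_comp M d ρ 100 s hwe (by omega) le_rfl h
    obtain ⟨t₂, s₂, he₂, ht₂, hv₂, h₂, hr₂⟩ :=
      f.exec_comp M d ρ 101 s₁ hwf' (by omega) (by omega) h₁
    have htest : (Test.rlt 100 101).holds s₂ ↔ e.eval M d ρ < f.eval M d ρ := by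
      rw [Test.holds, hv₂, hr₂ 100 (by omega), hv₁]
    set D := max (max e.depth f.depth) (max p.depth q.depth) with hD
    set D' := max p.depth' q.depth' with hD'
    have b₁ := ht₁.trans (mul_pow_le_mul_pow_mul_pow (B := ρ 3) (b := D')
      (show e.depth ≤ D by omega))
    have b₂ := ht₂.trans (mul_pow_le_mul_pow_mul_pow (B := ρ 3) (b := D')
      (show f.depth ≤ D by omega))
    have b₃ : 1 ≤ (ρ 0 + 1) ^ D * (ρ 3 + 1) ^ D' :=
      Nat.mul_pos (Nat.pow_pos (Nat.succ_pos _)) (Nat.pow_pos (Nat.succ_pos _))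
    by_cases hc : e.eval M d ρ < f.eval M d ρ
    · obtain ⟨t₃, s₃, he₃, ht₃, h₃⟩ := ihp d ρ M s₂ hwp hd hρ1 hρ2 h₂
      refine ⟨_, _, .seq he₁ (.seq he₂ (.ite_true (htest.2 hc) he₃)), ?_, ?_⟩
      · have b₄ := ht₃.trans (mul_pow_mul_pow_le (show p.depth ≤ D by omega)
          (show p.depth' ≤ D' by omega))
        simp only [size, depth, depth', add_mul, ← hD, ← hD', one_mul]
        omega
      · simpa only [run, hc, if_true] using h₃
    · obtain ⟨t₃, s₃, he₃, ht₃, h₃⟩ := ihq d ρ M s₂ hwq hd hρ1 hρ2 h₂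
      refine ⟨_, _, .seq he₁ (.seq he₂ (.ite_false (fun h => hc (htest.1 h)) he₃)), ?_, ?_⟩
      · have b₄ := ht₃.trans (mul_pow_mul_pow_le (show q.depth ≤ D by omega)
          (show q.depth' ≤ D' by omega))
        simp only [size, depth, depth', add_mul, ← hD, ← hD', one_mul]
        omega
      · simpa only [run, hc, if_false] using h₃
  | skip =>
    intro d ρ M s hwf hd hρ1 hρ2 h
    exact ⟨0, s, .skip s, Nat.zero_le _, h⟩
  | loop b p ih =>
    intro d ρ M s hwf hd hρ1 hρ2 h
    have hb : loopBound b < d := by cases b <;> simp [loopBound] <;> omega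
    obtain ⟨t, s', he, ht, hI⟩ := exec_while (x := d) (b := loopBound b)
      (p := .seq (p.comp (d + 1)) (.instr (.succ d))) (N := ρ (loopBound b))
      (T := p.size * (ρ 0 + 1) ^ p.depth * (ρ 3 + 1) ^ p.depth' + 1)
      (I := fun j s' => Holds (d + 1) (Function.update ρ d j)
        (iter (fun k => p.run (d + 1) (Function.update ρ d k)) j M) s')
      (fun j s' h => by rw [h.idx d (by omega)]; simp)
      (fun j s' h => by rw [h.idx _ (by omega), Function.update_of_ne hb.ne])
      (fun j hj s' h1 => by
        obtain ⟨t₁, s₁, he₁, ht₁, h₁⟩ := ih (d + 1) _ _ s' hwf (by omega)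
          (by rw [Function.update_of_ne (by omega), hρ1])
          (by rw [Function.update_of_ne (by omega), hρ2]) h1
        rw [Function.update_of_ne (by omega), Function.update_of_ne (by omega)] at ht₁
        refine ⟨_, _, .seq he₁ (.instr _ _), by omega, ?_⟩
        have h5 : s₁.idx d = j := by rw [h₁.idx d (by omega)]; simp
        have := h₁.weaken.setIdx (j + 1)
        simpa [Instr.exec, h5, iter] using this)
      { s with idx := Function.update s.idx d 0 } (h.setIdx 0)
    refine ⟨1 + t, s', .seq (.instr _ _) ?_, ?_, hI.weaken⟩
    · simpa [Instr.exec] using he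
    · have b₃ : 1 ≤ (ρ 0 + 1) ^ p.depth * (ρ 3 + 1) ^ p.depth' :=
        Nat.mul_pos (Nat.pow_pos (Nat.succ_pos _)) (Nat.pow_pos (Nat.succ_pos _))
      set X := (ρ 0 + 1) ^ p.depth * (ρ 3 + 1) ^ p.depth' with hX
      have e1 : (Cmd.loop b p).size * (ρ 0 + 1) ^ (Cmd.loop b p).depth *
          (ρ 3 + 1) ^ (Cmd.loop b p).depth' = (p.size + 4) * X * (ρ (loopBound b) + 1) := by
        cases b <;>
          simp only [size, depth, depth', loopBound, cond_true, cond_false, pow_succ, hX] <;>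
          ring
      rw [e1]
      rw [mul_assoc p.size, ← hX] at ht
      set N := ρ (loopBound b)
      have e2 : N * (p.size * X + 1 + 1) = p.size * X * N + 2 * N := by ring
      have e3 : (p.size + 4) * X * (N + 1) = p.size * X * N + p.size * X + 4 * (X * N) + 4 * X := by
        ring
      have h7 : N ≤ X * N := Nat.le_mul_of_pos_left _ b₃
      rw [e2] at ht
      rw [e3]
      omega

theorem iter_induction {α : Type} {f : ℕ → α → α} {N : ℕ} {I : ℕ → α → Prop} {m : α} (h0 : I 0 m)
    (hs : ∀ k < N, ∀ m, I k m → I (k + 1) (f k m)) : I N (iter f N m) := by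
  have : ∀ k ≤ N, I k (iter f k m) := by
    intro k
    induction k with
    | zero => exact fun _ => h0
    | succ k ih => exact fun hk => hs k (by omega) _ (ih (by omega))
  exact this N le_rfl

/-! ### Derived expressions, frame conditions and fill loops. -/

namespace RExp

instance : Add RExp := ⟨op .add⟩
instance : Sub RExp := ⟨op .sub⟩
instance : Mul RExp := ⟨op .mul⟩
instance : Div RExp := ⟨op .div⟩

variable (M : Mem) (d : ℕ) (ρ : ℕ → ℕ) (e f : RExp)

@[simp]
theorem eval_add : (e + f).eval M d ρ = e.eval M d ρ + f.eval M d ρ := rfl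
@[simp]
theorem eval_sub : (e - f).eval M d ρ = e.eval M d ρ - f.eval M d ρ := rfl
@[simp]
theorem eval_mul : (e * f).eval M d ρ = e.eval M d ρ * f.eval M d ρ := rfl
@[simp]
theorem eval_div : (e / f).eval M d ρ = e.eval M d ρ / f.eval M d ρ := rfl

theorem eval_sum {n : ℕ} (h : ρ 0 = n) :
    (sum e).eval M d ρ = ∑ i : Fin n, e.eval M (d + 1) (Function.update ρ d i) := by
  rw [eval, h, Finset.sum_range]

/-- The absolute value. -/
def abs : RExp := ite e (const 0) (const 0 - e) e

theorem eval_abs : (abs e).eval M d ρ = |e.eval M d ρ| := by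
  simp only [abs, eval, eval_sub, Rat.cast_zero, zero_sub]
  split_ifs with h
  · rw [abs_of_neg h]
  · rw [abs_of_nonneg (not_lt.1 h)]

/-- `1` if two indices agree, else `0`. -/
def eq (x y : ℕ) : RExp := (const 1 - lt x y) * (const 1 - lt y x)

theorem eval_eq (x y : ℕ) : (eq x y).eval M d ρ = if ρ x = ρ y then 1 else 0 := by
  simp only [eq, eval, eval_sub, eval_mul, Rat.cast_one]
  rcases lt_trichotomy (ρ x) (ρ y) with h | h | h
  · simp [h, h.ne]
  · simp [h]
  · simp [h, h.ne']

end RExp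

namespace Cmd

/-- Whether a command writes the real register `r`. -/
def writesReg (r : ℕ) : Cmd → Bool
  | asg r' _ => decide (r' = r)
  | sto _ _ _ _ => false
  | out _ _ => false
  | seq p q => p.writesReg r || q.writesReg r
  | ite _ _ p q => p.writesReg r || q.writesReg r
  | skip => false
  | loop _ p => p.writesReg r

/-- Whether a command writes the real array `a`. -/
def writesArr (a : ℕ) : Cmd → Bool
  | asg _ _ => false
  | sto a' _ _ _ => decide (a' = a)
  | out _ _ => false
  | seq p q => p.writesArr a || q.writesArr a
  | ite _ _ p q => p.writesArr a || q.writesArr a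
  | skip => false
  | loop _ p => p.writesArr a

/-- Whether a command writes the output. -/
def writesOut : Cmd → Bool
  | asg _ _ => false
  | sto _ _ _ _ => false
  | out _ _ => true
  | seq p q => p.writesOut || q.writesOut
  | ite _ _ p q => p.writesOut || q.writesOut
  | skip => false
  | loop _ p => p.writesOut

/-- A frame condition whose hypothesis is a syntactic check, so that it is discharged by evaluation
for each concrete command. -/
theorem run_reg {r : ℕ} (p : Cmd) (hp : p.writesReg r = false) (d : ℕ) (ρ : ℕ → ℕ) (M : Mem) :
    (p.run d ρ M).reg r = M.reg r := by
  induction p generalizing d ρ M with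
  | asg r' e =>
    simp only [writesReg, decide_eq_false_iff_not] at hp
    exact Function.update_of_ne (Ne.symm hp) _ _
  | sto a x y e => rfl
  | out x e => rfl
  | seq p q ihp ihq =>
    simp only [writesReg, Bool.or_eq_false_iff] at hp
    rw [run, ihq hp.2, ihp hp.1]
  | ite e f p q ihp ihq =>
    simp only [writesReg, Bool.or_eq_false_iff] at hp
    rw [run]
    split_ifs
    · exact ihp hp.1 _ _ _
    · exact ihq hp.2 _ _ _
  | skip => rfl
  | loop b p ih =>
    exact iter_induction (I := fun _ (M' : Mem) => M'.reg r = M.reg r) rfl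
      fun k _ M' h => (ih hp _ _ _).trans h

theorem run_arr {a : ℕ} (p : Cmd) (hp : p.writesArr a = false) (d : ℕ) (ρ : ℕ → ℕ) (M : Mem) :
    (p.run d ρ M).arr a = M.arr a := by
  induction p generalizing d ρ M with
  | asg r' e => rfl
  | sto a' x y e =>
    simp only [writesArr, decide_eq_false_iff_not] at hp
    funext i j
    have : ¬ (a = a' ∧ i = ρ x ∧ j = ρ y) := fun h => hp h.1.symm
    simp [run, write, this]
  | out x e => rfl
  | seq p q ihp ihq =>
    simp only [writesArr, Bool.or_eq_false_iff] at hp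
    rw [run, ihq hp.2, ihp hp.1]
  | ite e f p q ihp ihq =>
    simp only [writesArr, Bool.or_eq_false_iff] at hp
    rw [run]
    split_ifs
    · exact ihp hp.1 _ _ _
    · exact ihq hp.2 _ _ _
  | skip => rfl
  | loop b p ih =>
    exact iter_induction (I := fun _ (M' : Mem) => M'.arr a = M.arr a) rfl
      fun k _ M' h => (ih hp _ _ _).trans h

theorem run_out (p : Cmd) (hp : p.writesOut = false) (d : ℕ) (ρ : ℕ → ℕ) (M : Mem) :
    (p.run d ρ M).out = M.out := by
  induction p generalizing d ρ M with
  | asg r' e => rfl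
  | sto a x y e => rfl
  | out x e => cases hp
  | seq p q ihp ihq =>
    simp only [writesOut, Bool.or_eq_false_iff] at hp
    rw [run, ihq hp.2, ihp hp.1]
  | ite e f p q ihp ihq =>
    simp only [writesOut, Bool.or_eq_false_iff] at hp
    rw [run]
    split_ifs
    · exact ihp hp.1 _ _ _
    · exact ihq hp.2 _ _ _
  | skip => rfl
  | loop b p ih =>
    exact iter_induction (I := fun _ (M' : Mem) => M'.out = M.out) rfl
      fun k _ M' h => (ih hp _ _ _).trans h

/-- Fill the vector `a` with the values of `e`. -/
def fillVec (d a : ℕ) (e : RExp) : Cmd := loop false (sto a d 1 e)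

/-- Fill the matrix `a` with the values of `e`. -/
def fillMat (d a : ℕ) (e : RExp) : Cmd := loop false (loop false (sto a d (d + 1) e))

/-- `k` nested loops of the second kind. -/
def nest : ℕ → Cmd → Cmd
  | 0, p => p
  | k + 1, p => loop true (nest k p)

end Cmd

/-- The contents of the first four index registers. -/
structure Env (n l : ℕ) (ρ : ℕ → ℕ) : Prop where
  zero : ρ 0 = n
  one : ρ 1 = 0
  two : ρ 2 = 1
  three : ρ 3 = l

theorem Env.update {n l : ℕ} {ρ : ℕ → ℕ} (h : Env n l ρ) {d : ℕ} (hd : 4 ≤ d) (k : ℕ) :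
    Env n l (Function.update ρ d k) :=
  ⟨by rw [Function.update_of_ne (by omega), h.zero],
    by rw [Function.update_of_ne (by omega), h.one],
    by rw [Function.update_of_ne (by omega), h.two],
    by rw [Function.update_of_ne (by omega), h.three]⟩

namespace Cmd

theorem run_fillVec {n l : ℕ} {ρ : ℕ → ℕ} (h : Env n l ρ) {d : ℕ} (hd : 4 ≤ d) (a : ℕ) (e : RExp)
    (he : e.avoids a = true) (M : Mem) (i : Fin n) :
    ((fillVec d a e).run d ρ M).arr a i 0 = e.eval M (d + 1) (Function.update ρ d i) := by
  have key := iter_induction (N := n) (m := M)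
    (f := fun k => (sto a d 1 e).run (d + 1) (Function.update ρ d k))
    (I := fun k M' => M'.reg = M.reg ∧ (∀ b, b ≠ a → M'.arr b = M.arr b) ∧
      ∀ i < k, M'.arr a i 0 = e.eval M (d + 1) (Function.update ρ d i))
    ⟨rfl, fun _ _ => rfl, fun i hi => absurd hi (Nat.not_lt_zero i)⟩
    (by
      rintro k - M' ⟨h1, h2, h3⟩
      refine ⟨h1, fun b hb => ?_, fun i hi => ?_⟩
      · rw [run_arr _ (by simpa [writesArr] using Ne.symm hb)]; exact h2 b hb
      · have e1 : Function.update ρ d k 1 = 0 := by rw [Function.update_of_ne (by omega), h.one]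
        simp only [run, write, e1, Function.update_self]
        by_cases hik : i = k
        · subst hik
          simpa using RExp.eval_congr h1 h2 e he _ _
        · simpa [hik] using h3 i (by omega))
  have hb : ρ (loopBound false) = n := h.zero
  rw [fillVec, run, hb]
  exact key.2.2 i i.2

theorem run_fillMat {n l : ℕ} {ρ : ℕ → ℕ} (h : Env n l ρ) {d : ℕ} (hd : 4 ≤ d) (a : ℕ) (e : RExp)
    (he : e.avoids a = true) (M : Mem) (i j : Fin n) :
    ((fillMat d a e).run d ρ M).arr a i j =
      e.eval M (d + 2) (Function.update (Function.update ρ d i) (d + 1) j) := by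
  -- The inner loop fills row `k` and leaves the other rows of the array untouched.
  have inner : ∀ (k : ℕ) (M' : Mem), M'.reg = M.reg → (∀ b, b ≠ a → M'.arr b = M.arr b) →
      let M'' := iter (fun k' => (sto a d (d + 1) e).run (d + 2)
        (Function.update (Function.update ρ d k) (d + 1) k')) n M'
      M''.reg = M.reg ∧ (∀ b, b ≠ a → M''.arr b = M.arr b) ∧
        (∀ i, i ≠ k → M''.arr a i = M'.arr a i) ∧ ∀ j < n, M''.arr a k j =
          e.eval M (d + 2) (Function.update (Function.update ρ d k) (d + 1) j) := by
    intro k M' hreg harr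
    exact iter_induction (N := n) (m := M')
      (f := fun k' => (sto a d (d + 1) e).run (d + 2)
        (Function.update (Function.update ρ d k) (d + 1) k'))
      (I := fun k' M'' => M''.reg = M.reg ∧ (∀ b, b ≠ a → M''.arr b = M.arr b) ∧
        (∀ i, i ≠ k → M''.arr a i = M'.arr a i) ∧ ∀ j < k', M''.arr a k j =
          e.eval M (d + 2) (Function.update (Function.update ρ d k) (d + 1) j))
      ⟨hreg, harr, fun _ _ => rfl, fun i hi => absurd hi (Nat.not_lt_zero i)⟩
      (by
        rintro k' - M'' ⟨h1, h2, h3, h4⟩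
        have e1 : Function.update (Function.update ρ d k) (d + 1) k' d = k := by
          rw [Function.update_of_ne (by omega), Function.update_self]
        refine ⟨h1, fun b hb => ?_, fun i hi => ?_, fun j hj => ?_⟩
        · rw [run_arr _ (by simpa [writesArr] using Ne.symm hb)]; exact h2 b hb
        · funext j
          simp only [run, write, e1, hi, false_and, and_false, if_false, h3 i hi]
        · simp only [run, write, e1, Function.update_self]
          by_cases hjk : j = k'
          · subst hjk
            simpa using RExp.eval_congr h1 h2 e he _ _
          · simpa [hjk] using h4 j (by omega))
  have key := iter_induction (N := n) (m := M)
    (f := fun k => (loop false (sto a d (d + 1) e)).run (d + 1) (Function.update ρ d k))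
    (I := fun k M' => M'.reg = M.reg ∧ (∀ b, b ≠ a → M'.arr b = M.arr b) ∧
      ∀ i < k, ∀ j < n, M'.arr a i j =
        e.eval M (d + 2) (Function.update (Function.update ρ d i) (d + 1) j))
    ⟨rfl, fun _ _ => rfl, fun i hi => absurd hi (Nat.not_lt_zero i)⟩
    (by
      rintro k - M' ⟨h1, h2, h3⟩
      have hin := inner k M' h1 h2
      have hb : Function.update ρ d k (loopBound false) = n := by
        rw [loopBound, cond_false, Function.update_of_ne (by omega), h.zero]
      rw [run, hb]
      refine ⟨hin.1, hin.2.1, fun i hi j hj => ?_⟩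
      by_cases hik : i = k
      · subst hik
        exact hin.2.2.2 j hj
      · rw [hin.2.2.1 i hik]
        exact h3 i (by omega) j hj)
  have hb : ρ (loopBound false) = n := h.zero
  rw [fillMat, run, hb]
  exact key.2.2 i i.2 j j.2

/-- Nested loops repeat their body. -/
theorem run_nest {n l : ℕ} {p : Cmd} {I : ℕ → Mem → Prop} (k : ℕ) :
    ∀ {d : ℕ} {ρ : ℕ → ℕ}, 4 ≤ d → Env n l ρ →
      (∀ ρ', Env n l ρ' → ∀ t M, I t M → I (t + 1) (p.run (d + k) ρ' M)) →
      ∀ t M, I t M → I (t + l ^ k) ((nest k p).run d ρ M) := by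
  induction k with
  | zero =>
    intro d ρ hd hρ hp t M hM
    exact hp ρ hρ t M hM
  | succ k ih =>
    intro d ρ hd hρ hp t M hM
    have := iter_induction (N := l) (m := M)
      (f := fun j => (nest k p).run (d + 1) (Function.update ρ d j))
      (I := fun j M' => I (t + j * l ^ k) M') (by simpa using hM)
      (by
        intro j _ M' hM'
        have := ih (d := d + 1) (by omega) (hρ.update hd j)
          (fun ρ' hρ' t M hM => by
            have := hp ρ' hρ' t M hM
            rwa [show d + 1 + k = d + (k + 1) by omega]) _ M' hM'
        rwa [add_assoc, ← Nat.succ_mul] at this)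
    rw [pow_succ, mul_comm]
    simp only [nest, run, loopBound, cond_true, hρ.three]
    exact this

end Cmd

end RealRAM

/-! ## The program -/

namespace RealRAM

open RExp Cmd CutGain

/-- Degrees, inverse square roots of degrees, and parameters. -/
def setup : Cmd :=
  -- Real registers: 0 volume, 1 best value so far, 2 loop length `l`, 3 guess `a`, 4 exponent `m`,
  -- 5 threshold for `m`, 6 trace, 7 sign slope, 8 candidate value, 9 number of vertices. Arrays: 0
  -- adjacency, 1 degrees, 2 their inverse roots, 3 damping `q`, 4 matrix power, 6 relaxation
  -- vectors, 7 partial sums `g`, 9 vector to be rounded; 5 and 8 are scratch.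
  .seq (fillVec 4 1 (sum (RExp.abs (arr 0 4 5)))) <|
  .seq (asg 0 (sum (arr 1 4 1))) <|
  .seq (fillVec 4 2 (const 1 / sqrt (arr 1 4 1))) <|
  -- No cut has value below `-vol`, so this is a valid bound for whatever output is present
  -- initially.
  .seq (asg 1 (const 0 - reg 0)) <|
  .seq (asg 9 (sum (const 1))) <|
  .seq (asg 2 (const 0)) <|
  .seq (loop true (asg 2 (reg 2 + const 1)))
  (asg 3 (const 0))

/-- Greedy rounding of the vector in array `9`. -/
def greedy (d : ℕ) : Cmd :=
  loop false (sto 9 d 1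
    (ite (const 0) (sum (arr 0 d (d + 1) * arr 9 (d + 1) 1)) (const (-1)) (const 1)))

/-- Replace the output by the cut in array `9` if that is better. -/
def keepBest (d : ℕ) : Cmd :=
  .seq (asg 8 (sum (sum ((const 0 - arr 0 d (d + 1)) * (arr 9 d 1 * arr 9 (d + 1) 1)))))
  (.ite (reg 1) (reg 8) (.seq (asg 1 (reg 8)) (loop false (out d (arr 9 d 1)))) skip)

/-- Rounding of the vector in array `9`. -/
def round (d : ℕ) : Cmd := .seq (greedy d) (keepBest d)

/-- The cuts that are good enough for very small optima. -/
def stars : Cmd :=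
  loop false (.seq
    (fillVec 5 9 (RExp.eq 4 5 + (const 0 - arr 0 4 5) / (arr 1 4 1 * reg 9 * reg 9)))
    (round 5))

/-- The damped normalized matrix. -/
def buildMat (d : ℕ) : Cmd :=
  fillMat d 4 (arr 3 d 1 * arr 3 (d + 1) 1 *
    (RExp.eq d (d + 1) + (const 0 - arr 0 d (d + 1)) * (arr 2 d 1 * arr 2 (d + 1) 1)))

/-- Squaring of the matrix in array `4`. -/
def square (d : ℕ) : Cmd :=
  .seq (fillMat d 5 (sum (arr 4 d (d + 2) * arr 4 (d + 2) (d + 1)))) <|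
  .seq (fillMat d 4 (arr 5 d (d + 1)))
  (asg 4 (reg 4 + reg 4))

/-- Half of a large power of the matrix in array `4`, and the trace of the power. -/
def power (d : ℕ) : Cmd :=
  -- Register 4 holds twice the exponent reached in array 4: only the half power is formed.
  .seq (asg 4 (const 2)) <|
  .seq (loop true (.ite (reg 4) (reg 5) (square (d + 1)) skip))
  (asg 6 (sum (sum (arr 4 d (d + 1) * arr 4 d (d + 1)))))

/-- Case distinction on whether the vertex in index register `d` is heavy; `d'` is the depth. -/
def ifHeavy (d d' : ℕ) (e f : RExp) : RExp :=
  RExp.ite (const 40 * reg 3 * arr 1 d 1 * reg 6) (reg 0 * sum (arr 4 d d' * arr 4 d d')) e f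

/-- The vectors of the solution of the relaxation, and the damping. -/
def relax (d : ℕ) : Cmd :=
  .seq (fillMat d 6 (ifHeavy d (d + 2) (const 0)
    (arr 3 d 1 * arr 2 d 1 * arr 4 d (d + 1) * (sqrt (reg 0) / sqrt (reg 6))))) <|
  -- Staged through array 8, because the expression reads the array 3 that it is meant to replace.
  .seq (fillVec d 8 (ifHeavy d (d + 1) (arr 3 d 1 * (const 1 - const 1 / reg 4)) (arr 3 d 1)))
  (fillVec d 3 (arr 8 d 1))

/-- The dependence of the potential on the sign of column `d`. -/
def signExp (d : ℕ) : RExp :=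
  sum (sum ((const 0 - arr 0 (d + 1) (d + 2)) * (arr 7 (d + 1) 1 * arr 6 (d + 2) d))) -
    const 1 / (const 2048 * reg 3 * reg 3) * sum (arr 1 (d + 1) 1 *
      (const 2 * (arr 7 (d + 1) 1 * arr 7 (d + 1) 1 * arr 7 (d + 1) 1) * arr 6 (d + 1) d +
        const 2 * arr 7 (d + 1) 1 * (arr 6 (d + 1) d * arr 6 (d + 1) d * arr 6 (d + 1) d) +
        const 6 * arr 7 (d + 1) 1 * arr 6 (d + 1) d *
          sum (lt d (d + 2) * (arr 6 (d + 1) (d + 2) * arr 6 (d + 1) (d + 2)))))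

/-- Choice of the signs of the columns. -/
def signs (d : ℕ) : Cmd :=
  .seq (fillVec d 7 (const 0))
  (loop false <|
    .seq (asg 7 (signExp d)) <|
    .seq (fillVec (d + 1) 8 (arr 7 (d + 1) 1 +
      RExp.ite (reg 7) (const 0) (const (-1)) (const 1) * arr 6 (d + 1) d))
    (fillVec (d + 1) 7 (arr 8 (d + 1) 1)))

/-- Truncation. -/
def truncate (d : ℕ) : Cmd :=
  fillVec d 9 (RExp.ite (const 64 * reg 3) (arr 7 d 1) (const 1)
    (RExp.ite (arr 7 d 1) (const 0 - const 64 * reg 3) (const (-1))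
      (arr 7 d 1 / (const 64 * reg 3))))

/-- A phase. -/
def phase (d : ℕ) : Cmd :=
  .seq (buildMat d) <| .seq (power d) <| .seq (relax d) <| .seq (signs d) <|
  .seq (truncate d) (round d)

/-- The phases for the next guess of the optimum. -/
def guess : Cmd :=
  .seq (asg 3 (reg 3 + const 1)) <|
  .seq (asg 5 (const 5 * reg 3 * reg 2)) <|
  .seq (fillVec 5 3 (const 1))
  -- This makes `l⁹` phases, more than the potential argument allows to fail; depth 14 is 5 plus the
  -- nine loops.
  (nest 9 (phase 14))

/-- The loop program. -/
def mainCmd : Cmd := .seq setup (.seq stars (loop true guess))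

theorem mainCmd_wf : mainCmd.wf 4 = true := by decide

theorem mainCmd_depth : mainCmd.depth = 3 := by decide

/-- One loop over the guesses, nine nested loops over the phases, and one loop over the squarings.
-/
theorem mainCmd_depth' : mainCmd.depth' = 11 := by decide

/-! ### Specifications -/

section Specs

variable {n l : ℕ} {ρ : ℕ → ℕ} {d : ℕ} {M : Mem} {B : Matrix (Fin n) (Fin n) ℝ}

/-- The vector in array `a`. -/
def Mem.vec (M : Mem) (n a : ℕ) : Fin n → ℝ := fun i => M.arr a i 0

/-- The matrix in array `a`. -/
def Mem.mat (M : Mem) (n a : ℕ) : Matrix (Fin n) (Fin n) ℝ := of fun i j => M.arr a i j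

/-- The memory after `setup`. -/
structure Base (l : ℕ) (B : Matrix (Fin n) (Fin n) ℝ) (M : Mem) : Prop where
  adj : ∀ i j : Fin n, M.arr 0 i j = -B i j
  deg : ∀ i : Fin n, M.arr 1 i 0 = wdeg B i
  isq : ∀ i : Fin n, M.arr 2 i 0 = isqDeg B i
  vol : M.reg 0 = vol B
  len : M.reg 2 = l
  card : M.reg 9 = n

/-- Whether a command preserves `Base`. -/
def keepsBase (p : Cmd) : Bool :=
  !(p.writesArr 0 || p.writesArr 1 || p.writesArr 2 || p.writesReg 0 || p.writesReg 2 ||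
    p.writesReg 9)

theorem Base.run (h : Base l B M) {p : Cmd} (hp : keepsBase p = true) :
    Base l B (p.run d ρ M) := by
  simp only [keepsBase, Bool.not_eq_true', Bool.or_eq_false_iff] at hp
  obtain ⟨⟨⟨⟨⟨h0, h1⟩, h2⟩, h3⟩, h4⟩, h5⟩ := hp
  refine ⟨?_, ?_, ?_, ?_, ?_, ?_⟩
  · rw [run_arr p h0]; exact h.adj
  · rw [run_arr p h1]; exact h.deg
  · rw [run_arr p h2]; exact h.isq
  · rw [run_reg p h3]; exact h.vol
  · rw [run_reg p h4]; exact h.len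
  · rw [run_reg p h5]; exact h.card

theorem setup_spec (hρ : Env n l ρ) (hadj : ∀ i j : Fin n, M.arr 0 i j = -B i j) :
    Base l B (setup.run 4 ρ M) ∧ (setup.run 4 ρ M).reg 1 = -vol B ∧
      (setup.run 4 ρ M).reg 3 = 0 ∧ (setup.run 4 ρ M).out = M.out := by
  set M₁ := (fillVec 4 1 (sum (RExp.abs (arr 0 4 5)))).run 4 ρ M with hM₁
  have d1 : ∀ i : Fin n, M₁.arr 1 i 0 = wdeg B i := by
    intro i
    rw [hM₁, run_fillVec hρ le_rfl _ _ (by decide),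
      RExp.eval_sum _ _ _ _ (hρ.update le_rfl i).zero]
    simp [RExp.eval_abs, eval, hadj, wdeg]
  set M₂ := (asg 0 (sum (arr 1 4 1))).run 4 ρ M₁ with hM₂
  have w2 : M₂.reg 0 = vol B := by
    simp only [hM₂, run, Function.update_self]
    rw [RExp.eval_sum _ _ _ _ hρ.zero]
    simp [eval, hρ.one, d1, vol]
  have d2 : ∀ i : Fin n, M₂.arr 1 i 0 = wdeg B i := d1
  set M₃ := (fillVec 4 2 (const 1 / sqrt (arr 1 4 1))).run 4 ρ M₂ with hM₃
  have i3 : ∀ i : Fin n, M₃.arr 2 i 0 = isqDeg B i := by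
    intro i
    rw [hM₃, run_fillVec hρ le_rfl _ _ (by decide)]
    simp [RExp.eval_div, eval, hρ.one, d2, isqDeg]
  have d3 : ∀ i : Fin n, M₃.arr 1 i 0 = wdeg B i := by
    rw [hM₃, run_arr _ (by decide)]; exact d2
  have a3 : M₃.arr 0 = M.arr 0 := by
    rw [hM₃, run_arr _ (by decide), hM₂, run_arr _ (by decide), hM₁, run_arr _ (by decide)]
  have w3 : M₃.reg 0 = vol B := by rw [hM₃, run_reg _ (by decide)]; exact w2
  set M₄ := (asg 1 (const 0 - reg 0)).run 4 ρ M₃ with hM₄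
  have b4 : M₄.reg 1 = -vol B := by
    simp [hM₄, run, RExp.eval_sub, eval, w3]
  set M₅ := (asg 9 (sum (const 1))).run 4 ρ M₄ with hM₅
  have n5 : M₅.reg 9 = n := by
    simp only [hM₅, run, Function.update_self]
    rw [RExp.eval_sum _ _ _ _ hρ.zero]
    simp [eval]
  set M₆ := (asg 2 (const 0)).run 4 ρ M₅ with hM₆
  set M₇ := (loop true (asg 2 (reg 2 + const 1))).run 4 ρ M₆ with hM₇
  have l7 : M₇.reg 2 = l := by
    have := iter_induction (N := l) (m := M₆)
      (f := fun k => (asg 2 (reg 2 + const 1)).run 5 (Function.update ρ 4 k))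
      (I := fun k (M : Mem) => M.reg 2 = k) (by simp [hM₆, run, eval])
      (fun k _ M' h => by simp [run, eval, Op.eval, h])
    rw [hM₇, run, show ρ (loopBound true) = l from hρ.three]
    exact this
  have e : setup.run 4 ρ M = (asg 3 (const 0)).run 4 ρ M₇ := rfl
  have s7 : ∀ a, M₇.arr a = M₃.arr a := by
    intro a
    rw [hM₇, run_arr _ rfl, hM₆, run_arr _ rfl, hM₅, run_arr _ rfl, hM₄, run_arr _ rfl]
  rw [e]
  refine ⟨⟨fun i j => ?_, fun i => ?_, fun i => ?_, ?_, ?_, ?_⟩, ?_, ?_, ?_⟩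
  · rw [run_arr _ rfl, s7, a3, hadj]
  · rw [run_arr _ rfl, s7, d3]
  · rw [run_arr _ rfl, s7, i3]
  · rw [run_reg _ (by decide), hM₇, run_reg _ (by decide), hM₆, run_reg _ (by decide), hM₅,
      run_reg _ (by decide), hM₄, run_reg _ (by decide), w3]
  · rw [run_reg _ (by decide), l7]
  · rw [run_reg _ (by decide), hM₇, run_reg _ (by decide), hM₆, run_reg _ (by decide), n5]
  · rw [run_reg _ (by decide), hM₇, run_reg _ (by decide), hM₆, run_reg _ (by decide), hM₅,
      run_reg _ (by decide), b4]
  · simp [run, eval]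
  · exact (run_out setup (by decide) 4 ρ M)

/-- The vector of the cut in the output. -/
def Mem.outVec (M : Mem) (n : ℕ) : Fin n → ℝ := fun i => if M.out 0 i 0 ≠ 0 then 1 else -1

/-- Register `1` is a lower bound for the value of the output. -/
def Best (B : Matrix (Fin n) (Fin n) ℝ) (M : Mem) : Prop := M.reg 1 ≤ quad B (M.outVec n)

theorem Best.run {p : Cmd} (h : Best B M) (h1 : p.writesReg 1 = false) (h2 : p.writesOut = false) :
    Best B (p.run d ρ M) := by
  unfold Best Mem.outVec
  rw [run_reg p h1, run_out p h2]
  exact h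

/-- The updates are made in place, so each step sees the earlier ones and the form never decreases.
Array 0 holds `-B`, which reverses the test on the slope. -/
theorem greedy_spec (hB : Bᵀ = B) (h0 : ∀ i, B i i = 0) (hρ : Env n l ρ) (hd : 4 ≤ d)
    (hM : Base l B M) (hx : ∀ i, |M.vec n 9 i| ≤ 1) :
    quad B (M.vec n 9) ≤ quad B (((greedy d).run d ρ M).vec n 9) ∧
      ∀ i, ((greedy d).run d ρ M).vec n 9 i = 1 ∨ ((greedy d).run d ρ M).vec n 9 i = -1 := by
  have hd1 : 1 ≠ d := by omega
  have hd0 : d ≠ 0 := by omega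
  set p := sto 9 d 1
    (RExp.ite (const 0) (sum (arr 0 d (d + 1) * arr 9 (d + 1) 1)) (const (-1)) (const 1)) with hp
  have e : (greedy d).run d ρ M = iter (fun k => p.run (d + 1) (Function.update ρ d k)) n M := by
    rw [greedy, run, show ρ (loopBound false) = n from hρ.zero]
  have key := iter_induction (N := n) (m := M) (f := fun k => p.run (d + 1) (Function.update ρ d k))
    (I := fun k M' => M'.arr 0 = M.arr 0 ∧ quad B (M.vec n 9) ≤ quad B (M'.vec n 9) ∧
      (∀ i, |M'.vec n 9 i| ≤ 1) ∧
      ∀ i : Fin n, (i : ℕ) < k → M'.vec n 9 i = 1 ∨ M'.vec n 9 i = -1)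
    ⟨rfl, le_rfl, hx, fun i hi => absurd hi (Nat.not_lt_zero _)⟩
    (by
      rintro k hk M' ⟨h1, h2, h3, h4⟩
      have hupd : ((p.run (d + 1) (Function.update ρ d k)) M').vec n 9 =
          Function.update (M'.vec n 9) ⟨k, hk⟩
            (if ∑ j, B ⟨k, hk⟩ j * M'.vec n 9 j < 0 then -1 else 1) := by
        have hs : ∑ x : Fin n, M'.arr 0 k x * M'.arr 9 x 0 =
            -∑ j, B ⟨k, hk⟩ j * M'.vec n 9 j := by
          rw [← Finset.sum_neg_distrib]
          refine Finset.sum_congr rfl fun j _ => ?_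
          rw [h1, hM.adj ⟨k, hk⟩ j, neg_mul]; rfl
        have hv : (RExp.ite (const 0) (sum (arr 0 d (d + 1) * arr 9 (d + 1) 1)) (const (-1))
            (const 1)).eval M' (d + 1) (Function.update ρ d k) =
            if ∑ j, B ⟨k, hk⟩ j * M'.vec n 9 j < 0 then -1 else 1 := by
          rw [eval, RExp.eval_sum _ _ _ _ (hρ.update hd k).zero]
          simp [eval, Op.eval, hρ.one, hd1, hd0, hs]
        ext i
        simp only [hp, run, hv, Mem.vec, write, Function.update_self,
          Function.update_of_ne hd1, hρ.one, Function.update_apply, Fin.ext_iff]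
        simp
      have hval : ((if ∑ j, B ⟨k, hk⟩ j * M'.vec n 9 j < 0 then -1 else 1 : ℝ)) = 1 ∨
          ((if ∑ j, B ⟨k, hk⟩ j * M'.vec n 9 j < 0 then -1 else 1 : ℝ)) = -1 := by
        split_ifs <;> simp
      refine ⟨?_, ?_, fun i => ?_, fun i hi => ?_⟩
      · rw [run_arr _ rfl, h1]
      · rw [hupd]
        exact h2.trans (quad_le_quad_update hB h0 _ _ (h3 _))
      · rw [hupd, Function.update_apply]
        split_ifs <;> first | simp | exact h3 i
      · rw [hupd, Function.update_apply]
        by_cases hik : i = ⟨k, hk⟩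
        · rw [if_pos hik]; exact hval
        · rw [if_neg hik]
          refine h4 i (lt_of_le_of_ne (Nat.lt_succ_iff.1 hi) fun h => hik (Fin.ext h)))
  rw [e]
  exact ⟨key.2.1, fun i => key.2.2.2 i i.2⟩

theorem keepBest_spec (hρ : Env n l ρ) (hd : 4 ≤ d) (hM : Base l B M) (hbest : Best B M)
    (hx : ∀ i, M.vec n 9 i = 1 ∨ M.vec n 9 i = -1) :
    Best B ((keepBest d).run d ρ M) ∧ M.reg 1 ≤ ((keepBest d).run d ρ M).reg 1 ∧
      quad B (M.vec n 9) ≤ ((keepBest d).run d ρ M).reg 1 := by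
  have hd1 : 1 ≠ d := by omega
  have hd0 : d ≠ 0 := by omega
  set M₁ := (asg 8 (sum (sum ((const 0 - arr 0 d (d + 1)) *
    (arr 9 d 1 * arr 9 (d + 1) 1))))).run d ρ M with hM₁
  have v1 : M₁.reg 8 = quad B (M.vec n 9) := by
    simp only [hM₁, run, Function.update_self]
    rw [RExp.eval_sum _ _ _ _ hρ.zero]
    refine Finset.sum_congr rfl fun i _ => ?_
    rw [RExp.eval_sum _ _ _ _ (hρ.update hd i).zero]
    refine Finset.sum_congr rfl fun j _ => ?_
    simp [eval, Op.eval, hρ.one, hd1, hd0, hM.adj, Mem.vec]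
  have r1 : M₁.reg 1 = M.reg 1 := by rw [hM₁, run_reg _ rfl]
  have o1 : M₁.out = M.out := by rw [hM₁, run_out _ rfl]
  have e : (keepBest d).run d ρ M = if M.reg 1 < quad B (M.vec n 9) then
      (loop false (out d (arr 9 d 1))).run d ρ ((asg 1 (reg 8)).run d ρ M₁) else M₁ := by
    rw [← v1, ← r1]
    simp only [keepBest, run, eval]
    rfl
  rw [e]
  split_ifs with h
  · set M₂ := (asg 1 (reg 8)).run d ρ M₁ with hM₂
    have r2 : M₂.reg 1 = quad B (M.vec n 9) := by simp [hM₂, run, eval, v1]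
    have x2 : M₂.arr 9 = M.arr 9 := by
      rw [hM₂, run_arr _ rfl, hM₁, run_arr _ rfl]
    have r3 : ((loop false (out d (arr 9 d 1))).run d ρ M₂).reg 1 = quad B (M.vec n 9) := by
      rw [run_reg _ rfl, r2]
    have o3 : ((loop false (out d (arr 9 d 1))).run d ρ M₂).outVec n = M.vec n 9 := by
      have key := iter_induction (N := n) (m := M₂)
        (f := fun k => (out d (arr 9 d 1)).run (d + 1) (Function.update ρ d k))
        (I := fun k M' => M'.arr 9 = M.arr 9 ∧
          ∀ i : Fin n, (i : ℕ) < k → M'.outVec n i = M.vec n 9 i)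
        ⟨x2, fun i hi => absurd hi (Nat.not_lt_zero _)⟩
        (by
          rintro k hk M' ⟨h1, h2⟩
          refine ⟨by rw [run_arr _ rfl, h1], fun i hi => ?_⟩
          have hv : (arr 9 d 1).eval M' (d + 1) (Function.update ρ d k) = M.arr 9 k 0 := by
            simp [eval, hρ.one, hd1, h1]
          simp only [run, hv, Mem.outVec, write, Function.update_self]
          by_cases hik : (i : ℕ) = k
          · have := hx i
            simp only [Mem.vec] at this ⊢
            rw [← hik]
            rcases this with h | h <;> simp [h]
          · have := h2 i (by omega)
            simpa [hik, Mem.outVec] using this)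
      ext i
      rw [run, show ρ (loopBound false) = n from hρ.zero]
      exact key.2 i i.2
    refine ⟨?_, ?_, r3.ge⟩
    · rw [Best, r3, o3]
    · rw [r3]; exact h.le
  · rw [r1]
    refine ⟨?_, le_rfl, not_lt.1 h⟩
    unfold Best Mem.outVec
    rw [r1, o1]
    exact hbest

theorem round_spec (hB : Bᵀ = B) (h0 : ∀ i, B i i = 0) (hρ : Env n l ρ) (hd : 4 ≤ d)
    (hM : Base l B M) (hbest : Best B M) (hx : ∀ i, |M.vec n 9 i| ≤ 1) :
    Best B ((round d).run d ρ M) ∧ M.reg 1 ≤ ((round d).run d ρ M).reg 1 ∧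
      quad B (M.vec n 9) ≤ ((round d).run d ρ M).reg 1 := by
  obtain ⟨h1, h2⟩ := greedy_spec hB h0 hρ hd hM hx
  have hM' : Base l B ((greedy d).run d ρ M) := hM.run rfl
  obtain ⟨h3, h4, h5⟩ := keepBest_spec hρ hd hM' (hbest.run rfl rfl) h2
  refine ⟨h3, ?_, h1.trans h5⟩
  rw [run_reg (r := 1) (greedy d) rfl] at h4
  exact h4

theorem stars_spec (hB : Bᵀ = B) (h0 : ∀ i, B i i = 0) (hρ : Env n l ρ)
    (hM : Base l B M) (hbest : Best B M) :
    Best B (stars.run 4 ρ M) ∧ ∀ i, quad B (starVec B i) ≤ (stars.run 4 ρ M).reg 1 := by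
  set p := Cmd.seq
    (fillVec 5 9 (RExp.eq 4 5 + (const 0 - arr 0 4 5) / (arr 1 4 1 * reg 9 * reg 9)))
    (round 5) with hp
  have e : stars.run 4 ρ M = iter (fun k => p.run 5 (Function.update ρ 4 k)) n M := by
    rw [stars, run, show ρ (loopBound false) = n from hρ.zero]
  have key := iter_induction (N := n) (m := M) (f := fun k => p.run 5 (Function.update ρ 4 k))
    (I := fun k M' => Base l B M' ∧ Best B M' ∧
      ∀ i : Fin n, (i : ℕ) < k → quad B (starVec B i) ≤ M'.reg 1)
    ⟨hM, hbest, fun i hi => absurd hi (Nat.not_lt_zero _)⟩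
    (by
      rintro k hk M' ⟨h1, h2, h3⟩
      have hρ' := hρ.update le_rfl k
      set M₁ := (fillVec 5 9 (RExp.eq 4 5 +
        (const 0 - arr 0 4 5) / (arr 1 4 1 * reg 9 * reg 9))).run 5 (Function.update ρ 4 k) M'
        with hM₁
      have hv : M₁.vec n 9 = starVec B ⟨k, hk⟩ := by
        ext j
        have hA := h1.adj ⟨k, hk⟩ j
        have hD := h1.deg ⟨k, hk⟩
        simp only at hA hD
        rw [Mem.vec, hM₁, run_fillVec hρ' (by norm_num) _ _ rfl]
        simp [eval_eq, eval, Op.eval, hρ.one, hA, hD, h1.card, starVec, Fin.ext_iff]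
      have hr : M₁.reg 1 = M'.reg 1 := by rw [hM₁, run_reg _ rfl]
      obtain ⟨h4, h5, h6⟩ := round_spec (d := 5) hB h0 hρ' (by norm_num) (h1.run rfl)
        (h2.run rfl rfl) (M := M₁) (by rw [hv]; exact abs_starVec_le h0 _)
      refine ⟨h1.run rfl, h4, fun i hi => ?_⟩
      by_cases hik : (i : ℕ) = k
      · obtain rfl : i = ⟨k, hk⟩ := Fin.ext hik
        rw [hv] at h6
        exact h6
      · rw [hr] at h5
        exact (h3 i (by omega)).trans h5)
  rw [e]
  exact ⟨key.2.1, fun i => key.2.2 i i.2⟩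

end Specs

/-! ### Correctness of a single phase. -/

section PhaseSpecs

variable {n l : ℕ} {ρ : ℕ → ℕ} {d : ℕ} {M : Mem} {B : Matrix (Fin n) (Fin n) ℝ}

theorem buildMat_spec (hρ : Env n l ρ) (hd : 4 ≤ d) (hM : Base l B M) :
    ((buildMat d).run d ρ M).mat n 4 = stepMat B (M.vec n 3) := by
  have hd1 : 1 ≠ d := by omega
  have hd0 : d ≠ 0 := by omega
  ext i j
  rw [Mem.mat, of_apply, buildMat, run_fillMat hρ hd _ _ rfl]
  simp [eval_eq, eval, Op.eval, hρ.one, hd1, hd0, hM.adj, hM.isq, stepMat, Mem.vec, Fin.ext_iff]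

theorem square_spec (hρ : Env n l ρ) (hd : 4 ≤ d) :
    ((square d).run d ρ M).mat n 4 = M.mat n 4 * M.mat n 4 ∧
      ((square d).run d ρ M).reg 4 = 2 * M.reg 4 := by
  have hd1 : 1 ≠ d := by omega
  have hd0 : d ≠ 0 := by omega
  set M₁ := (fillMat d 5 (sum (arr 4 d (d + 2) * arr 4 (d + 2) (d + 1)))).run d ρ M with hM₁
  have m1 : M₁.mat n 5 = M.mat n 4 * M.mat n 4 := by
    ext i j
    rw [Mem.mat, of_apply, hM₁, run_fillMat hρ hd _ _ rfl,
      RExp.eval_sum _ _ _ _ ((hρ.update hd i).update (by omega) j).zero, mul_apply]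
    simp [eval, Op.eval, Mem.mat]
  set M₂ := (fillMat d 4 (arr 5 d (d + 1))).run d ρ M₁ with hM₂
  have m2 : M₂.mat n 4 = M.mat n 4 * M.mat n 4 := by
    rw [← m1]
    ext i j
    rw [Mem.mat, of_apply, hM₂, run_fillMat hρ hd _ _ rfl]
    simp [eval, Mem.mat]
  have r2 : M₂.reg 4 = M.reg 4 := by rw [hM₂, run_reg _ rfl, hM₁, run_reg _ rfl]
  have e : (square d).run d ρ M = (asg 4 (reg 4 + reg 4)).run d ρ M₂ := rfl
  rw [e]
  refine ⟨m2, ?_⟩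
  simp [run, eval, Op.eval, r2, two_mul]

theorem power_spec (hρ : Env n l ρ) (hd : 4 ≤ d) {N J : ℕ} (hN : M.reg 5 = N)
    (hJ : N ≤ 2 ^ (J + 1)) (hJ' : ∀ i < J, 2 ^ (i + 1) < N) (hJl : J ≤ l)
    (hsym : (M.mat n 4)ᵀ = M.mat n 4) :
    ((power d).run d ρ M).mat n 4 = M.mat n 4 ^ 2 ^ J ∧
      ((power d).run d ρ M).reg 4 = (2 ^ (J + 1) : ℕ) ∧
      ((power d).run d ρ M).reg 6 = (M.mat n 4 ^ 2 ^ (J + 1)).trace := by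
  have hd1 : 1 ≠ d := by omega
  have hd0 : d ≠ 0 := by omega
  set M₁ := (asg 4 (const 2)).run d ρ M with hM₁
  have r1 : M₁.reg 4 = 2 := by simp [hM₁, run, eval]
  have n1 : M₁.reg 5 = N := by rw [hM₁, run_reg _ rfl, hN]
  set p := Cmd.ite (reg 4) (reg 5) (square (d + 1)) skip with hp
  set M₂ := (loop true p).run d ρ M₁ with hM₂
  have key := iter_induction (N := l) (m := M₁)
    (f := fun k => p.run (d + 1) (Function.update ρ d k))
    -- After `J` squarings the test fails in all remaining iterations, whence `min k J`.
    (I := fun k M' => M'.reg 5 = N ∧ M'.mat n 4 = M.mat n 4 ^ 2 ^ min k J ∧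
      M'.reg 4 = (2 ^ (min k J + 1) : ℕ))
    ⟨n1, by simp; rfl, by simp [r1]⟩
    (by
      rintro k hk M' ⟨h1, h2, h3⟩
      refine ⟨by rw [run_reg _ rfl, h1], ?_⟩
      have hc : M'.reg 4 < M'.reg 5 ↔ k < J := by
        rw [h3, h1, Nat.cast_lt]
        constructor
        · intro h
          by_contra hkJ
          rw [min_eq_right (by omega)] at h
          omega
        · intro h
          rw [min_eq_left h.le]
          exact hJ' k h
      simp only [hp, run, eval, hc]
      split_ifs with hkJ
      · obtain ⟨s1, s2⟩ := square_spec (M := M') (hρ.update hd k) (by omega : 4 ≤ d + 1)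
        rw [s1, s2, h2, h3, min_eq_left hkJ.le, min_eq_left (by omega : k + 1 ≤ J)]
        refine ⟨by rw [← pow_add, ← two_mul, ← pow_succ'], ?_⟩
        push_cast
        ring
      · rw [h2, h3, min_eq_right (by omega), min_eq_right (by omega)]
        exact ⟨rfl, rfl⟩)
  have e2 : M₂ = iter (fun k => p.run (d + 1) (Function.update ρ d k)) l M₁ := by
    rw [hM₂, run, show ρ (loopBound true) = l from hρ.three]
  rw [← e2, min_eq_right hJl] at key
  obtain ⟨k1, k2, k3⟩ := key
  have e : (power d).run d ρ M =
      (asg 6 (sum (sum (arr 4 d (d + 1) * arr 4 d (d + 1))))).run d ρ M₂ := rfl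
  refine ⟨?_, ?_, ?_⟩
  · rw [e]; exact k2
  · rw [e, run_reg _ rfl, k3]
  · rw [e]
    simp only [run, Function.update_self]
    rw [RExp.eval_sum _ _ _ _ hρ.zero, trace]
    refine Finset.sum_congr rfl fun i _ => ?_
    -- By symmetry, a diagonal entry of the full power is the squared norm of a row of the half
    -- power.
    rw [RExp.eval_sum _ _ _ _ (hρ.update hd i).zero, diag_apply, pow_succ',
      pow_two_pow_apply_self hsym]
    refine Finset.sum_congr rfl fun j _ => ?_
    rw [← k2]
    simp [eval, Op.eval, Mem.mat, sq]

theorem eval_ifHeavy (hM : Base l B M) {a : ℕ} (ha : M.reg 3 = a) {P : Matrix (Fin n) (Fin n) ℝ}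
    (hP : ∀ i, P i i = ∑ j, M.mat n 4 i j ^ 2) (htr : M.reg 6 = P.trace) (i : Fin n)
    {d' : ℕ} (h0 : ρ 0 = n) (h1 : ρ 1 = 0) (h2 : ρ d = i) (hd : d ≠ d') (e f : RExp) :
    (ifHeavy d d' e f).eval M d' ρ =
      if i ∈ heavy B P (40 * a) then e.eval M d' ρ else f.eval M d' ρ := by
  have hs : (sum (arr 4 d d' * arr 4 d d')).eval M d' ρ = P i i := by
    rw [RExp.eval_sum _ _ _ _ h0, hP]
    refine Finset.sum_congr rfl fun j _ => ?_
    simp [eval, Op.eval, h2, hd, Mem.mat, sq]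
  have hl : (const 40 * reg 3 * arr 1 d 1 * reg 6).eval M d' ρ =
      40 * a * wdeg B i * P.trace := by
    simp [eval, Op.eval, h1, h2, ha, htr, hM.deg]
  have hr : (reg 0 * sum (arr 4 d d' * arr 4 d d')).eval M d' ρ = vol B * P i i := by
    rw [eval_mul, hs, eval, hM.vol]
  simp only [ifHeavy, eval.eq_7, hl, hr, heavy, Finset.mem_filter, Finset.mem_univ, true_and]

theorem relax_spec (hρ : Env n l ρ) (hd : 4 ≤ d) (hM : Base l B M) {a m : ℕ} (ha : M.reg 3 = a)
    (hm : M.reg 4 = m) {P : Matrix (Fin n) (Fin n) ℝ}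
    (hP : ∀ i, P i i = ∑ j, M.mat n 4 i j ^ 2) (htr : M.reg 6 = P.trace) :
    ((relax d).run d ρ M).mat n 6 = relaxVec B (M.vec n 3) (M.mat n 4) P (40 * a) ∧
      ((relax d).run d ρ M).vec n 3 = damp (M.vec n 3) (heavy B P (40 * a)) m := by
  have hd1 : 1 ≠ d := by omega
  have hd0 : d ≠ 0 := by omega
  set M₁ := (fillMat d 6 (ifHeavy d (d + 2) (const 0)
    (arr 3 d 1 * arr 2 d 1 * arr 4 d (d + 1) * (sqrt (reg 0) / sqrt (reg 6))))).run d ρ M with hM₁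
  have m1 : M₁.mat n 6 = relaxVec B (M.vec n 3) (M.mat n 4) P (40 * a) := by
    ext i j
    have hρ' := (hρ.update hd i).update (by omega : 4 ≤ d + 1) j
    rw [Mem.mat, of_apply, hM₁, run_fillMat hρ hd _ _ rfl,
      eval_ifHeavy hM ha hP htr i hρ'.zero hρ'.one (by simp) (by omega)]
    simp [eval, Op.eval, hρ.one, hd1, hd0, hM.isq, hM.vol, htr, relaxVec, heavy, Mem.vec, Mem.mat]
  set M₂ := (fillVec d 8 (ifHeavy d (d + 1) (arr 3 d 1 * (const 1 - const 1 / reg 4))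
    (arr 3 d 1))).run d ρ M₁ with hM₂
  have a1 : ∀ b, b ≠ 6 → M₁.arr b = M.arr b := fun b hb => by
    rw [hM₁, run_arr _ (by simpa [fillMat, writesArr] using hb.symm)]
  have r1 : M₁.reg = M.reg := by
    funext r
    rw [hM₁, run_reg _ rfl]
  have m2 : M₂.vec n 8 = damp (M.vec n 3) (heavy B P (40 * a)) m := by
    ext i
    have hρ' := hρ.update hd i
    have h4 : M₁.mat n 4 = M.mat n 4 := by simp only [Mem.mat, a1 4 (by norm_num)]
    rw [Mem.vec, hM₂, run_fillVec hρ hd _ _ rfl,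
      eval_ifHeavy (M := M₁) (hM.run rfl) (by rw [r1, ha]) (by rw [h4]; exact hP)
        (by rw [r1, htr]) i hρ'.zero hρ'.one (by simp) (by omega)]
    simp [eval, Op.eval, hρ.one, hd1, a1, r1, hm, damp, Mem.vec]
  have e : (relax d).run d ρ M = (fillVec d 3 (arr 8 d 1)).run d ρ M₂ := rfl
  rw [e]
  constructor
  · rw [← m1]
    ext i j
    rw [Mem.mat, Mem.mat, of_apply, of_apply, run_arr _ rfl, hM₂, run_arr _ rfl]
  · rw [← m2]
    ext i
    rw [Mem.vec, run_fillVec hρ hd _ _ rfl]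
    simp [eval, hρ.one, hd1, Mem.vec]

theorem eval_signExp (hM : Base l B M) {a : ℝ} (ha : M.reg 3 = a) (h0 : ρ 0 = n) (h1 : ρ 1 = 0)
    (hd : 4 ≤ d) {k : Fin n} (hk : ρ d = k) :
    (signExp d).eval M (d + 1) ρ =
      signDiff B (M.mat n 6) (1 / (2048 * a * a)) (M.vec n 7)
        (Finset.univ.filter fun j : Fin n => k < j) k := by
  have hd1 : 1 ≠ d := by omega
  have hd0 : d ≠ 0 := by omega
  have u0 : ∀ i, Function.update ρ (d + 1) i 0 = n := fun i => by
    rw [Function.update_of_ne (by omega), h0]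
  have u2 : ∀ i j, Function.update (Function.update ρ (d + 1) i) (d + 1 + 1) j d = k := by
    intro i j
    rw [Function.update_of_ne (by omega), Function.update_of_ne (by omega), hk]
  rw [signExp, eval_sub, eval_mul, signDiff]
  congr 1
  · rw [RExp.eval_sum _ _ _ _ h0, bilin]
    refine Finset.sum_congr rfl fun i _ => ?_
    rw [RExp.eval_sum _ _ _ _ (u0 i)]
    refine Finset.sum_congr rfl fun j _ => ?_
    simp [eval, Op.eval, h1, u2, hd0, hM.adj, Mem.vec, Mem.mat]
  · congr 1
    · simp [eval, Op.eval, ha]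
    · rw [RExp.eval_sum _ _ _ _ h0]
      refine Finset.sum_congr rfl fun i _ => ?_
      have hs : (sum (lt d (d + 2) * (arr 6 (d + 1) (d + 2) * arr 6 (d + 1) (d + 2)))).eval M
          (d + 1 + 1) (Function.update ρ (d + 1) i) =
          ∑ j ∈ Finset.univ.filter (fun j : Fin n => k < j), M.mat n 6 i j ^ 2 := by
        rw [RExp.eval_sum _ _ _ _ (u0 i), Finset.sum_filter]
        refine Finset.sum_congr rfl fun j _ => ?_
        simp [eval, Op.eval, u2, Mem.mat, sq]
      rw [eval_mul, eval_add, eval_add, eval_mul (f := sum _), hs]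
      simp [eval, Op.eval, h1, hk, hd0, hM.deg, Mem.vec, Mem.mat]
      ring_nf
      simp

/-- Once all signs are fixed, the potential has become the value of the form minus the truncation
penalty, and it has never decreased. -/
theorem signs_spec (hB : Bᵀ = B) (hρ : Env n l ρ) (hd : 4 ≤ d) (hM : Base l B M) {a c : ℝ}
    (ha : M.reg 3 = a) (hc : c = 1 / (2048 * a * a)) :
    signPot B (M.mat n 6) c (fun _ => 0) Finset.univ ≤
      quad B (((signs d).run d ρ M).vec n 7) -
        c * ∑ i, wdeg B i * ((signs d).run d ρ M).vec n 7 i ^ 4 := by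
  have hd1 : 1 ≠ d := by omega
  have hd0 : d ≠ 0 := by omega
  have hc0 : 0 ≤ c := by
    rw [hc, mul_assoc]
    exact div_nonneg zero_le_one (mul_nonneg (by norm_num) (mul_self_nonneg a))
  set M₁ := (fillVec d 7 (const 0)).run d ρ M with hM₁
  have g1 : M₁.vec n 7 = fun _ => 0 := by
    ext i
    rw [Mem.vec, hM₁, run_fillVec hρ hd _ _ rfl]
    simp [eval]
  have u1 : M₁.mat n 6 = M.mat n 6 := by
    simp only [Mem.mat, hM₁, run_arr (a := 6) (fillVec d 7 (const 0)) rfl]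
  set p := Cmd.seq (asg 7 (signExp d)) (Cmd.seq (fillVec (d + 1) 8 (arr 7 (d + 1) 1 +
      RExp.ite (reg 7) (const 0) (const (-1)) (const 1) * arr 6 (d + 1) d))
    (fillVec (d + 1) 7 (arr 8 (d + 1) 1))) with hp
  have e : (signs d).run d ρ M = iter (fun k => p.run (d + 1) (Function.update ρ d k)) n M₁ := by
    rw [signs, run, run, show ρ (loopBound false) = n from hρ.zero]
  have key := iter_induction (N := n) (m := M₁)
    (f := fun k => p.run (d + 1) (Function.update ρ d k))
    (I := fun k M' => Base l B M' ∧ M'.reg 3 = a ∧ M'.mat n 6 = M.mat n 6 ∧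
      signPot B (M.mat n 6) c (fun _ => 0) Finset.univ ≤ signPot B (M.mat n 6) c (M'.vec n 7)
        -- The columns from `k` on still await their signs.
        (Finset.univ.filter fun j : Fin n => k ≤ (j : ℕ)))
    ⟨hM.run rfl, by rw [hM₁, run_reg _ rfl, ha], u1, by simp [g1]⟩
    (by
      rintro k hk M' ⟨h1, h2, h3, h4⟩
      have hρ' := hρ.update hd k
      set k' : Fin n := ⟨k, hk⟩ with hk'
      set S := Finset.univ.filter fun j : Fin n => k' < j with hS
      have hS1 : (Finset.univ.filter fun j : Fin n => k ≤ (j : ℕ)) = insert k' S := by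
        ext j
        simp only [Finset.mem_filter, Finset.mem_univ, true_and, Finset.mem_insert, hS, hk',
          Fin.ext_iff, Fin.lt_def]
        omega
      have hS2 : (Finset.univ.filter fun j : Fin n => k + 1 ≤ (j : ℕ)) = S := rfl
      have hkS : k' ∉ S := by simp [hS]
      set M₂ := (asg 7 (signExp d)).run (d + 1) (Function.update ρ d k) M' with hM₂
      have s2 : M₂.reg 7 = signDiff B (M.mat n 6) c (M'.vec n 7) S k' := by
        simp only [hM₂, run, Function.update_self]
        rw [eval_signExp (k := k') h1 h2 hρ'.zero hρ'.one hd (by simp [hk']), h3, hc]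
      set M₃ := (fillVec (d + 1) 8 (arr 7 (d + 1) 1 +
        RExp.ite (reg 7) (const 0) (const (-1)) (const 1) * arr 6 (d + 1) d)).run (d + 1)
        (Function.update ρ d k) M₂ with hM₃
      have v3 : M₃.vec n 8 = fun i => M'.vec n 7 i +
          (if signDiff B (M.mat n 6) c (M'.vec n 7) S k' < 0 then -1 else 1) *
            M.mat n 6 i k' := by
        ext i
        rw [← s2, ← h3, Mem.vec, hM₃, run_fillVec hρ' (by omega) _ _ rfl]
        simp only [eval_add, eval_mul, eval.eq_7]
        have a2 : M₂.arr = M'.arr := rfl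
        simp [eval, hρ.one, hd1, hd0, Mem.vec, Mem.mat, hk', a2]
      refine ⟨h1.run rfl, by rw [run_reg _ rfl, h2], ?_, ?_⟩
      · rw [← h3]
        simp only [Mem.mat, run_arr (a := 6) p rfl]
      · have hv : (p.run (d + 1) (Function.update ρ d k) M').vec n 7 = M₃.vec n 8 := by
          have e : p.run (d + 1) (Function.update ρ d k) M' =
            (fillVec (d + 1) 7 (arr 8 (d + 1) 1)).run (d + 1) (Function.update ρ d k) M₃ := rfl
          ext i
          rw [e, Mem.vec, run_fillVec hρ' (by omega) _ _ rfl]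
          simp [eval, hρ.one, hd1, hd0, Mem.vec]
        rw [hv, v3, hS2]
        rw [hS1] at h4
        exact h4.trans (signPot_le hB _ hc0 _ hkS))
  rw [← e] at key
  have hemp : (Finset.univ.filter fun j : Fin n => n ≤ (j : ℕ)) = ∅ := by
    ext j
    have := j.2
    simp only [Finset.mem_filter, Finset.mem_univ, true_and, Finset.notMem_empty, iff_false]
    omega
  have := key.2.2.2
  rwa [hemp, signPot_empty] at this

theorem truncate_spec (hρ : Env n l ρ) (hd : 4 ≤ d) {a : ℝ} (ha : M.reg 3 = a) :
    ((truncate d).run d ρ M).vec n 9 = fun i => clip (64 * a) (M.vec n 7 i) := by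
  have hd1 : 1 ≠ d := by omega
  ext i
  rw [Mem.vec, truncate, run_fillVec hρ hd _ _ rfl]
  simp [eval, Op.eval, hρ.one, hd1, ha, clip, Mem.vec]
  congr

/-- That the best value does not get worse holds unconditionally; the last part ties one phase to
the dichotomy of `Progress.step`. -/
theorem phase_spec (hB : Bᵀ = B) (h0 : ∀ i, B i i = 0) (hρ : Env n l ρ) (hd : 4 ≤ d)
    (hM : Base l B M) (hbest : Best B M) {a : ℕ} (ha : M.reg 3 = a) (ha0 : 0 < a) :
    Best B ((phase d).run d ρ M) ∧ M.reg 1 ≤ ((phase d).run d ρ M).reg 1 ∧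
      ∀ (N J : ℕ), M.reg 5 = N → N ≤ 2 ^ (J + 1) → (∀ i < J, 2 ^ (i + 1) < N) → J ≤ l →
        ((phase d).run d ρ M).vec n 3 = damp (M.vec n 3)
          (heavy B (stepMat B (M.vec n 3) ^ 2 ^ (J + 1)) (40 * a)) (2 ^ (J + 1)) ∧
        (IsRelaxSol B (relaxVec B (M.vec n 3) (stepMat B (M.vec n 3) ^ 2 ^ J)
            (stepMat B (M.vec n 3) ^ 2 ^ (J + 1)) (40 * a)) (40 * a) (1 / (a : ℝ) / 8 * vol B) →
          vol B / (65536 * a ^ 3) ≤ ((phase d).run d ρ M).reg 1) := by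
  have ha' : (0 : ℝ) < a := by exact_mod_cast ha0
  set M₁ := (buildMat d).run d ρ M with hM₁
  set M₂ := (power d).run d ρ M₁ with hM₂
  set M₃ := (relax d).run d ρ M₂ with hM₃
  set M₄ := (signs d).run d ρ M₃ with hM₄
  set M₅ := (truncate d).run d ρ M₄ with hM₅
  have e : (phase d).run d ρ M = (round d).run d ρ M₅ := rfl
  have b1 : Base l B M₁ := hM.run rfl
  have b2 : Base l B M₂ := b1.run rfl
  have b3 : Base l B M₃ := b2.run rfl
  have b4 : Base l B M₄ := b3.run rfl
  have b5 : Base l B M₅ := b4.run rfl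
  have a2 : M₂.reg 3 = a := by rw [hM₂, run_reg _ rfl, hM₁, run_reg _ rfl, ha]
  have a3 : M₃.reg 3 = a := by rw [hM₃, run_reg _ rfl, a2]
  have a4 : M₄.reg 3 = a := by rw [hM₄, run_reg _ rfl, a3]
  have best5 : Best B M₅ :=
    ((((hbest.run rfl rfl : Best B M₁).run rfl rfl : Best B M₂).run rfl rfl :
      Best B M₃).run rfl rfl : Best B M₄).run rfl rfl
  have r5 : M₅.reg 1 = M.reg 1 := by
    rw [hM₅, run_reg _ rfl, hM₄, run_reg _ rfl, hM₃, run_reg _ rfl, hM₂, run_reg _ rfl, hM₁,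
      run_reg _ rfl]
  have x5 : M₅.vec n 9 = fun i => clip (64 * a) (M₄.vec n 7 i) := truncate_spec hρ hd a4
  obtain ⟨s1, s2, s3⟩ := round_spec hB h0 hρ hd b5 best5
    (by rw [x5]; exact fun i => abs_clip_le (by positivity) _)
  rw [e]
  refine ⟨s1, by rwa [r5] at s2, fun N J hN hJ hJ' hJl => ?_⟩
  have m1 : M₁.mat n 4 = stepMat B (M.vec n 3) := buildMat_spec hρ hd hM
  have hsym := stepMat_transpose hB (M.vec n 3)
  obtain ⟨p1, p2, p3⟩ := power_spec (M := M₁) hρ hd (by rw [hM₁, run_reg _ rfl, hN]) hJ hJ' hJl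
    (by rw [m1, hsym])
  rw [m1] at p1 p3
  have q2 : M₂.vec n 3 = M.vec n 3 := by
    unfold Mem.vec
    rw [hM₂, run_arr _ rfl, hM₁, run_arr _ rfl]
  obtain ⟨t1, t2⟩ := relax_spec (M := M₂) hρ hd b2 a2 p2
    (P := stepMat B (M.vec n 3) ^ 2 ^ (J + 1))
    (fun i => by rw [p1, pow_succ', pow_two_pow_apply_self hsym]) p3
  rw [p1, q2] at t1
  rw [q2] at t2
  constructor
  · rw [← t2]
    unfold Mem.vec
    rw [run_arr _ rfl, hM₅, run_arr _ rfl, hM₄, run_arr _ rfl]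
  · intro hsol
    rw [← t1] at hsol
    set c : ℝ := 1 / (2048 * a * a) with hc
    have hc0 : 0 ≤ c := by positivity
    have u1 := hsol.le_signPot hc0 (by positivity)
    have u2 := signs_spec (M := M₃) hB hρ hd b3 a3 hc
    have u3 := le_quad_clip hB (T := 64 * a) (c := c) (by positivity)
      (by rw [hc]; field_simp; norm_num) (M₄.vec n 7)
    rw [← x5] at u3
    -- The penalty factor `3 c K` is `(120/2048)/a`, less than `(1/16)/a`, so at least half of the
    -- objective `vol/(8a)` survives. Division by `T² = 4096 a²` then yields `vol/(65536 a³)`.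
    have u4 : 1 / (a : ℝ) / 16 * vol B ≤ (64 * (a : ℝ)) ^ 2 * quad B (M₅.vec n 9) := by
      refine le_trans ?_ (u1.trans (u2.trans u3))
      have e1 : 3 * c * (40 * a) = 120 / 2048 * (1 / (a : ℝ)) := by
        rw [hc]; field_simp; norm_num
      rw [e1]
      have : 0 ≤ 1 / (a : ℝ) * vol B := mul_nonneg (by positivity) (vol_nonneg B)
      linarith
    refine le_trans ?_ s3
    rw [div_le_iff₀ (by positivity)]
    have u5 := mul_le_mul_of_nonneg_left u4 (by positivity : 0 ≤ 16 * (a : ℝ))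
    have e2 : 16 * (a : ℝ) * (1 / a / 16 * vol B) = vol B := by field_simp
    rw [e2] at u5
    linarith

end PhaseSpecs

/-! ### All phases for one guess, and all guesses. -/

section GuessSpecs

variable {n l : ℕ} {ρ : ℕ → ℕ} {M : Mem} {B : Matrix (Fin n) (Fin n) ℝ}

/-- The number of squarings for the guess `1 / a`. -/
theorem exists_squarings {a l : ℕ} (ha : 0 < a) (hal : a ≤ l) (hl : 8 ≤ l) :
    ∃ J ≤ l, (5 * a * l ≤ 2 ^ (J + 1) ∧ ∀ i < J, 2 ^ (i + 1) < 5 * a * l) ∧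
      2 ^ (J + 1) ≤ 10 * a * l := by
  -- This needs `l ≥ 8`: at 8 it reads 320 ≤ 512.
  have h1 : ∀ l, 8 ≤ l → 5 * l * l ≤ 2 ^ (l + 1) := by
    intro l hl
    induction l, hl using Nat.le_induction with
    | base => norm_num
    | succ k hk ih => rw [pow_succ]; nlinarith
  have h2 : 5 * a * l ≤ 2 ^ (l + 1) :=
    (Nat.mul_le_mul_right _ (Nat.mul_le_mul_left _ hal)).trans (h1 l hl)
  have hex : ∃ J, 5 * a * l ≤ 2 ^ (J + 1) := ⟨l, h2⟩
  refine ⟨Nat.find hex, Nat.find_min' hex h2,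
    ⟨Nat.find_spec hex, fun i hi => not_le.1 (Nat.find_min hex hi)⟩, ?_⟩
  cases hJ : Nat.find hex with
  | zero =>
    have := Nat.mul_pos ha (show 0 < l by omega)
    rw [mul_assoc]
    norm_num
    omega
  | succ i =>
    have := Nat.find_min hex (m := i) (by omega)
    rw [pow_succ]
    linarith

/-- Every failed phase adds at least `ε²/256` to a total bounded by `5m`, so at most `1280 m a² ≤
12800 l⁴` phases fail. This is below `l⁹`, as `8⁵ > 12800`. -/
theorem not_progress {ε K : ℝ} {m : ℕ} {q : Fin n → ℝ} {c : ℝ} {a : ℕ} (ha : 0 < a)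
    (hal : a ≤ l) (hl : 8 ≤ l) (hm : m ≤ 10 * a * l) (hε : ε = 1 / (a : ℝ)) :
    ¬ Progress B ε K m (l ^ 9) q c := by
  intro h
  have h1 := h.le_total.trans h.total_le
  have ha' : (0 : ℝ) < a := by exact_mod_cast ha
  rw [hε, div_pow, one_pow, div_div, div_mul_eq_mul_div, one_mul, div_le_iff₀ (by positivity)] at h1
  have h2 : l ^ 9 ≤ 5 * m * (a ^ 2 * 256) := by exact_mod_cast h1
  have h3 : 5 * m * (a ^ 2 * 256) ≤ 12800 * l ^ 4 :=
    calc 5 * m * (a ^ 2 * 256) ≤ 5 * (10 * l * l) * (l ^ 2 * 256) := by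
          refine Nat.mul_le_mul (Nat.mul_le_mul_left _ (hm.trans ?_))
            (Nat.mul_le_mul_right _ (Nat.pow_le_pow_left hal 2))
          exact Nat.mul_le_mul_right _ (Nat.mul_le_mul_left _ hal)
      _ = _ := by ring
  have h4 : 8 ^ 5 * l ^ 4 ≤ l ^ 9 := by
    rw [show 9 = 5 + 4 from rfl, pow_add]
    exact Nat.mul_le_mul_right _ (Nat.pow_le_pow_left hl 5)
  have h5 : 0 < l ^ 4 := by positivity
  omega

/-- The invariant over the phases is that either the best value is already good enough or the
damping vector has made `t` steps of progress; after `l⁹` phases the second is impossible. -/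
theorem guess_spec (hB : Bᵀ = B) (h0 : ∀ i, B i i = 0) (hρ : Env n l ρ) (hl : 8 ≤ l)
    (hn : n ≤ 2 ^ l) (hM : Base l B M) (hbest : Best B M) {b : ℕ} (hb : M.reg 3 = b)
    (hbl : b < l) :
    Base l B (guess.run 5 ρ M) ∧ Best B (guess.run 5 ρ M) ∧
      (guess.run 5 ρ M).reg 3 = (b + 1 : ℕ) ∧ M.reg 1 ≤ (guess.run 5 ρ M).reg 1 ∧
      ∀ y : Fin n → ℝ, 0 < vol B → (∀ i, y i * y i = 1) →
        1 / ((b + 1 : ℕ) : ℝ) * vol B ≤ quad B y →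
        vol B / (65536 * ((b + 1 : ℕ) : ℝ) ^ 3) ≤ (guess.run 5 ρ M).reg 1 := by
  set a := b + 1 with ha
  have ha0 : 0 < a := by omega
  have ha' : (0 : ℝ) < a := by exact_mod_cast ha0
  obtain ⟨J, hJl, ⟨hJ, hJ'⟩, hm⟩ := exists_squarings ha0 hbl hl
  set M₁ := (asg 3 (reg 3 + const 1)).run 5 ρ M with hM₁
  set M₂ := (asg 5 (const 5 * reg 3 * reg 2)).run 5 ρ M₁ with hM₂
  set M₃ := (fillVec 5 3 (const 1)).run 5 ρ M₂ with hM₃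
  have e : guess.run 5 ρ M = (nest 9 (phase 14)).run 5 ρ M₃ := rfl
  have r1 : M₁.reg 3 = a := by simp [hM₁, run, eval, Op.eval, hb, ha]
  have b1 : Base l B M₁ := hM.run rfl
  have r2 : M₂.reg 5 = (5 * a * l : ℕ) := by simp [hM₂, run, eval, Op.eval, r1, b1.len]
  have v3 : M₃.vec n 3 = fun _ => 1 := by
    ext i
    rw [Mem.vec, hM₃, run_fillVec hρ (by norm_num) _ _ rfl]
    simp [eval]
  have key := run_nest (n := n) (l := l) (p := phase 14) 9 (d := 5) (ρ := ρ)
    (I := fun t M' => Base l B M' ∧ Best B M' ∧ M'.reg 3 = a ∧ M'.reg 5 = (5 * a * l : ℕ) ∧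
      M.reg 1 ≤ M'.reg 1 ∧ ∀ y : Fin n → ℝ, 0 < vol B → (∀ i, y i * y i = 1) →
        1 / (a : ℝ) * vol B ≤ quad B y →
        vol B / (65536 * (a : ℝ) ^ 3) ≤ M'.reg 1 ∨
          ∃ c, Progress B (1 / (a : ℝ)) (40 * a) (2 ^ (J + 1)) t (M'.vec n 3) c)
    (by norm_num) hρ
    (by
      rintro ρ' hρ' t M' ⟨i1, i2, i3, i4, i5, i6⟩
      obtain ⟨s1, s2, s3⟩ := phase_spec (d := 14) hB h0 hρ' (by norm_num) i1 i2 i3 ha0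
      obtain ⟨s4, s5⟩ := s3 _ J i4 hJ hJ' hJl
      refine ⟨i1.run rfl, s1, by rw [run_reg _ rfl, i3], by rw [run_reg _ rfl, i4],
        i5.trans s2, fun y hvol hy hopt => ?_⟩
      rcases i6 y hvol hy hopt with h | ⟨c, h⟩
      · exact Or.inl (h.trans s2)
      · have hcard : Fintype.card (Fin n) ≤ 2 ^ 2 ^ (J + 1) := by
          rw [Fintype.card_fin]
          refine hn.trans (Nat.pow_le_pow_right (by norm_num) (le_trans ?_ hJ))
          nlinarith
        have hpow := card_mul_pow_le (N := Fintype.card (Fin n)) ha0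
          (by rwa [Fintype.card_fin]) hJ
        rcases h.step hB (by positivity) (by field_simp) hcard hpow hvol hy hopt with h | h
        · exact Or.inl (s5 h)
        · right
          rw [s4]
          exact h)
    0 M₃
    ⟨((b1.run rfl : Base l B M₂).run rfl), ((hbest.run rfl rfl : Best B M₁).run rfl rfl :
      Best B M₂).run rfl rfl, by rw [hM₃, run_reg _ rfl, hM₂, run_reg _ rfl, r1],
      by rw [hM₃, run_reg _ rfl, r2],
      by rw [hM₃, run_reg _ rfl, hM₂, run_reg _ rfl, hM₁, run_reg _ rfl],
      fun y _ _ _ => Or.inr ⟨0, by rw [v3]; exact progress_zero hB _ _ _⟩⟩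
  rw [e]
  obtain ⟨i1, i2, i3, _, i5, i6⟩ := key
  refine ⟨i1, i2, i3, i5, fun y hvol hy hopt => ?_⟩
  refine (i6 y hvol hy hopt).resolve_right ?_
  rintro ⟨c, h⟩
  rw [zero_add] at h
  exact not_progress ha0 hbl hl hm rfl h

/-- What the loop program achieves. -/
theorem mainCmd_spec (hB : Bᵀ = B) (h0 : ∀ i, B i i = 0) (hρ : Env n l ρ) (hl : 8 ≤ l)
    (hn : n ≤ 2 ^ l) (hadj : ∀ i j : Fin n, M.arr 0 i j = -B i j)
    (hout : -vol B ≤ quad B (M.outVec n)) :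
    (∀ i, quad B (starVec B i) ≤ quad B ((mainCmd.run 4 ρ M).outVec n)) ∧
      ∀ (a : ℕ) (y : Fin n → ℝ), 0 < a → a ≤ l → 0 < vol B → (∀ i, y i * y i = 1) →
        1 / (a : ℝ) * vol B ≤ quad B y →
        vol B / (65536 * (a : ℝ) ^ 3) ≤ quad B ((mainCmd.run 4 ρ M).outVec n) := by
  obtain ⟨b1, r1, z1, o1⟩ := setup_spec (M := M) hρ hadj
  set M₁ := setup.run 4 ρ M with hM₁
  have best1 : Best B M₁ := by
    unfold Best Mem.outVec
    rw [r1, o1]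
    exact hout
  obtain ⟨best2, hstar⟩ := stars_spec hB h0 hρ b1 best1
  have b2 : Base l B (stars.run 4 ρ M₁) := b1.run rfl
  have z2 : (stars.run 4 ρ M₁).reg 3 = 0 := by rw [run_reg _ rfl, z1]
  set M₂ := stars.run 4 ρ M₁ with hM₂
  have e : mainCmd.run 4 ρ M = iter (fun k => guess.run 5 (Function.update ρ 4 k)) l M₂ := by
    rw [mainCmd, run, run, run, show ρ (loopBound true) = l from hρ.three]
  have key := iter_induction (N := l) (m := M₂)
    (f := fun k => guess.run 5 (Function.update ρ 4 k))
    (I := fun k M' => Base l B M' ∧ Best B M' ∧ M'.reg 3 = k ∧ M₂.reg 1 ≤ M'.reg 1 ∧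
      ∀ (a : ℕ) (y : Fin n → ℝ), 0 < a → a ≤ k → 0 < vol B → (∀ i, y i * y i = 1) →
        1 / (a : ℝ) * vol B ≤ quad B y → vol B / (65536 * (a : ℝ) ^ 3) ≤ M'.reg 1)
    ⟨b2, best2, by simpa using z2, le_rfl, fun a y h1 h2 => absurd h1 (by omega)⟩
    (by
      rintro k hk M' ⟨i1, i2, i3, i4, i5⟩
      obtain ⟨g1, g2, g3, g4, g5⟩ := guess_spec hB h0 (hρ.update le_rfl k) hl hn i1 i2 i3 hk
      refine ⟨g1, g2, g3, i4.trans g4, fun a y ha0 hak hvol hy hopt => ?_⟩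
      rcases hak.lt_or_eq with h | rfl
      · exact (i5 a y ha0 (by omega) hvol hy hopt).trans g4
      · exact g5 y hvol hy hopt)
  rw [e]
  obtain ⟨-, k2, -, k4, k5⟩ := key
  exact ⟨fun i => ((hstar i).trans k4).trans k2, fun a y h1 h2 h3 h4 h5 =>
    (k5 a y h1 h2 h3 h4 h5).trans k2⟩

end GuessSpecs

/-- Constants, and the computation of the length of the second kind of loops, which is logarithmic
in the number of vertices. -/
def prologue : Prog :=
  .seq (.instr (.succ 2)) <| .seq (.instr (.succ 3)) <| .seq (.instr (.succ 3)) <|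
  .seq (.instr (.succ 3)) <| .seq (.instr (.succ 3)) <| .seq (.instr (.succ 3)) <|
  .seq (.instr (.succ 3)) <| .seq (.instr (.succ 3)) <| .seq (.instr (.succ 3)) <|
  .seq (.instr (.const 0 1)) <| .seq (.instr (.const 1 1)) <| .seq (.instr (.const 2 1)) <|
  .while (.ilt 4 0) <| .seq (.instr (.op .add 1 1 2)) <|
    .seq (.ite (.rlt 0 1) (.seq (.instr (.op .add 0 0 0)) (.instr (.succ 3))) .skip)
    (.instr (.succ 4))

/-- The invariant of the loop in `prologue`. -/
structure LogInv (n : ℕ) (s₀ : State) (k : ℕ) (s : State) (h : ℕ) : Prop where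
  idx0 : s.idx 0 = n
  idx1 : s.idx 1 = 0
  idx2 : s.idx 2 = 1
  idx3 : s.idx 3 = h + 8
  idx4 : s.idx 4 = k
  reg0 : s.reg 0 = (2 ^ h : ℕ)
  reg1 : s.reg 1 = (k + 1 : ℕ)
  reg2 : s.reg 2 = 1
  le : k + 1 ≤ 2 ^ h
  lt : 2 ^ h < 2 * (k + 1)
  arr : s.arr = s₀.arr

theorem exec_prologue {n : ℕ} {s₀ : State} (h0 : s₀.idx = fun x => if x = 0 then n else 0) :
    ∃ t s h, Exec prologue s₀ t s ∧ t ≤ 6 * n + 13 ∧ LogInv n s₀ n s h := by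
  obtain ⟨t, s, he, ht, h, hI⟩ := exec_while (x := 4) (b := 0) (N := n) (T := 5)
    (p := .seq (.instr (.op .add 1 1 2)) <|
      .seq (.ite (.rlt 0 1) (.seq (.instr (.op .add 0 0 0)) (.instr (.succ 3))) .skip)
      (.instr (.succ 4)))
    (I := fun k s => ∃ h, LogInv n s₀ k s h)
    (fun k s ⟨h, hs⟩ => hs.idx4) (fun k s ⟨h, hs⟩ => hs.idx0)
    (by
      rintro k hk s ⟨h, hs⟩
      obtain ⟨i0, i1, i2, i3, i4, r0, r1, r2, hle, hlt, ha⟩ := hs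
      -- `2^h` is the least power of two that is at least `k + 1`; it is doubled when the count
      -- overtakes it.
      by_cases hc : 2 ^ h < k + 2
      · refine ⟨_, _, .seq (.instr _ _) (.seq (.ite_true ?_ (.seq (.instr _ _) (.instr _ _)))
          (.instr _ _)), by omega, h + 1, ?_⟩
        · simp only [Test.holds, Instr.exec, Op.eval, r1, r2, Function.update_self]
          rw [Function.update_of_ne (by decide), r0]
          exact_mod_cast hc
        · refine ⟨?_, ?_, ?_, ?_, ?_, ?_, ?_, ?_, ?_, ?_, ha⟩ <;>
            try simp [Instr.exec, Function.update, Op.eval, *]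
          · rw [pow_succ]; ring
          · rw [pow_succ]; omega
          · rw [pow_succ]; omega
      · refine ⟨_, _, .seq (.instr _ _) (.seq (.ite_false ?_ (.skip _))
          (.instr _ _)), by omega, h, ?_⟩
        · simp only [Test.holds, Instr.exec, Op.eval, r1, r2, Function.update_self]
          rw [Function.update_of_ne (by decide), r0]
          exact_mod_cast hc
        · refine ⟨?_, ?_, ?_, ?_, ?_, ?_, ?_, ?_, ?_, ?_, ha⟩ <;>
            try simp [Instr.exec, Function.update, Op.eval, *]
          · omega
          · omega)
    ([.succ 2, .succ 3, .succ 3, .succ 3, .succ 3, .succ 3, .succ 3, .succ 3, .succ 3, .const 0 1,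
      .const 1 1, .const 2 1].foldl Instr.exec s₀)
    ⟨0, by constructor <;> first | rfl | simp [Instr.exec, Function.update, h0]⟩
  refine ⟨_, s, h, .seq (.instr _ s₀) <| .seq (.instr _ _) <| .seq (.instr _ _) <|
    .seq (.instr _ _) <| .seq (.instr _ _) <| .seq (.instr _ _) <| .seq (.instr _ _) <|
    .seq (.instr _ _) <| .seq (.instr _ _) <| .seq (.instr _ _) <| .seq (.instr _ _) <|
    .seq (.instr _ _) he, by omega, hI⟩

/-- The algorithm. -/
def cutGainProg : Prog := .seq prologue (mainCmd.comp 4)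

end RealRAM

/-! ### From values of the quadratic form to gains, and the final estimates. -/

namespace CutGain

section Gain

variable {n : ℕ} (G : WGraph n)

theorem abs_quad_le_vol {ι : Type*} [Fintype ι] (B : Matrix ι ι ℝ) {x : ι → ℝ}
    (hx : ∀ i, |x i| ≤ 1) : |quad B x| ≤ vol B := by
  refine (Finset.abs_sum_le_sum_abs _ _).trans (Finset.sum_le_sum fun i _ =>
    (Finset.abs_sum_le_sum_abs _ _).trans (Finset.sum_le_sum fun j _ => ?_))
  rw [abs_mul, abs_mul]
  exact mul_le_of_le_one_right (abs_nonneg _) (mul_le_one₀ (hx i) (abs_nonneg _) (hx j))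

theorem cutVec_mul_self (c : Fin n → Bool) (i : Fin n) :
    WGraph.cutVec c i * WGraph.cutVec c i = 1 := by
  unfold WGraph.cutVec
  split_ifs <;> norm_num

theorem gain_eq (c : Fin n → Bool) :
    G.gain c = quad (-G.adj) (WGraph.cutVec c) / vol (-G.adj) := by
  unfold WGraph.gain
  congr 1
  · simp only [dotProduct, mulVec, quad, Finset.mul_sum, ← Finset.sum_neg_distrib]
    refine Finset.sum_congr rfl fun i _ => Finset.sum_congr rfl fun j _ => ?_
    rw [neg_apply]; ring
  · simp only [WGraph.degMatrix, mulVec_diagonal, dotProduct, vol]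
    refine Finset.sum_congr rfl fun i _ => ?_
    rw [mul_left_comm, cutVec_mul_self, mul_one]
    simp [WGraph.deg, wdeg]

/-- If `a = ⌈1/ε⌉ ≤ l`, then `65536 ≤ 2^17 ≤ e^{17/ε}` and `a ≤ 1 + 1/ε ≤ e^{1/ε}`, which gives the
exponent 17 + 3 = 20. Otherwise `l ≤ 1/ε`, hence `n ≤ 2^l ≤ e^{1/ε}` and the bound `n^{-4}`
suffices. -/
theorem exp_neg_div_le {l n : ℕ} {ε v w : ℝ} (hn0 : 0 < n) (hn : n ≤ 2 ^ l) (hε : 0 < ε)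
    (hε1 : ε ≤ 1) (hv : 0 < v) (h1 : v / (n : ℝ) ^ 4 ≤ w)
    (h2 : ∀ a : ℕ, 0 < a → a ≤ l → 1 / (a : ℝ) ≤ ε → v / (65536 * (a : ℝ) ^ 3) ≤ w) :
    Real.exp (-20 / ε) ≤ w / v := by
  rw [le_div_iff₀ hv]
  have hε2 : 1 ≤ 1 / ε := (one_le_div hε).2 hε1
  have e20 : Real.exp (-20 / ε) = (Real.exp (20 * (1 / ε)))⁻¹ := by
    rw [← Real.exp_neg]; congr 1; ring
  rw [e20]
  by_cases hl : ⌈1 / ε⌉₊ ≤ l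
  · have ha0 : 0 < ⌈1 / ε⌉₊ := Nat.ceil_pos.2 (by positivity)
    have hle : 1 / ε ≤ ⌈1 / ε⌉₊ := Nat.le_ceil _
    have ha0' : (0 : ℝ) < ⌈1 / ε⌉₊ := by exact_mod_cast ha0
    refine le_trans ?_ (h2 _ ha0 hl ((one_div_le ha0' hε).2 hle))
    rw [div_eq_inv_mul v]
    refine mul_le_mul_of_nonneg_right (inv_anti₀ (by positivity) ?_) hv.le
    have h3 : (⌈1 / ε⌉₊ : ℝ) ≤ Real.exp (1 / ε) :=
      (Nat.ceil_lt_add_one (by positivity)).le.trans (Real.add_one_le_exp _)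
    have h4 : (65536 : ℝ) ≤ Real.exp (17 * (1 / ε)) := by
      have h5 : (2 : ℝ) ≤ Real.exp (1 / ε) := by
        have := Real.add_one_le_exp (1 / ε); linarith
      calc (65536 : ℝ) ≤ 2 ^ 17 := by norm_num
        _ ≤ Real.exp (1 / ε) ^ 17 := pow_le_pow_left₀ zero_le_two h5 17
        _ = _ := by rw [← Real.exp_nat_mul]; norm_num
    calc 65536 * (⌈1 / ε⌉₊ : ℝ) ^ 3 ≤ Real.exp (17 * (1 / ε)) * Real.exp (1 / ε) ^ 3 :=
          mul_le_mul h4 (pow_le_pow_left₀ ha0'.le h3 3) (by positivity) (by positivity)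
      _ = Real.exp (20 * (1 / ε)) := by
          rw [← Real.exp_nat_mul, ← Real.exp_add]; congr 1; push_cast; ring
  · refine le_trans ?_ h1
    rw [div_eq_inv_mul v]
    have hn0' : (0 : ℝ) < n := by exact_mod_cast hn0
    refine mul_le_mul_of_nonneg_right (inv_anti₀ (by positivity) ?_) hv.le
    have h3 : (l : ℝ) ≤ 1 / ε := (Nat.lt_ceil.1 (not_le.1 hl)).le
    have h4 : (n : ℝ) ≤ Real.exp (1 / ε) := by
      calc (n : ℝ) ≤ 2 ^ l := by exact_mod_cast hn
        _ ≤ Real.exp 1 ^ l := pow_le_pow_left₀ zero_le_two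
            (by have := Real.add_one_le_exp 1; linarith) l
        _ = Real.exp l := by rw [← Real.exp_nat_mul, mul_one]
        _ ≤ _ := Real.exp_le_exp.2 h3
    calc (n : ℝ) ^ 4 ≤ Real.exp (1 / ε) ^ 4 := pow_le_pow_left₀ hn0'.le h4 4
      _ = Real.exp (4 * (1 / ε)) := by rw [← Real.exp_nat_mul]; norm_num
      _ ≤ _ := Real.exp_le_exp.2 (by linarith)

end Gain

end CutGain

namespace RealRAM

open CutGain

theorem exec_cutGainProg {n : ℕ} (G : WGraph n) (ω : ℕ → Bool) :
    ∃ t s h, Exec cutGainProg (init G ω) t s ∧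
      t ≤ 6 * n + 13 + mainCmd.size * (n + 1) ^ 3 * (h + 8 + 1) ^ 11 ∧
      n + 1 ≤ 2 ^ h ∧ 2 ^ h < 2 * (n + 1) ∧
      (∀ i, quad (-G.adj) (starVec (-G.adj) i) ≤
        quad (-G.adj) (WGraph.cutVec (outputCut n s))) ∧
      ∀ (a : ℕ) (y : Fin n → ℝ), 0 < a → a ≤ h + 8 → 0 < vol (-G.adj) → (∀ i, y i * y i = 1) →
        1 / (a : ℝ) * vol (-G.adj) ≤ quad (-G.adj) y →
        vol (-G.adj) / (65536 * (a : ℝ) ^ 3) ≤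
          quad (-G.adj) (WGraph.cutVec (outputCut n s)) := by
  obtain ⟨t₁, s₁, h, he₁, ht₁, hI⟩ := exec_prologue (n := n) (s₀ := init G ω) rfl
  set M : Mem := ⟨s₁.reg, s₁.arr, s₁.idxArr⟩ with hM
  obtain ⟨t₂, s₂, he₂, ht₂, hH⟩ := mainCmd.exec_comp 4 s₁.idx M s₁ mainCmd_wf le_rfl hI.idx1
    hI.idx2 ⟨fun _ _ => rfl, fun _ _ => rfl, rfl, rfl⟩
  have hρ : Env n (h + 8) s₁.idx := ⟨hI.idx0, hI.idx1, hI.idx2, hI.idx3⟩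
  have hn : n ≤ 2 ^ (h + 8) := by
    have := hI.le
    rw [pow_add]
    omega
  have hcut : (mainCmd.run 4 s₁.idx M).outVec n = WGraph.cutVec (outputCut n s₂) := by
    ext i
    simp [Mem.outVec, WGraph.cutVec, outputCut, hH.out]
  have hspec := mainCmd_spec (B := -G.adj) (M := M) (by rw [transpose_neg, G.symm.eq])
    (fun i => by rw [neg_apply, G.loopless, neg_zero]) hρ (by omega) hn
    (fun i j => by simp [hM, hI.arr, init])
    (abs_le.1 (abs_quad_le_vol _ fun i => by unfold Mem.outVec; split_ifs <;> simp)).1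
  rw [hcut] at hspec
  rw [mainCmd_depth, mainCmd_depth', hI.idx0, hI.idx3] at ht₂
  exact ⟨_, s₂, h, .seq he₁ he₂, Nat.add_le_add ht₁ ht₂, hI.le, hI.lt, hspec⟩

/-- With `x = log (n + 2) ≥ 1/2`, `2^h ≤ 2(n + 1) ≤ (n + 2)²` gives `h ≤ 4x`, and `9 ≤ 18x`;
together this is the constant 22. -/
theorem time_le {n h t S : ℕ} (ht : t ≤ 6 * n + 13 + S * (n + 1) ^ 3 * (h + 8 + 1) ^ 11)
    (hh : 2 ^ h < 2 * (n + 1)) :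
    (t : ℝ) ≤ (13 + S) * 22 ^ 11 * ((n : ℝ) + 1) ^ 3 * Real.log ((n : ℝ) + 2) ^ 11 := by
  have hlog2 : (1 / 2 : ℝ) ≤ Real.log 2 := by have := Real.log_two_gt_d9; linarith
  set x := Real.log ((n : ℝ) + 2) with hx
  have hn : (0 : ℝ) ≤ n := Nat.cast_nonneg n
  have hx2 : Real.log 2 ≤ x := Real.log_le_log (by norm_num) (by linarith)
  have h1 : (h : ℝ) * Real.log 2 ≤ 2 * x := by
    rw [hx, ← Real.log_pow, ← Real.log_rpow (by linarith), Real.rpow_ofNat]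
    refine Real.log_le_log (by positivity) ?_
    have : (2 : ℝ) ^ h ≤ 2 * (n + 1) := by exact_mod_cast hh.le
    nlinarith
  have h2 : (h : ℝ) + 8 + 1 ≤ 22 * x := by
    have : (h : ℝ) * (1 / 2) ≤ 2 * x :=
      (mul_le_mul_of_nonneg_left hlog2 (Nat.cast_nonneg h)).trans h1
    linarith
  have h3 : t ≤ (13 + S) * (n + 1) ^ 3 * (h + 8 + 1) ^ 11 := by
    have h4 : 1 ≤ (h + 8 + 1) ^ 11 := Nat.one_le_pow _ _ (by omega)
    have h5 : 6 * n + 13 ≤ 13 * (n + 1) ^ 3 := by nlinarith [sq_nonneg n]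
    have h6 := Nat.mul_le_mul h5 h4
    rw [add_mul, add_mul]
    omega
  calc (t : ℝ) ≤ (13 + S) * ((n : ℝ) + 1) ^ 3 * ((h : ℝ) + 8 + 1) ^ 11 := by exact_mod_cast h3
    _ ≤ (13 + S) * ((n : ℝ) + 1) ^ 3 * (22 * x) ^ 11 := by gcongr
    _ = _ := by ring

theorem exp_neg_div_le_gain {n : ℕ} (G : WGraph n) (ω : ℕ → Bool) {ε : ℝ} (hε : 0 < ε)
    (hopt : ε ≤ G.maxCutGain) :
    ∃ t s, Exec cutGainProg (init G ω) t s ∧ Real.exp (-20 / ε) ≤ G.gain (outputCut n s) := by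
  obtain ⟨t, s, h, he, -, hle, -, hstar, hphase⟩ := exec_cutGainProg G ω
  refine ⟨t, s, he, ?_⟩
  obtain ⟨c, hc⟩ := exists_eq_ciSup_of_finite (f := G.gain)
  rw [WGraph.maxCutGain, ← hc, gain_eq] at hopt
  rw [gain_eq]
  set B := -G.adj with hBdef
  have hB : Bᵀ = B := by rw [hBdef, transpose_neg, G.symm.eq]
  have h0 : ∀ i, B i i = 0 := fun i => by rw [hBdef, neg_apply, G.loopless, neg_zero]
  -- With zero volume every gain is 0 by the convention for division, contrary to `ε > 0`.
  have hv : 0 < vol B := by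
    refine lt_of_le_of_ne (vol_nonneg B) fun hv => ?_
    rw [← hv, div_zero] at hopt
    linarith
  have hn0 : 0 < n := by
    rcases Nat.eq_zero_or_pos n with rfl | h
    · simp [vol] at hv
    · exact h
  have hε1 : ε ≤ 1 := by
    refine hopt.trans ((div_le_one hv).2 (abs_le.1 (abs_quad_le_vol B fun i => ?_)).2)
    unfold WGraph.cutVec
    split_ifs <;> simp
  obtain ⟨i, hi⟩ := exists_le_quad_starVec hB h0 hv
  rw [Fintype.card_fin] at hi
  rw [le_div_iff₀ hv] at hopt
  refine exp_neg_div_le (l := h + 8) hn0 ?_ hε hε1 hv (hi.trans (hstar i)) fun a ha hal haε =>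
    hphase a _ ha hal hv (cutVec_mul_self c)
      ((mul_le_mul_of_nonneg_right haε hv.le).trans hopt)
  rw [pow_add]
  omega

end RealRAM

theorem theorem12 :
    ∃ (P : RealRAM.Prog) (C K : ℝ) (k : ℕ),
      ∀ (n : ℕ) (G : WGraph n),
        (∀ ω : ℕ → Bool, ∃ (t : ℕ) (s : RealRAM.State),
          RealRAM.Exec P (RealRAM.init G ω) t s ∧
            (t : ℝ) ≤ K * ((n : ℝ) + 1) ^ 3 * Real.log ((n : ℝ) + 2) ^ k) ∧
        ∀ ε : ℝ, 0 < ε → ε ≤ G.maxCutGain →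
          2 / 3 ≤ RealRAM.coinMeasure
            {ω | ∃ (t : ℕ) (s : RealRAM.State),
              RealRAM.Exec P (RealRAM.init G ω) t s ∧
                Real.exp (-C / ε) ≤ G.gain (RealRAM.outputCut n s)} := by
  refine ⟨RealRAM.cutGainProg, 20, (13 + RealRAM.mainCmd.size) * 22 ^ 11, 11, fun n G =>
    ⟨fun ω => ?_, fun ε hε hopt => ?_⟩⟩
  · obtain ⟨t, s, h, he, ht, -, hh, -⟩ := RealRAM.exec_cutGainProg G ω
    exact ⟨t, s, he, RealRAM.time_le ht hh⟩
  · rw [Set.eq_univ_of_forall (s := {ω | _}) fun ω => RealRAM.exp_neg_div_le_gain G ω hε hopt]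
    have : ∀ _ : ℕ, MeasureTheory.IsProbabilityMeasure (PMF.uniformOfFintype Bool).toMeasure :=
      fun _ => inferInstance
    rw [RealRAM.coinMeasure, MeasureTheory.measure_univ]
    exact ENNReal.div_le_of_le_mul (by norm_num)
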